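/- Let $L$ be an even lattice (a free abelian group of finite rank with a nondegenerate symmetric bilinear form $(\cdot,\cdot)$ satisfying $(l,l)\in 2\mathbb{Z}$) of signature $(p,q)$ with $p\le q$, put $\sigma(L)=p-q$, and let $I\subset L$ be a primitive isotropic sublattice of rank $p$ (assumed to exist, i.e. $L$ has Witt index $p$). Let $L^\vee$ be the dual lattice, $A_L=L^\vee/L$ the discriminant group with $q_L([x])=(x,x)/2+\mathbb{Z}$, and $\rho_L$ the Weil representation of $\mathrm{Mp}_2(\mathbb{Z})$ on $\mathbb{C}A_L=\bigoplus_\lambda\mathbb{C}\mathbf{e}_\lambda$, given on the generators $T=(\begin{pmatrix}1&1\\0&1\end{pmatrix},1)$, $S=(\begin{pmatrix}0&-1\\1&0\end{pmatrix},\sqrt{\tau})$ by $\rho_L(T)\mathbf{e}_\lambda=e(q_L(\lambda))\mathbf{e}_\lambda$ and $\rho_L(S)\mathbf{e}_\lambda=\frac{e(-\sigma(L)/8)}{\sqrt{|A_L|}}\sum_{\mu}e(-(\lambda,\mu))\mathbf{e}_\mu$, where $e(z)=\exp(2\pi i z)$. Let $M^!(L)$ be the space of weakly holomorphic modular forms of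 weight $\sigma(L)/2$ and type $\rho_L$, that is, holomorphic $f\colon\mathbb{H}\to\mathbb{C}A_L$, meromorphic at the cusp, with $f(M\tau)=\phi(\tau)^{\sigma(L)}\rho_L(M,\phi)f(\tau)$ for all $(M,\phi)\in\mathrm{Mp}_2(\mathbb{Z})$; and let $M^!$ be the space of scalar-valued weakly holomorphic modular forms of weight $0$ for $\mathrm{SL}_2(\mathbb{Z})$. Let $K=(I^\perp\cap L)/I$, a negative-definite even lattice, and $K^+=K(-1)$, with theta series $\Theta_{K^+}(\tau)=\sum_{l\in K^\vee}q^{-(l,l)/2}\mathbf{e}_{[l]}$, $q^n=e^{2\pi i n\tau}$. Let $I^*=I_{\mathbb{Q}}\cap L^\vee$ and let $L^*=L+I^*$, an even overlattice of $L$. Identify $A_{L^*}$ with $A_K$ by sending the class of $x\in (L^*)^\vee\cap I^\perp$ to the class of $x$ modulo $I_{\mathbb{Q}}$, and let ${\downarrow^L_K}\colon\mathbb{C}A_L\to\mathbb{C}A_{L^*}=\mathbb{C}A_K$ be the linear map sending $\mathbf{e}_{[x]}$ to $\mathbf{e}_{[x]}$ if $x\in (L^*)^\vee$ and to $0$ if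 $x\in L^\vee\setminus (L^*)^\vee$. For $f\in M^!(L)$ put $\xi(f)=\langle f{\downarrow^L_K},\Theta_{K^+}\rangle=\sum_{\lambda\in A_K}(f{\downarrow^L_K})_\lambda\,(\Theta_{K^+})_\lambda$, and put $\Theta^\perp=\{f\in M^!(L)\mid \xi(f)=0\}$. Then $\xi$ maps $M^!(L)$ to $M^!$, and $M^!(L)$ is closed under the $\Theta$-product $f_1*f_2=\xi(f_1)\cdot f_2$. Moreover: (1) $M^!(L)$ with the product $*$ has a left unit element (an element $u$ with $u*f=f$ for all $f\in M^!(L)$) if and only if $\xi\colon M^!(L)\to M^!$ is surjective. This always holds when $\sigma(L)=0$. (2) If there exists $f\in M^!(L)\setminus\Theta^\perp$ with $f(\tau)=o(q^{-1})$ as $\mathrm{Im}\,\tau\to\infty$, then $M^!(L)$ has a left unit element. Such an $f$ exists only when $|\sigma(L)|<24$. -/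

import Mathlib

open UpperHalfPlane Filter Asymptotics
open scoped MatrixGroups Manifold Topology

noncomputable section

namespace ThetaProduct

/-! ### The metaplectic group `Mp₂(ℤ)` -/

/-- Elements of `Mp₂(ℤ)`: pairs `(M, φ)` with `M = (a b; c d) ∈ SL₂(ℤ)` and `φ` a holomorphic
function on the upper half plane with `φ(τ)² = cτ + d`. -/
@[ext]
structure Mp2Z where
  mat : SL(2, ℤ)
  phi : ℍ → ℂ
  holo : MDifferentiable 𝓘(ℂ) 𝓘(ℂ) phi
  sq : ∀ τ : ℍ, phi τ ^ 2 = (mat 1 0 : ℂ) * τ + (mat 1 1 : ℂ)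

namespace Mp2Z

theorem mdifferentiable_smul (g : SL(2, ℤ)) :
    MDifferentiable 𝓘(ℂ) 𝓘(ℂ) (fun τ : ℍ ↦ g • τ) :=
  UpperHalfPlane.mdifferentiable_smul (g := (g : GL (Fin 2) ℝ)) (by simp)

theorem sq_eq_denom (x : Mp2Z) (τ : ℍ) : x.phi τ ^ 2 = denom (x.mat : GL (Fin 2) ℝ) τ := by
  rw [x.sq, ModularGroup.denom_apply]

theorem phi_ne_zero (x : Mp2Z) (τ : ℍ) : x.phi τ ≠ 0 := fun h ↦
  denom_ne_zero (x.mat : GL (Fin 2) ℝ) τ (by rw [← x.sq_eq_denom, h]; simp)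

theorem denom_mul (g h : SL(2, ℤ)) (τ : ℍ) :
    denom ((g * h : SL(2, ℤ)) : GL (Fin 2) ℝ) τ
      = denom (g : GL (Fin 2) ℝ) (h • τ : ℍ) * denom (h : GL (Fin 2) ℝ) τ := by
  rw [map_mul, map_mul, denom_cocycle _ _ τ.im_ne_zero, ModularGroup.sl_moeb,
    coe_smul_of_det_pos (by simp)]

instance : One Mp2Z where
  one := ⟨1, fun _ ↦ 1, mdifferentiable_const, fun τ ↦ by simp⟩

/-- `(M, φ)(N, ψ) = (MN, φ(Nτ)ψ(τ))`. -/
instance : Mul Mp2Z where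
  mul x y :=
    { mat := x.mat * y.mat
      phi := fun τ ↦ x.phi (y.mat • τ) * y.phi τ
      holo := (x.holo.comp (mdifferentiable_smul y.mat)).mul y.holo
      sq := fun τ ↦ by
        rw [mul_pow, sq_eq_denom, sq_eq_denom, ← ModularGroup.denom_apply, denom_mul] }

instance : Inv Mp2Z where
  inv x :=
    { mat := x.mat⁻¹
      phi := fun τ ↦ (x.phi (x.mat⁻¹ • τ))⁻¹
      holo := by
        have := (x.holo.comp (mdifferentiable_smul x.mat⁻¹))
        rw [UpperHalfPlane.mdifferentiable_iff] at this ⊢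
        exact this.inv fun z _ ↦ x.phi_ne_zero _
      sq := fun τ ↦ by
        have h := denom_mul x.mat x.mat⁻¹ τ
        rw [inv_pow, sq_eq_denom, ← ModularGroup.denom_apply]
        rw [mul_inv_cancel] at h
        refine inv_eq_of_mul_eq_one_right ?_
        rw [← h]
        simp [denom] }

theorem one_mat : (1 : Mp2Z).mat = 1 := rfl
theorem one_phi : (1 : Mp2Z).phi = fun _ ↦ 1 := rfl
theorem mul_mat (x y : Mp2Z) : (x * y).mat = x.mat * y.mat := rfl
theorem mul_phi (x y : Mp2Z) : (x * y).phi = fun τ ↦ x.phi (y.mat • τ) * y.phi τ := rfl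
theorem inv_mat (x : Mp2Z) : (x⁻¹).mat = x.mat⁻¹ := rfl
theorem inv_phi (x : Mp2Z) : (x⁻¹).phi = fun τ ↦ (x.phi (x.mat⁻¹ • τ))⁻¹ := rfl

instance : Group Mp2Z where
  mul_assoc x y z := by
    apply Mp2Z.ext
    · simp only [mul_mat, mul_assoc]
    · funext τ; simp only [mul_mat, mul_phi, mul_smul, mul_assoc]
  one_mul x := by
    apply Mp2Z.ext
    · simp only [mul_mat, one_mat, one_mul]
    · funext τ; simp only [mul_phi, one_phi, one_mul]
  mul_one x := by
    apply Mp2Z.ext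
    · simp only [mul_mat, one_mat, mul_one]
    · funext τ; simp only [mul_phi, one_phi, one_mat, one_smul, mul_one]
  inv_mul_cancel x := by
    apply Mp2Z.ext
    · simp only [mul_mat, inv_mat, one_mat, inv_mul_cancel]
    · funext τ
      simp only [mul_phi, inv_phi, one_phi, inv_smul_smul]
      exact inv_mul_cancel₀ (x.phi_ne_zero τ)

/-- The generator `T = ((1 1; 0 1), 1)`. -/
def T : Mp2Z where
  mat := ModularGroup.T
  phi := fun _ ↦ 1
  holo := mdifferentiable_const
  sq := fun τ ↦ by simp [ModularGroup.T]

/-- The generator `S = ((0 -1; 1 0), √τ)`, with the principal branch of the square root. -/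
def S : Mp2Z where
  mat := ModularGroup.S
  phi := fun τ ↦ (τ : ℂ) ^ (2⁻¹ : ℂ)
  holo := by
    rw [UpperHalfPlane.mdifferentiable_iff]
    have h : DifferentiableOn ℂ (fun z : ℂ ↦ z ^ (2⁻¹ : ℂ)) {z | 0 < z.im} := fun z hz ↦
      (differentiableAt_id.cpow_const
        (Or.inr (ne_of_gt hz))).differentiableWithinAt
    refine h.congr fun z hz ↦ ?_
    simp only [Function.comp_apply, ofComplex_apply_of_im_pos hz]
  sq := fun τ ↦ by
    have := Complex.cpow_nat_inv_pow (τ : ℂ) (n := 2) two_ne_zero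
    simp only [Nat.cast_ofNat] at this
    rw [this]
    simp [ModularGroup.S]

end Mp2Z

/-- `e(x) = exp(2πix)` on `ℚ/ℤ`. -/
def e : AddCircle (1 : ℚ) → ℂ :=
  Function.Periodic.lift (f := fun x : ℚ ↦ Complex.exp (2 * Real.pi * Complex.I * (x : ℂ)))
    (c := 1) (fun x ↦ by
      simp only [Rat.cast_add, Rat.cast_one, mul_add, mul_one]
      exact Complex.exp_periodic _)

/-- `q^r = exp(2πirτ)` for a rational exponent `r`. -/
def qpow (r : ℚ) (τ : ℍ) : ℂ := Complex.exp (2 * Real.pi * Complex.I * (r : ℂ) * (τ : ℂ))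

/-! ### Even lattices and discriminant forms -/

/-- An even lattice, realized as a full `ℤ`-lattice in its rational quadratic space `V = L ⊗ ℚ`,
with `(x, x) ∈ 2ℤ` for all `x ∈ L`. (By polarization the form is then integral on `L`.) -/
structure EvenLattice (V : Type*) [AddCommGroup V] [Module ℚ V] where
  form : LinearMap.BilinForm ℚ V
  symm : form.IsSymm
  nondeg : form.Nondegenerate
  carrier : Submodule ℤ V
  fg : carrier.FG
  span_eq_top : Submodule.span ℚ (carrier : Set V) = ⊤
  even : ∀ x ∈ carrier, ∃ n : ℤ, form x x = 2 * n

namespace EvenLattice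

variable {V : Type*} [AddCommGroup V] [Module ℚ V] (L : EvenLattice V)

/-- Signature `(p, q)`: the number `p`. -/
def sigP : ℕ := sigPos L.form.toQuadraticMap

/-- Signature `(p, q)`: the number `q`. -/
def sigQ : ℕ := sigNeg L.form.toQuadraticMap

/-- `σ(L) = p - q`. -/
def sigma : ℤ := (L.sigP : ℤ) - (L.sigQ : ℤ)

/-- The dual lattice `L^∨ = {x ∈ V | (x, L) ⊂ ℤ}`. -/
def dual : Submodule ℤ V := L.form.dualSubmodule L.carrier

/-- The discriminant group `A_L = L^∨ / L`. -/
abbrev A : Type _ := L.dual ⧸ L.carrier.submoduleOf L.dual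

/-- The class in `A_L` of a vector of `L^∨`. -/
def cls (x : L.dual) : L.A := Submodule.Quotient.mk x

theorem finiteDimensional (L : EvenLattice V) : FiniteDimensional ℚ V := by
  obtain ⟨s, hs⟩ := L.fg
  refine ⟨s, ?_⟩
  rw [← L.span_eq_top, ← hs]
  exact (Submodule.span_span_of_tower ℤ ℚ (s : Set V)).symm

theorem exists_smul_mem (x : V) : ∃ n : ℤ, n ≠ 0 ∧ n • x ∈ L.carrier := by
  have hx : x ∈ Submodule.span ℚ (L.carrier : Set V) := by rw [L.span_eq_top]; trivial
  induction hx using Submodule.span_induction with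
  | mem x h => exact ⟨1, one_ne_zero, by simpa using h⟩
  | zero => exact ⟨1, one_ne_zero, by simp⟩
  | add x y _ _ hx hy =>
    obtain ⟨n, hn, hx⟩ := hx
    obtain ⟨m, hm, hy⟩ := hy
    refine ⟨n * m, mul_ne_zero hn hm, ?_⟩
    rw [smul_add]
    refine add_mem ?_ ?_
    · rw [mul_comm, mul_smul]; exact L.carrier.smul_mem m hx
    · rw [mul_smul]; exact L.carrier.smul_mem n hy
  | smul a x _ hx =>
    obtain ⟨n, hn, hx⟩ := hx
    refine ⟨n * a.den, mul_ne_zero hn (by exact_mod_cast a.den_ne_zero), ?_⟩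
    have : (n * (a.den : ℤ)) • a • x = a.num • n • x := by
      rw [← Int.cast_smul_eq_zsmul ℚ (n * (a.den : ℤ)), ← Int.cast_smul_eq_zsmul ℚ a.num,
        ← Int.cast_smul_eq_zsmul ℚ n, smul_smul, smul_smul]
      congr 1
      push_cast
      rw [mul_assoc, Rat.den_mul_eq_num, mul_comm]
    rw [this]
    exact L.carrier.smul_mem _ hx

theorem dual_fg : L.dual.FG := by
  classical
  have := L.finiteDimensional
  let b := Module.Basis.ofSpan L.span_eq_top.ge
  have hb : Set.range b ⊆ (L.carrier : Set V) := Module.Basis.ofSpan_subset L.span_eq_top.ge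
  have : Finite _ := Module.Finite.finite_basis b
  have h1 : L.dual ≤ L.form.dualSubmodule (Submodule.span ℤ (Set.range b)) :=
    fun x hx y hy ↦ hx y (Submodule.span_le.mpr hb hy)
  rw [LinearMap.BilinForm.dualSubmodule_span_of_basis L.form L.nondeg b] at h1
  exact (Submodule.fg_span (Set.finite_range _)).of_le h1

instance : Finite L.A := by
  have : Module.Finite ℤ L.dual := Module.Finite.iff_fg.mpr L.dual_fg
  refine Module.finite_of_fg_torsion L.A ?_
  intro x
  induction x using Submodule.Quotient.induction_on with
  | H x =>
    obtain ⟨n, hn, h⟩ := L.exists_smul_mem (x : V)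
    refine ⟨⟨n, mem_nonZeroDivisors_of_ne_zero hn⟩, ?_⟩
    exact (Submodule.Quotient.mk_eq_zero _).mpr h

instance : Fintype L.A := Fintype.ofFinite _

theorem dual_pair {x y : V} (hx : x ∈ L.dual) (hy : y ∈ L.carrier) :
    ∃ n : ℤ, L.form x y = n := by
  obtain ⟨n, hn⟩ := Submodule.mem_one.mp (hx y hy)
  exact ⟨n, by simpa using hn.symm⟩

/-- The discriminant form `q_L([x]) = (x, x)/2 + ℤ`. -/
def q (a : L.A) : AddCircle (1 : ℚ) :=
  Quotient.liftOn' a (fun x ↦ ((L.form x x / 2 : ℚ) : AddCircle (1 : ℚ))) (by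
    intro x y hxy
    have hm : (x : V) - y ∈ L.carrier :=
      (Submodule.quotientRel_def (L.carrier.submoduleOf L.dual)).mp hxy
    obtain ⟨a, ha⟩ := L.even _ hm
    obtain ⟨b, hb⟩ := L.dual_pair y.2 hm
    have h := L.symm.eq (x : V) y
    simp only [map_sub, LinearMap.sub_apply] at ha hb h
    refine (QuotientAddGroup.eq_iff_sub_mem).mpr
      (AddSubgroup.mem_zmultiples_iff.mpr ⟨a + b, ?_⟩)
    simp only [zsmul_eq_mul, mul_one]
    push_cast
    linarith)

/-- The bilinear form `([x], [y]) = (x, y) + ℤ` on `A_L`. -/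
def pair (a b : L.A) : AddCircle (1 : ℚ) :=
  Quotient.liftOn₂' a b (fun x y ↦ ((L.form x y : ℚ) : AddCircle (1 : ℚ))) (by
    intro x y x' y' hx hy
    have hm : (x : V) - x' ∈ L.carrier :=
      (Submodule.quotientRel_def (L.carrier.submoduleOf L.dual)).mp hx
    have hm' : (y : V) - y' ∈ L.carrier :=
      (Submodule.quotientRel_def (L.carrier.submoduleOf L.dual)).mp hy
    obtain ⟨a, ha⟩ := L.dual_pair y.2 hm
    obtain ⟨b, hb⟩ := L.dual_pair x'.2 hm'
    have h := L.symm.eq (x : V) y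
    have h' := L.symm.eq (x' : V) y
    simp only [map_sub] at ha hb h h'
    refine (QuotientAddGroup.eq_iff_sub_mem).mpr
      (AddSubgroup.mem_zmultiples_iff.mpr ⟨a + b, ?_⟩)
    simp only [zsmul_eq_mul, mul_one]
    push_cast
    linarith)

/-! ### The Weil representation and weakly holomorphic modular forms

`ℂA_L` is the space of functions `L.A → ℂ`; the basis vector `e_λ` is `Pi.single λ 1`. -/

/-- `ρ_L(T) e_λ = e(q(λ)) e_λ`. -/
def weilT : Module.End ℂ (L.A → ℂ) where
  toFun v := fun l ↦ e (L.q l) * v l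
  map_add' v w := by funext l; simp [mul_add]
  map_smul' c v := by funext l; simp [mul_left_comm]

/-- `ρ_L(S) e_λ = e(-σ(L)/8) / √|A_L| · ∑_μ e(-(λ, μ)) e_μ`. -/
def weilS : Module.End ℂ (L.A → ℂ) where
  toFun v := fun m ↦
    e ((-(L.sigma : ℚ) / 8 : ℚ) : AddCircle (1 : ℚ)) / (Real.sqrt (Fintype.card L.A) : ℂ)
      * ∑ l, e (-(L.pair l m)) * v l
  map_add' v w := by funext m; simp [mul_add, Finset.sum_add_distrib]
  map_smul' c v := by
    funext m
    simp only [Pi.smul_apply, smul_eq_mul, RingHom.id_apply]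
    rw [mul_left_comm, Finset.mul_sum (a := c)]
    congr 1
    exact Finset.sum_congr rfl fun l _ ↦ by ring

/-- The graph of the Weil representation `ρ_L : Mp₂(ℤ) → GL(ℂA_L)`. Since `ρ_L` is the
representation determined by its values on `T` and `S`, which generate `Mp₂(ℤ)` (also as a monoid,
because `S⁸ = 1` and `(ST)³ = S²`), its graph is generated by `(T, ρ_L(T))` and `(S, ρ_L(S))`. -/
def weilGraph : Submonoid (Mp2Z × Module.End ℂ (L.A → ℂ)) :=
  Submonoid.closure {(Mp2Z.T, L.weilT), (Mp2Z.S, L.weilS)}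

end EvenLattice

/-- Meromorphy at the cusp `i∞`, for a holomorphic function on `ℍ` which is periodic under some
`τ ↦ τ + N`: it is `O(q^{-n})` for some `n`. -/
def MeromorphicAtCusp (f : ℍ → ℂ) : Prop :=
  ∃ n : ℕ, f =O[atImInfty] qpow (-(n : ℚ))

theorem qpow_isBigO {m n : ℕ} (h : m ≤ n) :
    qpow (-(m : ℚ)) =O[atImInfty] qpow (-(n : ℚ)) := by
  refine IsBigO.of_bound 1 (Eventually.of_forall fun τ ↦ ?_)
  simp only [qpow, Complex.norm_exp, one_mul]
  refine Real.exp_le_exp.mpr ?_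
  have h1 : (m : ℝ) ≤ n := by exact_mod_cast h
  have h2 := τ.im_pos
  have h3 := Real.pi_pos
  have key : ∀ k : ℕ, (2 * (Real.pi : ℂ) * Complex.I * ((-(k : ℚ) : ℚ) : ℂ) * (τ : ℂ)).re
      = 2 * Real.pi * τ.im * k := by
    intro k
    have : (2 * (Real.pi : ℂ) * Complex.I * ((-(k : ℚ) : ℚ) : ℂ) * (τ : ℂ))
        = ((2 * Real.pi * -(k : ℝ) : ℝ) : ℂ) * (Complex.I * (τ : ℂ)) := by
      push_cast; ring
    rw [this, Complex.re_ofReal_mul]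
    simp
    ring
  rw [key, key]
  gcongr

theorem MeromorphicAtCusp.add {f g : ℍ → ℂ} (hf : MeromorphicAtCusp f)
    (hg : MeromorphicAtCusp g) : MeromorphicAtCusp (fun τ ↦ f τ + g τ) := by
  obtain ⟨m, hm⟩ := hf
  obtain ⟨n, hn⟩ := hg
  exact ⟨max m n, (hm.trans (qpow_isBigO (le_max_left m n))).add
    (hn.trans (qpow_isBigO (le_max_right m n)))⟩

theorem MeromorphicAtCusp.const_mul {f : ℍ → ℂ} (c : ℂ) (hf : MeromorphicAtCusp f) :
    MeromorphicAtCusp (fun τ ↦ c * f τ) := by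
  obtain ⟨m, hm⟩ := hf
  exact ⟨m, hm.const_mul_left c⟩

theorem meromorphicAtCusp_zero : MeromorphicAtCusp (fun _ ↦ 0) :=
  ⟨0, isBigO_zero _ _⟩

/-- `M^!`: the scalar-valued weakly holomorphic modular forms of weight `0` for `SL₂(ℤ)`. -/
def MShriek : Submodule ℂ (ℍ → ℂ) where
  carrier := {f | MDifferentiable 𝓘(ℂ) 𝓘(ℂ) f ∧ (∀ (g : SL(2, ℤ)) (τ : ℍ), f (g • τ) = f τ) ∧
    MeromorphicAtCusp f}
  zero_mem' := ⟨mdifferentiable_const, fun _ _ ↦ rfl, meromorphicAtCusp_zero⟩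
  add_mem' := fun hf hg ↦ ⟨hf.1.add hg.1, fun g τ ↦ by
    simp only [Pi.add_apply, hf.2.1, hg.2.1], hf.2.2.add hg.2.2⟩
  smul_mem' := fun c f hf ↦ ⟨hf.1.const_smul c, fun g τ ↦ by
    simp only [Pi.smul_apply, hf.2.1], hf.2.2.const_mul c⟩

namespace EvenLattice

variable {V : Type*} [AddCommGroup V] [Module ℚ V] (L : EvenLattice V)

/-- `M^!(L)`: the weakly holomorphic modular forms of weight `k = σ(L)/2` and type `ρ_L`, i.e.
holomorphic `f : ℍ → ℂA_L` with `f(Mτ) = φ(τ)^{2k} ρ_L(M, φ) f(τ)` for all `(M, φ) ∈ Mp₂(ℤ)`,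
meromorphic at the cusp. -/
def MShriek : Submodule ℂ (ℍ → L.A → ℂ) where
  carrier := {f | (∀ l, MDifferentiable 𝓘(ℂ) 𝓘(ℂ) (fun τ ↦ f τ l)) ∧
    (∀ x ∈ L.weilGraph, ∀ τ : ℍ, f (x.1.mat • τ) = x.1.phi τ ^ L.sigma • x.2 (f τ)) ∧
    ∀ l, MeromorphicAtCusp (fun τ ↦ f τ l)}
  zero_mem' := ⟨fun _ ↦ mdifferentiable_const, fun x _ τ ↦ by simp,
    fun _ ↦ meromorphicAtCusp_zero⟩
  add_mem' := fun hf hg ↦ ⟨fun l ↦ (hf.1 l).add (hg.1 l), fun x hx τ ↦ by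
    simp only [Pi.add_apply, hf.2.1 x hx, hg.2.1 x hx, map_add, smul_add],
    fun l ↦ (hf.2.2 l).add (hg.2.2 l)⟩
  smul_mem' := fun c f hf ↦ ⟨fun l ↦ (hf.1 l).const_smul c, fun x hx τ ↦ by
    simp only [Pi.smul_apply, hf.2.1 x hx, map_smul, smul_comm c],
    fun l ↦ (hf.2.2 l).const_mul c⟩

/-- The theta series `Θ_{L(-1)}(τ) = ∑_{x ∈ L^∨} q^{-(x, x)/2} e_{[x]}` of `L(-1)`, for `L` negative
definite. Its components are indexed by `A_{L(-1)}`, which is the same group as `A_L`. -/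
def thetaNeg (τ : ℍ) (l : L.A) : ℂ :=
  ∑' x : {x : L.dual // L.cls x = l}, qpow (-(L.form x.1 x.1) / 2) τ

open Classical in
/-- The pushforward `↓ : ℂA_L → ℂA_{L'}` to an even overlattice `L ⊂ L' ⊂ L'^∨ ⊂ L^∨`: `e_μ` goes to
`e_{p(μ)}` if `μ ∈ (L'/L)^⊥ = L'^∨/L`, where `p : L'^∨/L → L'^∨/L'`, and to `0` otherwise. -/
def push (L' : EvenLattice V) (v : L.A → ℂ) : L'.A → ℂ := fun l ↦
  ∑ m, if ∃ (x : V) (h : x ∈ L.dual) (h' : x ∈ L'.dual), L.cls ⟨x, h⟩ = m ∧ L'.cls ⟨x, h'⟩ = l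
    then v m else 0

/-- A maximal isotropic sublattice: a primitive isotropic sublattice of rank `p`, where `L` has
signature `(p, q)`. -/
structure MaximalIsotropic where
  carrier : Submodule ℤ V
  le : carrier ≤ L.carrier
  isotropic : ∀ x ∈ carrier, ∀ y ∈ carrier, L.form x y = 0
  primitive : ∀ (n : ℤ) (x : V), n ≠ 0 → x ∈ L.carrier → n • x ∈ carrier → x ∈ carrier
  finrank_eq : Module.finrank ℤ carrier = L.sigP

namespace MaximalIsotropic

variable {L} (I : L.MaximalIsotropic)

/-- `I_ℚ`. -/
def rat : Submodule ℚ V := Submodule.span ℚ (I.carrier : Set V)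

theorem rat_isotropic {x y : V} (hx : x ∈ I.rat) (hy : y ∈ I.rat) : L.form x y = 0 := by
  induction hx using Submodule.span_induction with
  | zero => simp
  | add x x' _ _ h h' => simp [h, h']
  | smul a x _ h => simp [h]
  | mem x hx =>
    induction hy using Submodule.span_induction with
    | zero => simp
    | add x x' _ _ h h' => simp [h, h']
    | smul a x _ h => simp [h]
    | mem y hy => exact I.isotropic x hx y hy

/-- `I^* = I_ℚ ∩ L^∨`. -/
def star : Submodule ℤ V := I.rat.restrictScalars ℤ ⊓ L.dual

/-- The overlattice `L^* = ⟨L, I^*⟩` of `L`. -/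
def overlattice : EvenLattice V where
  form := L.form
  symm := L.symm
  nondeg := L.nondeg
  carrier := L.carrier ⊔ I.star
  fg := L.fg.sup (L.dual_fg.of_le inf_le_right)
  span_eq_top := by
    rw [eq_top_iff, ← L.span_eq_top]
    exact Submodule.span_mono (SetLike.coe_subset_coe.mpr le_sup_left)
  even := by
    intro z hz
    obtain ⟨x, hx, y, hy, rfl⟩ := Submodule.mem_sup.mp hz
    obtain ⟨a, ha⟩ := L.even x hx
    obtain ⟨b, hb⟩ := L.dual_pair hy.2 hx
    have h0 : L.form y y = 0 := I.rat_isotropic hy.1 hy.1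
    have h := L.symm.eq x y
    refine ⟨a + b, ?_⟩
    simp only [map_add, LinearMap.add_apply] at h ⊢
    push_cast
    linarith

/-- `I^⊥` in `V`. -/
def perp : Submodule ℚ V := L.form.orthogonal I.rat

/-- `K ⊗ ℚ = I^⊥ / I_ℚ`. -/
abbrev W : Type _ := I.perp ⧸ I.rat.submoduleOf I.perp

theorem form_perp_left {x y : V} (hx : x ∈ I.rat) (hy : y ∈ I.perp) : L.form x y = 0 := hy x hx

theorem form_perp_right {x y : V} (hx : x ∈ I.perp) (hy : y ∈ I.rat) : L.form x y = 0 := by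
  have := L.symm.eq y x
  rw [hx y hy] at this
  exact this.symm

/-- The bilinear form on `I^⊥ / I_ℚ` induced from that of `V`. -/
def formW : LinearMap.BilinForm ℚ I.W :=
  LinearMap.mk₂ ℚ
    (fun a b ↦ Quotient.liftOn₂' a b (fun x y ↦ L.form x y) (by
      intro x y x' y' hx hy
      have hm : (x : V) - x' ∈ I.rat :=
      (Submodule.quotientRel_def (I.rat.submoduleOf I.perp)).mp hx
      have hm' : (y : V) - y' ∈ I.rat :=
      (Submodule.quotientRel_def (I.rat.submoduleOf I.perp)).mp hy
      have h1 := I.form_perp_left hm y.2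
      have h2 := I.form_perp_right x'.2 hm'
      simp only [map_sub, LinearMap.sub_apply] at h1 h2 ⊢
      linarith))
    (by rintro ⟨a⟩ ⟨b⟩ ⟨c⟩; exact LinearMap.map_add₂ L.form a.1 b.1 c.1)
    (by rintro c ⟨a⟩ ⟨b⟩; exact LinearMap.map_smul₂ L.form c a.1 b.1)
    (by rintro ⟨a⟩ ⟨b⟩ ⟨c⟩; exact map_add (L.form a.1) b.1 c.1)
    (by rintro c ⟨a⟩ ⟨b⟩; exact map_smul (L.form a.1) c b.1)

/-- The projection `I^⊥ → I^⊥ / I_ℚ`. -/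
def proj : I.perp →ₗ[ℚ] I.W := Submodule.mkQ _

theorem formW_proj (x y : I.perp) : I.formW (I.proj x) (I.proj y) = L.form x y := rfl

theorem proj_surjective : Function.Surjective I.proj := Submodule.mkQ_surjective _

/-- The lattice `K = (I^⊥ ∩ L) / I`, in `K ⊗ ℚ = I^⊥ / I_ℚ`. -/
def K : EvenLattice I.W where
  form := I.formW
  symm := ⟨fun a b ↦ by
    obtain ⟨x, rfl⟩ := I.proj_surjective a
    obtain ⟨y, rfl⟩ := I.proj_surjective b
    exact L.symm.eq x.1 y.1⟩
  nondeg := by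
    have := L.finiteDimensional
    have key : ∀ x : I.perp, (∀ y : I.perp, L.form y x = 0) → I.proj x = 0 := by
      intro x hx
      have : (x : V) ∈ L.form.orthogonal (L.form.orthogonal I.rat) :=
        fun y hy ↦ hx ⟨y, hy⟩
      rw [LinearMap.BilinForm.orthogonal_orthogonal L.nondeg L.symm.isRefl] at this
      exact (Submodule.Quotient.mk_eq_zero _).mpr this
    constructor
    · intro a ha
      obtain ⟨x, rfl⟩ := I.proj_surjective a
      refine key x fun y ↦ ?_
      have h := L.symm.eq x.1 y.1
      rw [← I.formW_proj, ha] at h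
      exact h.symm
    · intro a ha
      obtain ⟨x, rfl⟩ := I.proj_surjective a
      exact key x fun y ↦ ha (I.proj y)
  carrier := (L.carrier.comap (I.perp.subtype.restrictScalars ℤ)).map (I.proj.restrictScalars ℤ)
  fg := by
    refine Submodule.FG.map _ ?_
    refine Submodule.fg_of_fg_map_injective (I.perp.subtype.restrictScalars ℤ)
      Subtype.val_injective ?_
    exact L.fg.of_le (Submodule.map_comap_le _ _)
  span_eq_top := by
    rw [eq_top_iff]
    rintro a -
    obtain ⟨x, rfl⟩ := I.proj_surjective a
    obtain ⟨n, hn, h⟩ := L.exists_smul_mem (x : V)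
    have h2 : I.proj (n • x) ∈ Submodule.span ℚ
        (((L.carrier.comap (I.perp.subtype.restrictScalars ℤ)).map
          (I.proj.restrictScalars ℤ) : Submodule ℤ I.W) : Set I.W) :=
      Submodule.subset_span ⟨n • x, h, rfl⟩
    have hn' : (n : ℚ) ≠ 0 := by exact_mod_cast hn
    rw [map_zsmul, ← Int.cast_smul_eq_zsmul ℚ] at h2
    exact (Submodule.smul_mem_iff _ hn').mp h2
  even := by
    rintro a ⟨x, hx, rfl⟩
    exact L.even x.1 hx

open Classical in
/-- The identification `ℂA_{L^*} = ℂA_K` induced by the canonical isometry `A_{L^*} ≃ A_K`. The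
isometry comes from any splitting `L^* = φ(pU) ⊕ φ(pU)^⊥` with `φ(I_p) = I^*` and
`φ(pU)^⊥ ≃ K` the projection modulo `I^*`; so it sends the class of `x ∈ L^{*∨} ∩ I^⊥` to the class
of `x mod I_ℚ` in `A_K`, and every class of `A_{L^*}` contains such an `x`. -/
def ident (v : I.overlattice.A → ℂ) : I.K.A → ℂ := fun l ↦
  ∑ m, if ∃ (x : I.perp) (h : (x : V) ∈ I.overlattice.dual) (h' : I.proj x ∈ I.K.dual),
      I.overlattice.cls ⟨x, h⟩ = m ∧ I.K.cls ⟨I.proj x, h'⟩ = l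
    then v m else 0

/-- `↓^L_K : ℂA_L → ℂA_{L^*} = ℂA_K`. -/
def down (v : L.A → ℂ) : I.K.A → ℂ := I.ident (L.push I.overlattice v)

/-- `ξ(f) = ⟨f↓^L_K, Θ_{K^+}⟩` with `K^+ = K(-1)`. -/
def xi (f : ℍ → L.A → ℂ) : ℍ → ℂ := fun τ ↦ ∑ l, I.down (f τ) l * I.K.thetaNeg τ l

/-- The `Θ`-product `f₁ * f₂ = ξ(f₁) · f₂` with respect to `I`. -/
def thetaProd (f₁ f₂ : ℍ → L.A → ℂ) : ℍ → L.A → ℂ := fun τ ↦ I.xi f₁ τ • f₂ τ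

/-- `Θ^⊥ = {f ∈ M^!(L) | ξ(f) = 0}`. -/
def thetaPerp : Set (ℍ → L.A → ℂ) := {f | f ∈ L.MShriek ∧ I.xi f = 0}

/-- `M^!(L)`, with the `Θ`-product, has a left unit element. -/
def HasLeftUnit : Prop := ∃ u ∈ L.MShriek, ∀ f ∈ L.MShriek, I.thetaProd u f = f

end MaximalIsotropic

/-- `f = o(q^{-1})` as `τ → i∞`. -/
def IsLittleOQInv (f : ℍ → L.A → ℂ) : Prop :=
  ∀ l, (fun τ ↦ f τ l) =o[atImInfty] qpow (-1)

end EvenLattice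

end ThetaProduct

end

noncomputable section

namespace ThetaProduct

/-! ### Bicharacters on finite abelian groups and Lagrangian correspondences -/

/-! Moving `↓` onto the theta series gives `ξ(f) = ∑ a, f_a θ_a`, where `θ_a` (`thetaUp`) sums over
the image in `K^∨` of the vectors of `L^∨ ∩ I^⊥` of class `a` (`xi_eq`). Maximality of `I` makes `K`
negative definite of rank `n = -σ(L)`, so `θ` has weight `n/2` and transforms dually to `ρ_L`; hence
`ξ(f)` is invariant of weight `0`.

The transformation of `θ` under `S` is reduced to rank one. An orthogonal basis of `K ⊗ ℚ` inside
`K` writes `θ_a` as a finite sum of products of one-variable theta functions, which satisfy Jacobi's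
functional equation. The passage from `∏ ℤ/N_i` to `A_L` is a Lagrangian subgroup of the product,
and such a correspondence always intertwines the two Fourier transforms (`lagrangian_intertwines`,
`isLagrangian_corr`, `thetaUp_S`).

If `u` is a left unit then `(ξ(u) - 1) f = 0` for all `f`, so `ξ(u) = 1` as soon as `M^!(L) ≠ 0`;
and a preimage of `1` is a left unit and makes `ξ` surjective by `ξ(g u) = g ξ(u)`
(`hasLeftUnit_iff`). A nonzero form is built from `θ` itself: seven copies of the dual type map to
`ρ_L` through a Lagrangian in `A_L × A_L⁷`, the graph of a quaternion whose norm plus one is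
`2|A_L|`. The weight `7n/2` is corrected to `-n/2` by `(E₄²/Δ)^n`, and nonvanishing follows from
positivity at `τ = i`. For `σ(L) = 0` no correction is needed: the form is bounded and `ξ` of it is
positive at `i`, so the criterion in (2) applies.

For (2), `f = o(q⁻¹)` forces `ξ(f) = o(q⁻¹)`, since `θ` is bounded. Then `ξ(f)Δ` is a cusp form of
weight `12`, so `ξ(f)` is a constant, and it can be normalised to `1` if nonzero. If moreover `σ(L)
≤ -24`, then `fΔ` vanishes at the cusp and has weight `12 + σ(L)/2 ≤ 0`. Moving up into the
fundamental domain does not decrease its norm, so the maximum principle kills it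
(`eq_zero_of_isLittleOQInv`). -/

theorem e_coe (x : ℚ) : e (x : AddCircle (1 : ℚ)) = Complex.exp (2 * Real.pi * Complex.I * (x : ℂ)) :=
  rfl

theorem e_zero : e 0 = 1 := by
  have := e_coe 0
  simpa using this

theorem e_add (x y : AddCircle (1 : ℚ)) : e (x + y) = e x * e y := by
  induction x using QuotientAddGroup.induction_on with | H x =>
  induction y using QuotientAddGroup.induction_on with | H y =>
  have h : ((x : AddCircle (1 : ℚ)) + (y : AddCircle (1 : ℚ))) = ((x + y : ℚ) : AddCircle (1 : ℚ)) := rfl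
  change e ((x : AddCircle (1 : ℚ)) + (y : AddCircle (1 : ℚ))) = _
  rw [h, e_coe]
  rw [e_coe, e_coe, ← Complex.exp_add]
  push_cast
  ring_nf

theorem norm_e (x : AddCircle (1 : ℚ)) : ‖e x‖ = 1 := by
  induction x using QuotientAddGroup.induction_on with | H x =>
  rw [e_coe, show (2 * Real.pi * Complex.I * (x : ℂ)) = ((2 * Real.pi * x : ℝ) : ℂ) * Complex.I by
    push_cast; ring]
  exact Complex.norm_exp_ofReal_mul_I _

theorem e_ne_zero (x : AddCircle (1 : ℚ)) : e x ≠ 0 := by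
  rw [← norm_ne_zero_iff, norm_e]; exact one_ne_zero

theorem e_neg (x : AddCircle (1 : ℚ)) : e (-x) = (e x)⁻¹ := by
  refine eq_inv_of_mul_eq_one_left ?_
  rw [← e_add, neg_add_cancel, e_zero]

theorem e_coe_eq_one_iff (x : ℚ) : e (x : AddCircle (1 : ℚ)) = 1 ↔ ∃ n : ℤ, x = n := by
  rw [e_coe, Complex.exp_eq_one_iff]
  refine exists_congr fun n ↦ ?_
  have h : (2 * Real.pi * Complex.I : ℂ) ≠ 0 := Complex.two_pi_I_ne_zero
  rw [mul_comm (n : ℂ), mul_right_inj' h]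
  exact_mod_cast Iff.rfl

theorem e_eq_one_iff (x : AddCircle (1 : ℚ)) : e x = 1 ↔ x = 0 := by
  induction x using QuotientAddGroup.induction_on with | H x =>
  change e (x : AddCircle (1 : ℚ)) = 1 ↔ (x : AddCircle (1 : ℚ)) = 0
  rw [e_coe_eq_one_iff, AddCircle.coe_eq_zero_iff]
  simp [eq_comm]

theorem e_sum {ι : Type*} (s : Finset ι) (x : ι → AddCircle (1 : ℚ)) :
    e (∑ i ∈ s, x i) = ∏ i ∈ s, e (x i) := by
  classical
  induction s using Finset.induction_on with
  | empty => simp [e_zero]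
  | insert i s hi h => rw [Finset.sum_insert hi, Finset.prod_insert hi, e_add, h]

theorem e_nsmul (n : ℕ) (x : AddCircle (1 : ℚ)) : e (n • x) = e x ^ n := by
  induction n with
  | zero => simp [e_zero]
  | succ n h => rw [succ_nsmul, e_add, h, pow_succ]

/-- A nondegenerate symmetric bicharacter with values in the unit circle. -/
structure IsBichar {A : Type*} [AddCommGroup A] (χ : A → A → ℂ) : Prop where
  add_left : ∀ a b c, χ (a + b) c = χ a c * χ b c
  symm : ∀ a b, χ a b = χ b a
  norm_eq_one : ∀ a b, ‖χ a b‖ = 1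
  nondeg : ∀ a, (∀ b, χ a b = 1) → a = 0

namespace IsBichar

variable {A B : Type*} [AddCommGroup A] [AddCommGroup B] {χ : A → A → ℂ} {ψ : B → B → ℂ}

theorem ne_zero (hχ : IsBichar χ) (a b : A) : χ a b ≠ 0 := by
  rw [← norm_ne_zero_iff, hχ.norm_eq_one]; exact one_ne_zero

theorem zero_left (hχ : IsBichar χ) (a : A) : χ 0 a = 1 := by
  have h := hχ.add_left 0 0 a
  rw [add_zero] at h
  exact mul_left_cancel₀ (hχ.ne_zero 0 a) (by rw [← h, mul_one])

theorem zero_right (hχ : IsBichar χ) (a : A) : χ a 0 = 1 := by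
  rw [hχ.symm, hχ.zero_left]

theorem add_right (hχ : IsBichar χ) (a b c : A) : χ a (b + c) = χ a b * χ a c := by
  rw [hχ.symm, hχ.add_left, hχ.symm b, hχ.symm c]

theorem neg_left (hχ : IsBichar χ) (a b : A) : χ (-a) b = (χ a b)⁻¹ := by
  refine eq_inv_of_mul_eq_one_left ?_
  rw [← hχ.add_left, neg_add_cancel, hχ.zero_left]

theorem neg_right (hχ : IsBichar χ) (a b : A) : χ a (-b) = (χ a b)⁻¹ := by
  rw [hχ.symm, hχ.neg_left, hχ.symm]

theorem inv (hχ : IsBichar χ) : IsBichar (fun a b ↦ (χ a b)⁻¹) where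
  add_left a b c := by rw [hχ.add_left, mul_inv]
  symm a b := by rw [hχ.symm]
  norm_eq_one a b := by rw [norm_inv, hχ.norm_eq_one, inv_one]
  nondeg a h := hχ.nondeg a fun b ↦ inv_eq_one.mp (h b)

theorem pi {ι : Type*} [Fintype ι] {C : ι → Type*} [∀ i, AddCommGroup (C i)]
    {φ : ∀ i, C i → C i → ℂ} (hφ : ∀ i, IsBichar (φ i)) :
    IsBichar (fun a b : ∀ i, C i ↦ ∏ i, φ i (a i) (b i)) where
  add_left a b c := by simp only [Pi.add_apply, (hφ _).add_left, Finset.prod_mul_distrib]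
  symm a b := Finset.prod_congr rfl fun i _ ↦ (hφ i).symm _ _
  norm_eq_one a b := by
    rw [norm_prod]; exact Finset.prod_eq_one fun i _ ↦ (hφ i).norm_eq_one _ _
  nondeg a h := by
    classical
    funext i
    refine (hφ i).nondeg _ fun b ↦ ?_
    have := h (Pi.single i b)
    rw [Finset.prod_eq_single i] at this
    · simpa using this
    · intro j _ hj
      rw [Pi.single_eq_of_ne hj, (hφ j).zero_right]
    · simp

/-- Orthogonality relation for a multiplicative function on a subgroup. -/
theorem _root_.ThetaProduct.sum_subgroup_eq {G : Type*} [AddCommGroup G] [Fintype G]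
    (H : AddSubgroup G) [DecidablePred (· ∈ H)] (φ : G → ℂ)
    (hadd : ∀ a b, φ (a + b) = φ a * φ b) [Decidable (∀ g ∈ H, φ g = 1)] :
    (∑ g, if g ∈ H then φ g else 0) = if ∀ g ∈ H, φ g = 1 then (Nat.card H : ℂ) else 0 := by
  classical
  rw [← Finset.sum_filter]
  split_ifs with h
  · rw [Finset.sum_congr rfl (g := fun _ ↦ (1 : ℂ)) (fun g hg ↦ h g (by simpa using hg))]
    simp [Nat.card_eq_fintype_card, Fintype.card_subtype]
  · push Not at h
    obtain ⟨g₀, hg₀, hne⟩ := h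
    have key : φ g₀ * (∑ g with g ∈ H, φ g) = ∑ g with g ∈ H, φ g := by
      rw [Finset.mul_sum]
      refine Finset.sum_bij (fun g _ ↦ g₀ + g) ?_ ?_ ?_ ?_
      · intro g hg; simp at hg ⊢; exact H.add_mem hg₀ hg
      · intro a _ b _ h; exact add_left_cancel h
      · intro b hb; simp at hb
        exact ⟨-g₀ + b, by simpa using H.add_mem (H.neg_mem hg₀) hb, by simp⟩
      · intro g _; exact (hadd _ _).symm
    have : (φ g₀ - 1) * (∑ g with g ∈ H, φ g) = 0 := by rw [sub_mul, key]; ring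
    exact (mul_eq_zero.mp this).resolve_left (sub_ne_zero.mpr hne)

theorem sum_left [Fintype A] [DecidableEq A] (hχ : IsBichar χ) (b : A) :
    ∑ a, χ a b = if b = 0 then (Fintype.card A : ℂ) else 0 := by
  classical
  have := sum_subgroup_eq (⊤ : AddSubgroup A) (fun a ↦ χ a b)
    (fun a a' ↦ hχ.add_left a a' b)
  simp only [AddSubgroup.mem_top, if_true, true_imp_iff] at this
  rw [this]
  have h : (∀ a, χ a b = 1) ↔ b = 0 :=
    ⟨fun h ↦ hχ.nondeg b fun a ↦ by rw [hχ.symm, h], fun h a ↦ by rw [h, hχ.zero_right]⟩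
  simp [h, Nat.card_eq_fintype_card]

/-- Fourier inversion. -/
theorem sum_inv_mul [Fintype A] [DecidableEq A] (hχ : IsBichar χ) (b c : A) :
    ∑ a, (χ b a)⁻¹ * χ a c = if b = c then (Fintype.card A : ℂ) else 0 := by
  have := hχ.sum_left (c - b)
  simp only [sub_eq_zero, eq_comm (a := c)] at this
  rw [← this]
  refine Finset.sum_congr rfl fun a _ ↦ ?_
  rw [sub_eq_add_neg, hχ.add_right, hχ.neg_right, hχ.symm b a, mul_comm]

/-- A Lagrangian correspondence between two finite groups with bicharacters. -/
def IsLagrangian (χ : A → A → ℂ) (ψ : B → B → ℂ) (G : AddSubgroup (A × B)) : Prop :=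
  ∀ p : A × B, p ∈ G ↔ ∀ r ∈ G, χ r.1 p.1 = ψ r.2 p.2

section Lagrangian

variable [Fintype A] [Fintype B] {G : AddSubgroup (A × B)}

open Classical in
-- The summand is a character of `G` in the variable `r`, and the Lagrangian condition says that it
-- is trivial exactly when `p ∈ G`.
theorem sum_lagrangian (hχ : IsBichar χ) (hψ : IsBichar ψ) (hG : IsLagrangian χ ψ G)
    (p : A × B) :
    (∑ r : A × B, if r ∈ G then χ r.1 p.1 * (ψ r.2 p.2)⁻¹ else 0)
      = if p ∈ G then (Nat.card G : ℂ) else 0 := by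
  rw [sum_subgroup_eq G (fun r ↦ χ r.1 p.1 * (ψ r.2 p.2)⁻¹)]
  · refine if_congr ?_ rfl rfl
    rw [hG p]
    refine forall₂_congr fun r _ ↦ ?_
    rw [← div_eq_mul_inv, div_eq_one_iff_eq (hψ.ne_zero _ _)]
  · intro a b
    simp only [Prod.fst_add, Prod.snd_add, hχ.add_left, hψ.add_left, mul_inv]
    ring

/-- A double count: summing over `r` first leaves `|G|` for each `p ∈ G`, while summing over `p`
first leaves only `r = 0`. -/
theorem card_sq (hχ : IsBichar χ) (hψ : IsBichar ψ) (hG : IsLagrangian χ ψ G) :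
    (Nat.card G) ^ 2 = Fintype.card A * Fintype.card B := by
  classical
  have h1 : ∑ p : A × B, ∑ r : A × B, (if r ∈ G then χ r.1 p.1 * (ψ r.2 p.2)⁻¹ else 0)
      = (Nat.card G : ℂ) ^ 2 := by
    simp_rw [sum_lagrangian hχ hψ hG]
    rw [← Finset.sum_filter, Finset.sum_const, nsmul_eq_mul, sq]
    congr 1
    simp [Nat.card_eq_fintype_card, Fintype.card_subtype]
  have h2 : ∑ p : A × B, ∑ r : A × B, (if r ∈ G then χ r.1 p.1 * (ψ r.2 p.2)⁻¹ else 0)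
      = (Fintype.card A : ℂ) * Fintype.card B := by
    rw [Finset.sum_comm, Finset.sum_eq_single (0 : A × B)]
    · simp [G.zero_mem, hχ.zero_left, hψ.zero_left]
    · rintro ⟨a, b⟩ - hne
      dsimp only
      split_ifs with h
      · rw [← Finset.univ_product_univ, Finset.sum_product]
        simp_rw [← Finset.mul_sum, ← Finset.sum_mul]
        have e1 : ∑ c, χ a c = ∑ c, χ c a := Finset.sum_congr rfl fun _ _ ↦ hχ.symm _ _
        have e2 : ∑ c, (ψ b c)⁻¹ = ∑ c, (ψ c b)⁻¹ :=
          Finset.sum_congr rfl fun _ _ ↦ by rw [hψ.symm]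
        rw [e1, e2, hχ.sum_left, hψ.inv.sum_left]
        by_cases ha : a = 0
        · have hb : b ≠ 0 := fun hb ↦ hne (by rw [ha, hb]; rfl)
          simp [hb]
        · simp [ha]
      · simp
    · simp
  have := h1.symm.trans h2
  exact_mod_cast this

open Classical in
/-- The correspondence defined by a Lagrangian subgroup intertwines the Fourier transforms. -/
theorem lagrangian_intertwines (hχ : IsBichar χ) (hψ : IsBichar ψ) (hG : IsLagrangian χ ψ G)
    (a : A) (b' : B) :
    (Real.sqrt (Fintype.card A) : ℂ) * (∑ b, if (a, b) ∈ G then ψ b b' else 0)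
      = (Real.sqrt (Fintype.card B) : ℂ) * ∑ a', if (a', b') ∈ G then χ a a' else 0 := by
  -- The complex conjugate of the claim, up to the factor `√|A|`: multiply `sum_lagrangian` at `(a',
  -- b')` by `(χ a a')⁻¹` and sum over `a'`. Orthogonality then keeps only the pairs of `G` with
  -- first entry `a`.
  have key : (Fintype.card A : ℂ) * (∑ b, if (a, b) ∈ G then (ψ b b')⁻¹ else 0)
      = (Nat.card G : ℂ) * ∑ a', if (a', b') ∈ G then (χ a a')⁻¹ else 0 := by
    have h := fun a' : A ↦ congrArg (fun z ↦ (χ a a')⁻¹ * z) (sum_lagrangian hχ hψ hG (a', b'))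
    have h' := Finset.sum_congr (rfl : (Finset.univ : Finset A) = _) (fun a' _ ↦ h a')
    dsimp only at h'
    have r : ∑ a', (χ a a')⁻¹ * (if (a', b') ∈ G then (Nat.card G : ℂ) else 0)
        = (Nat.card G : ℂ) * ∑ a', if (a', b') ∈ G then (χ a a')⁻¹ else 0 := by
      rw [Finset.mul_sum]
      refine Finset.sum_congr rfl fun a' _ ↦ ?_
      split_ifs <;> ring
    rw [r] at h'
    rw [← h']
    simp_rw [Finset.mul_sum]
    rw [Finset.sum_comm, ← Finset.univ_product_univ, Finset.sum_product_right]
    refine Finset.sum_congr rfl fun b _ ↦ ?_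
    rw [Finset.sum_eq_single a]
    · dsimp only
      split_ifs
      · simp_rw [← mul_assoc, ← Finset.sum_mul]
        have := hχ.sum_inv_mul a a
        rw [if_pos rfl] at this
        rw [← this]
        congr 1
        exact Finset.sum_congr rfl fun c _ ↦ by rw [hχ.symm c a]
      · simp
    · intro a₁ _ hne
      dsimp only
      split_ifs
      · simp_rw [← mul_assoc, ← Finset.sum_mul]
        have := hχ.sum_inv_mul a a₁
        rw [if_neg hne.symm] at this
        rw [show ∑ i, (χ a i)⁻¹ * χ a₁ i = 0 by
          rw [← this]; exact Finset.sum_congr rfl fun c _ ↦ by rw [hχ.symm c a₁], zero_mul]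
      · simp
    · simp
  have hA : (0 : ℝ) < Fintype.card A := by exact_mod_cast Fintype.card_pos
  have hB : (0 : ℝ) < Fintype.card B := by exact_mod_cast Fintype.card_pos
  have hcard : (Nat.card G : ℝ) = Real.sqrt (Fintype.card A) * Real.sqrt (Fintype.card B) := by
    rw [← Real.sqrt_mul hA.le, eq_comm, Real.sqrt_eq_iff_mul_self_eq (by positivity) (by positivity)]
    have := card_sq hχ hψ hG
    rw [← sq]
    exact_mod_cast this.symm
  have hcardC : (Nat.card G : ℂ)
      = (Real.sqrt (Fintype.card A) : ℂ) * (Real.sqrt (Fintype.card B) : ℂ) := by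
    exact_mod_cast congrArg (fun x : ℝ ↦ (x : ℂ)) hcard
  have hAC : (Fintype.card A : ℂ)
      = (Real.sqrt (Fintype.card A) : ℂ) * (Real.sqrt (Fintype.card A) : ℂ) := by
    have := Real.mul_self_sqrt hA.le
    exact_mod_cast congrArg (fun x : ℝ ↦ (x : ℂ)) this.symm
  have hs : (Real.sqrt (Fintype.card A) : ℂ) ≠ 0 := by
    exact_mod_cast (Real.sqrt_pos.mpr hA).ne'
  rw [hcardC, hAC, mul_assoc, mul_assoc] at key
  have key2 := mul_left_cancel₀ hs key
  -- The values lie on the unit circle, so conjugation removes the inverses.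
  have := congrArg (starRingEnd ℂ) key2
  have cχ : ∀ x y, (starRingEnd ℂ) (χ x y)⁻¹ = χ x y := fun x y ↦ by
    rw [map_inv₀, ← Complex.inv_eq_conj (hχ.norm_eq_one x y), inv_inv]
  have cψ : ∀ x y, (starRingEnd ℂ) (ψ x y)⁻¹ = ψ x y := fun x y ↦ by
    rw [map_inv₀, ← Complex.inv_eq_conj (hψ.norm_eq_one x y), inv_inv]
  simpa only [map_mul, map_sum, Complex.conj_ofReal, apply_ite (starRingEnd ℂ), cχ, cψ,
    map_zero] using this

open Classical in
theorem lagrangian_intertwines_apply (hχ : IsBichar χ) (hψ : IsBichar ψ)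
    (hG : IsLagrangian χ ψ G) (v : B → ℂ) (a : A) :
    (Real.sqrt (Fintype.card A) : ℂ) * (∑ b, if (a, b) ∈ G then ∑ b', ψ b b' * v b' else 0)
      = (Real.sqrt (Fintype.card B) : ℂ)
        * ∑ a', χ a a' * ∑ b, if (a', b) ∈ G then v b else 0 := by
  have l : (∑ b, if (a, b) ∈ G then ∑ b', ψ b b' * v b' else 0)
      = ∑ b', (∑ b, if (a, b) ∈ G then ψ b b' else 0) * v b' := by
    simp_rw [Finset.sum_mul]
    rw [Finset.sum_comm]
    refine Finset.sum_congr rfl fun b _ ↦ ?_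
    split_ifs <;> simp
  have r : (∑ a', χ a a' * ∑ b, if (a', b) ∈ G then v b else 0)
      = ∑ b', (∑ a', if (a', b') ∈ G then χ a a' else 0) * v b' := by
    simp_rw [Finset.sum_mul, Finset.mul_sum]
    rw [Finset.sum_comm]
    refine Finset.sum_congr rfl fun b _ ↦ Finset.sum_congr rfl fun a' _ ↦ ?_
    split_ifs <;> simp
  rw [l, r, Finset.mul_sum, Finset.mul_sum]
  refine Finset.sum_congr rfl fun b' _ ↦ ?_
  rw [← mul_assoc, hχ.lagrangian_intertwines hψ hG, mul_assoc]

end Lagrangian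

/-- The Fourier transform is unitary. -/
theorem sum_norm_sq_fourier [Fintype A] (hχ : IsBichar χ) (v : A → ℂ) :
    ∑ b, ‖∑ a, χ a b * v a‖ ^ 2 = Fintype.card A * ∑ a, ‖v a‖ ^ 2 := by
  classical
  have hn : ∀ z : ℂ, ((‖z‖ ^ 2 : ℝ) : ℂ) = z * (starRingEnd ℂ) z := fun z ↦ by
    rw [Complex.mul_conj, Complex.normSq_eq_norm_sq]
  have cχ : ∀ x y, (starRingEnd ℂ) (χ x y) = (χ x y)⁻¹ := fun x y ↦
    (Complex.inv_eq_conj (hχ.norm_eq_one x y)).symm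
  have : ((∑ b, ‖∑ a, χ a b * v a‖ ^ 2 : ℝ) : ℂ) = ((Fintype.card A * ∑ a, ‖v a‖ ^ 2 : ℝ) : ℂ) := by
    push_cast only [Complex.ofReal_sum, Complex.ofReal_mul, hn, Complex.ofReal_natCast]
    simp_rw [map_sum, map_mul, cχ, Finset.sum_mul_sum]
    rw [Finset.sum_comm, Finset.mul_sum]
    refine Finset.sum_congr rfl fun a _ ↦ ?_
    rw [Finset.sum_comm]
    have : ∀ c, ∑ b, χ a b * v a * ((χ c b)⁻¹ * (starRingEnd ℂ) (v c))
        = (if c = a then (Fintype.card A : ℂ) else 0) * (v a * (starRingEnd ℂ) (v c)) := fun c ↦ by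
      rw [← hχ.sum_inv_mul c a, Finset.sum_mul]
      refine Finset.sum_congr rfl fun b _ ↦ ?_
      rw [hχ.symm a b]; ring
    simp_rw [this]
    simp
  exact_mod_cast this

end IsBichar

end ThetaProduct

end

noncomputable section

namespace ThetaProduct

/-! ### Theta series of rank one and of orthogonal sums -/

/-- The summand `exp(πiτm²/N)`. -/
def gaussTerm (N : ℕ) (m : ℤ) (τ : ℂ) : ℂ := Complex.exp (Real.pi * Complex.I * τ * m ^ 2 / N)

/-- `∑_{m ≡ b mod N} exp(πiτm²/N)`. -/
def theta1 (N : ℕ) (b : ZMod N) (τ : ℂ) : ℂ :=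
  ∑' m : ℤ, if (m : ZMod N) = b then gaussTerm N m τ else 0

theorem gaussTerm_eq (N : ℕ) (m : ℤ) (τ : ℂ) :
    gaussTerm N m τ = jacobiTheta₂_term m 0 (τ / N) := by
  rw [gaussTerm, jacobiTheta₂_term]
  congr 1
  ring

theorem norm_gaussTerm (N : ℕ) (m : ℤ) (τ : ℂ) :
    ‖gaussTerm N m τ‖ = Real.exp (-(Real.pi * τ.im * m ^ 2 / N)) := by
  rw [gaussTerm, Complex.norm_exp]
  congr 1
  rw [show (Real.pi * Complex.I * τ * (m : ℂ) ^ 2 / N : ℂ)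
    = ((Real.pi * m ^ 2 / N : ℝ) : ℂ) * (Complex.I * τ) by push_cast; ring, Complex.re_ofReal_mul]
  simp
  ring

section

variable (N : ℕ) [NeZero N]

theorem im_div_natCast_pos {τ : ℂ} (hτ : 0 < τ.im) : 0 < (τ / (N : ℂ)).im := by
  have : (0 : ℝ) < N := by exact_mod_cast Nat.pos_of_neZero N
  rw [Complex.div_natCast_im]
  positivity

theorem summable_norm_gaussTerm {τ : ℂ} (hτ : 0 < τ.im) :
    Summable fun m : ℤ ↦ ‖gaussTerm N m τ‖ := by
  simp_rw [gaussTerm_eq]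
  exact ((summable_jacobiTheta₂_term_iff 0 (τ / N)).mpr (im_div_natCast_pos N hτ)).norm

theorem summable_norm_theta1 (b : ZMod N) {τ : ℂ} (hτ : 0 < τ.im) :
    Summable fun m : ℤ ↦ ‖if (m : ZMod N) = b then gaussTerm N m τ else 0‖ := by
  refine (summable_norm_gaussTerm N hτ).of_nonneg_of_le (fun _ ↦ norm_nonneg _) fun m ↦ ?_
  split_ifs <;> simp

/-- Substitute `m = b + N j` and expand the square. This supplies both holomorphy in `τ` and access
to Jacobi's functional equation. -/
theorem theta1_eq_jacobiTheta₂ (b : ZMod N) (τ : ℂ) :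
    theta1 N b τ = Complex.exp (Real.pi * Complex.I * τ * (b.val : ℂ) ^ 2 / N)
      * jacobiTheta₂ (b.val * τ) (N * τ) := by
  have hN : (N : ℂ) ≠ 0 := by exact_mod_cast NeZero.ne N
  have hinj : Function.Injective (fun j : ℤ ↦ (b.val : ℤ) + N * j) := fun i j h ↦ by
    simpa [NeZero.ne N] using h
  rw [theta1, jacobiTheta₂, ← tsum_mul_left, ← hinj.tsum_eq]
  · refine tsum_congr fun j ↦ ?_
    rw [if_pos (by simp), gaussTerm, jacobiTheta₂_term, ← Complex.exp_add]
    congr 1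
    push_cast
    field_simp
    ring
  · intro m hm
    rw [Function.mem_support, ne_eq, ite_eq_right_iff, not_forall] at hm
    obtain ⟨h, -⟩ := hm
    have h2 : ((m - b.val : ℤ) : ZMod N) = 0 := by push_cast; rw [h]; simp
    obtain ⟨j, hj⟩ := (ZMod.intCast_zmod_eq_zero_iff_dvd _ N).mp h2
    exact ⟨j, by dsimp only; omega⟩

theorem differentiableAt_theta1 (b : ZMod N) {τ : ℂ} (hτ : 0 < τ.im) :
    DifferentiableAt ℂ (theta1 N b) τ := by
  have hN : (0 : ℝ) < N := by exact_mod_cast Nat.pos_of_neZero N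
  rw [show theta1 N b = fun τ ↦ Complex.exp (Real.pi * Complex.I * τ * (b.val : ℂ) ^ 2 / N)
      * jacobiTheta₂ (b.val * τ) (N * τ) from funext fun τ ↦ theta1_eq_jacobiTheta₂ N b τ]
  refine DifferentiableAt.mul (by fun_prop) ?_
  have h : 0 < ((N : ℂ) * τ).im := by
    rw [← Complex.ofReal_natCast, Complex.im_ofReal_mul]; positivity
  have h1 := (hasFDerivAt_jacobiTheta₂ (b.val * τ) h).differentiableAt
  exact DifferentiableAt.comp (f := fun τ : ℂ ↦ ((b.val : ℂ) * τ, (N : ℂ) * τ))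
    (g := fun p : ℂ × ℂ ↦ jacobiTheta₂ p.1 p.2) τ h1 (by fun_prop)

/-- The norm of each Gaussian term is nonincreasing in `Im τ`, so the full series at `τ = i` is a
majorant. -/
theorem norm_theta1_le (b : ZMod N) {τ : ℂ} (hτ : 1 ≤ τ.im) :
    ‖theta1 N b τ‖ ≤ ∑' m : ℤ, ‖gaussTerm N m Complex.I‖ := by
  have h1 : 0 < τ.im := by linarith
  refine (norm_tsum_le_tsum_norm (summable_norm_theta1 N b h1)).trans ?_
  refine (summable_norm_theta1 N b h1).tsum_le_tsum ?_
    (summable_norm_gaussTerm N (by simp))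
  intro m
  split_ifs
  · rw [norm_gaussTerm, norm_gaussTerm, Real.exp_le_exp]
    have : (0 : ℝ) < N := by exact_mod_cast Nat.pos_of_neZero N
    simp only [Complex.I_im, neg_le_neg_iff]
    have := Real.pi_pos
    gcongr
  · simp

/-- The residue classes reassemble into one sum over `ℤ`, with the character contributing the
elliptic variable `-b/N`; evenness of the Jacobi theta function removes the sign. -/
theorem sum_char_mul_theta1 (b : ZMod N) {τ : ℂ} (hτ : 0 < τ.im) :
    ∑ c, (ZMod.stdAddChar (b * c))⁻¹ * theta1 N c τ
      = jacobiTheta₂ ((b.val : ℂ) / N) (τ / N) := by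
  have hN : (N : ℂ) ≠ 0 := by exact_mod_cast NeZero.ne N
  rw [← jacobiTheta₂_neg_left, jacobiTheta₂]
  have h : ∀ c : ZMod N, (ZMod.stdAddChar (b * c))⁻¹ * theta1 N c τ
      = ∑' m : ℤ, (ZMod.stdAddChar (b * c))⁻¹ * (if (m : ZMod N) = c then gaussTerm N m τ else 0) :=
    fun c ↦ tsum_mul_left.symm
  simp_rw [h]
  rw [← Summable.tsum_finsetSum fun c _ ↦ (summable_norm_theta1 N c hτ).of_norm.mul_left _]
  refine tsum_congr fun m ↦ ?_
  rw [Finset.sum_eq_single (m : ZMod N) (fun c _ hc ↦ by rw [if_neg hc.symm, mul_zero])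
    (by simp), if_pos rfl]
  have hb : b * (m : ZMod N) = (((b.val : ℤ) * m : ℤ) : ZMod N) := by simp
  rw [hb, ZMod.stdAddChar_coe, ← Complex.exp_neg, gaussTerm, jacobiTheta₂_term, ← Complex.exp_add]
  congr 1
  push_cast
  ring

theorem cpow_half_div_natCast {z : ℂ} (hz : z ≠ 0) :
    (z / (N : ℂ)) ^ (1 / 2 : ℂ) = z ^ (1 / 2 : ℂ) / (Real.sqrt N : ℂ) := by
  have hN : (0 : ℝ) < N := by exact_mod_cast Nat.pos_of_neZero N
  have h2 : Complex.log (z / (N : ℂ)) = Complex.log z - Real.log N := by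
    rw [div_eq_inv_mul, show ((N : ℂ)⁻¹) = ((N⁻¹ : ℝ) : ℂ) by push_cast; rfl,
      Complex.log_ofReal_mul (by positivity) hz, Real.log_inv]
    push_cast; ring
  have h3 : (Real.sqrt N : ℂ) = Complex.exp (Real.log N * (1 / 2)) := by
    rw [Real.sqrt_eq_rpow, Real.rpow_def_of_pos hN]
    push_cast
    rfl
  rw [Complex.cpow_def_of_ne_zero (div_ne_zero hz (by exact_mod_cast hN.ne')),
    Complex.cpow_def_of_ne_zero hz, h2, h3, ← Complex.exp_sub]
  congr 1
  ring

/-- Jacobi's functional equation at `(b/N, τ/N)`, whose two sides are the two preceding expressions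
in Jacobi theta functions. -/
theorem theta1_neg_inv (b : ZMod N) {τ : ℂ} (hτ : 0 < τ.im) :
    theta1 N b (-1 / τ) = (-Complex.I * τ) ^ (1 / 2 : ℂ) / (Real.sqrt N : ℂ)
      * ∑ c, (ZMod.stdAddChar (b * c))⁻¹ * theta1 N c τ := by
  have hN : (N : ℂ) ≠ 0 := by exact_mod_cast NeZero.ne N
  have hτ0 : τ ≠ 0 := fun h ↦ by simp [h] at hτ
  have hne : -Complex.I * τ ≠ 0 := mul_ne_zero (neg_ne_zero.mpr Complex.I_ne_zero) hτ0
  have hs : (-Complex.I * τ) ^ (1 / 2 : ℂ) / (Real.sqrt N : ℂ) ≠ 0 := by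
    rw [← cpow_half_div_natCast N hne]
    exact Complex.cpow_ne_zero_iff.mpr (Or.inl (div_ne_zero hne hN))
  rw [sum_char_mul_theta1 N b hτ, jacobiTheta₂_functional_equation, ← mul_div_assoc,
    cpow_half_div_natCast N hne, theta1_eq_jacobiTheta₂, ← mul_assoc, ← mul_assoc,
    mul_one_div_cancel hs, one_mul, ← jacobiTheta₂_neg_left]
  congr 2
  · field_simp
  · field_simp
  · field_simp

theorem isBichar_stdAddChar :
    IsBichar (fun a b : ZMod N ↦ ((ZMod.stdAddChar (a * b) : ℂ))⁻¹) := by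
  refine IsBichar.inv (χ := fun a b : ZMod N ↦ (ZMod.stdAddChar (a * b) : ℂ)) ⟨?_, ?_, ?_, ?_⟩
  · intro a b c; rw [add_mul, AddChar.map_add_eq_mul]
  · intro a b; rw [mul_comm]
  · intro a b; exact AddChar.norm_apply _ _
  · intro a h
    by_contra ha
    exact ZMod.isPrimitive_stdAddChar N ha (by ext b; simpa [AddChar.mulShift_apply] using h b)

end

/-- Induction on `n` by the product of two absolutely convergent series. Absolute convergence is
carried along because the next step needs it. -/
theorem hasSum_pi_prod {n : ℕ} (g : Fin n → ℤ → ℂ) (hg : ∀ i, Summable fun m ↦ ‖g i m‖) :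
    (Summable fun m : Fin n → ℤ ↦ ‖∏ i, g i (m i)‖) ∧
      HasSum (fun m : Fin n → ℤ ↦ ∏ i, g i (m i)) (∏ i, ∑' m, g i m) := by
  induction n with
  | zero =>
    constructor
    · exact Summable.of_finite
    · simp
  | succ n ih =>
    obtain ⟨h1, h2⟩ := ih (fun i ↦ g i.succ) fun i ↦ hg i.succ
    generalize hp : (fun m : Fin n → ℤ ↦ ∏ i, g i.succ (m i)) = p at h2
    have hp' : ∀ m : Fin n → ℤ, ∏ i, g i.succ (m i) = p m := fun m ↦ congrFun hp m
    simp_rw [hp'] at h1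
    have hs : Summable fun x : ℤ × (Fin n → ℤ) ↦ ‖g 0 x.1 * p x.2‖ := (hg 0).mul_norm h1
    let E : ℤ × (Fin n → ℤ) ≃ (Fin (n + 1) → ℤ) := Fin.consEquiv fun _ ↦ ℤ
    have hE : ∀ x, ∏ i, g i (E x i) = g 0 x.1 * p x.2 := fun x ↦ by
      rw [Fin.prod_univ_succ, ← hp']; rfl
    have key : Summable fun m : Fin (n + 1) → ℤ ↦ ‖∏ i, g i (m i)‖ :=
      E.summable_iff.mp (hs.congr fun x ↦ by rw [Function.comp_apply, hE])
    refine ⟨key, ?_⟩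
    rw [key.of_norm.hasSum_iff, Fin.prod_univ_succ, ← h2.tsum_eq,
      tsum_mul_tsum_of_summable_norm (hg 0) h1, ← E.tsum_eq]
    exact tsum_congr hE

open Classical in
/-- A sum of Gaussians over a periodic subset of `ℤⁿ`, in terms of theta series of rank one. -/
theorem hasSum_periodic {n : ℕ} (N : Fin n → ℕ) [∀ i, NeZero (N i)] (s : Set (∀ i, ZMod (N i)))
    {τ : ℂ} (hτ : 0 < τ.im) :
    HasSum (fun m : Fin n → ℤ ↦ if (fun i ↦ (m i : ZMod (N i))) ∈ s
        then ∏ i, gaussTerm (N i) (m i) τ else 0)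
      (∑ b, if b ∈ s then ∏ i, theta1 (N i) (b i) τ else 0) := by
  have h : ∀ b : (∀ i, ZMod (N i)), HasSum (fun m : Fin n → ℤ ↦ if b ∈ s then
      ∏ i, (if (m i : ZMod (N i)) = b i then gaussTerm (N i) (m i) τ else 0) else 0)
      (if b ∈ s then ∏ i, theta1 (N i) (b i) τ else 0) := by
    intro b
    split_ifs with hb
    · exact (hasSum_pi_prod (fun i m ↦ if (m : ZMod (N i)) = b i then gaussTerm (N i) m τ else 0)
        fun i ↦ summable_norm_theta1 (N i) (b i) hτ).2
    · exact hasSum_zero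
  refine (hasSum_sum fun b _ ↦ h b).congr_fun ?_
  intro m
  rw [Finset.sum_eq_single (fun i ↦ (m i : ZMod (N i)))]
  · simp
  · intro b _ hb
    obtain ⟨i, hi⟩ := Function.ne_iff.mp hb
    rw [Finset.prod_eq_zero (Finset.mem_univ i) (if_neg hi.symm), ite_self]
  · simp

end ThetaProduct

end

noncomputable section

namespace ThetaProduct

/-! ### Lattices in rational quadratic spaces -/

section Lattice

variable {V : Type*} [AddCommGroup V] [Module ℚ V]

theorem exists_basis_span_eq (N : Submodule ℤ V) (hN : N.FG)
    (hspan : Submodule.span ℚ (N : Set V) = ⊤) :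
    ∃ (n : ℕ) (b : Module.Basis (Fin n) ℚ V), Submodule.span ℤ (Set.range b) = N := by
  have : Module.Finite ℤ N := Module.Finite.iff_fg.mpr hN
  have : IsAddTorsionFree V := IsAddTorsionFree.of_module_rat V
  let b₀ := Module.finBasis ℤ N
  have hr : Set.range (fun i ↦ (b₀ i : V)) = N.subtype '' Set.range b₀ := by
    rw [← Set.range_comp]; rfl
  have hs : Submodule.span ℤ (Set.range fun i ↦ (b₀ i : V)) = N := by
    rw [hr, Submodule.span_image, b₀.span_eq, Submodule.map_top, Submodule.range_subtype]
  have hli : LinearIndependent ℚ (fun i ↦ (b₀ i : V)) := by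
    rw [← LinearIndependent.iff_fractionRing ℤ ℚ]
    exact b₀.linearIndependent.map' N.subtype (Submodule.ker_subtype N)
  have htop : ⊤ ≤ Submodule.span ℚ (Set.range fun i ↦ (b₀ i : V)) := by
    rw [← hspan, Submodule.span_le]
    intro x hx
    rw [← hs] at hx
    exact Submodule.span_le_restrictScalars ℤ ℚ _ hx
  refine ⟨_, Module.Basis.mk hli htop, ?_⟩
  rw [Module.Basis.coe_mk, hs]

/-- Every functional on a full lattice is represented by a vector. -/
theorem exists_form_eq (B : LinearMap.BilinForm ℚ V) (hB : B.Nondegenerate) (N : Submodule ℤ V)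
    (hN : N.FG) (hspan : Submodule.span ℚ (N : Set V) = ⊤) (φ : N →ₗ[ℤ] ℚ) :
    ∃ y : V, ∀ x : N, B y x = φ x := by
  classical
  obtain ⟨n, b, hb⟩ := exists_basis_span_eq N hN hspan
  have hmem : ∀ i, b i ∈ N := fun i ↦ by rw [← hb]; exact Submodule.subset_span ⟨i, rfl⟩
  refine ⟨∑ i, φ ⟨b i, hmem i⟩ • B.dualBasis hB b i, ?_⟩
  have key : ∀ x (hx : x ∈ Submodule.span ℤ (Set.range b)),
      B (∑ i, φ ⟨b i, hmem i⟩ • B.dualBasis hB b i) x = φ ⟨x, hb ▸ hx⟩ := by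
    intro x hx
    induction hx using Submodule.span_induction with
    | mem x hx =>
      obtain ⟨j, rfl⟩ := hx
      simp [LinearMap.BilinForm.apply_dualBasis_left]
    | zero => rw [map_zero]; exact (map_zero φ).symm
    | add x y hx hy h1 h2 =>
      rw [map_add, h1, h2, ← map_add]; rfl
    | smul a x hx h =>
      rw [map_zsmul, h, ← map_zsmul]; rfl
  intro x
  exact key x (by rw [hb]; exact x.2)

/-- A lattice retracts onto its intersection with a subspace. -/
theorem exists_retraction (N : Submodule ℤ V) (hN : N.FG) (P : Submodule ℚ V) :
    ∃ r : N →ₗ[ℤ] N, (∀ x, (r x : V) ∈ P) ∧ ∀ x : N, (x : V) ∈ P → r x = x := by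
  have : Module.Finite ℤ N := Module.Finite.iff_fg.mpr hN
  let f : N →ₗ[ℤ] (V ⧸ P) := (P.mkQ.restrictScalars ℤ) ∘ₗ N.subtype
  have : IsAddTorsionFree (V ⧸ P) := IsAddTorsionFree.of_module_rat (V ⧸ P)
  have hfin : Module.Finite ℤ (LinearMap.range f) := inferInstance
  have hfree : Module.Free ℤ (LinearMap.range f) := inferInstance
  -- The image of `N` in `V/P` is finitely generated and torsion-free over `ℤ`, hence free, so the
  -- projection splits; `r` is the complementary projector.
  obtain ⟨s, hs⟩ := Module.projective_lifting_property f.rangeRestrict LinearMap.id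
    f.surjective_rangeRestrict
  have hs' : ∀ y, f (s y) = y := fun y ↦ congrArg Subtype.val (LinearMap.congr_fun hs y)
  refine ⟨LinearMap.id - s ∘ₗ f.rangeRestrict, fun x ↦ ?_, fun x hx ↦ ?_⟩
  · have h : f (x - s (f.rangeRestrict x)) = 0 := by rw [map_sub, hs']; simp
    exact (Submodule.Quotient.mk_eq_zero P).mp h
  · have h : f.rangeRestrict x = 0 := Subtype.ext ((Submodule.Quotient.mk_eq_zero P).mpr hx)
    simp [h]

end Lattice

namespace EvenLattice

variable {V : Type*} [AddCommGroup V] [Module ℚ V] (L : EvenLattice V)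

theorem mem_dual_iff {x : V} : x ∈ L.dual ↔ ∀ y ∈ L.carrier, ∃ n : ℤ, L.form x y = n := by
  refine forall₂_congr fun y _ ↦ ?_
  rw [Submodule.mem_one]
  simp [eq_comm]

theorem form_comm (x y : V) : L.form x y = L.form y x := L.symm.eq y x |>.symm

theorem carrier_le_dual : L.carrier ≤ L.dual := by
  intro x hx
  rw [L.mem_dual_iff]
  intro y hy
  obtain ⟨a, ha⟩ := L.even x hx
  obtain ⟨b, hb⟩ := L.even y hy
  obtain ⟨c, hc⟩ := L.even _ (add_mem hx hy)
  refine ⟨c - a - b, ?_⟩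
  have h := L.form_comm x y
  simp only [map_add, LinearMap.add_apply] at hc
  push_cast
  linarith

theorem span_dual_eq_top : Submodule.span ℚ (L.dual : Set V) = ⊤ := by
  rw [eq_top_iff, ← L.span_eq_top]
  exact Submodule.span_mono L.carrier_le_dual

/-- The dual of the dual lattice is the lattice. -/
theorem mem_carrier_of_form_dual {x : V} (h : ∀ y ∈ L.dual, ∃ n : ℤ, L.form x y = n) :
    x ∈ L.carrier := by
  obtain ⟨n, b, hb⟩ := exists_basis_span_eq L.carrier L.fg L.span_eq_top
  have h2 := LinearMap.BilinForm.dualSubmodule_dualSubmodule_of_basis (R := ℤ) L.form L.nondeg L.symm b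
  rw [hb] at h2
  rw [← h2]
  intro y hy
  obtain ⟨n, hn⟩ := h y hy
  rw [hn, Submodule.mem_one]
  exact ⟨n, by simp⟩

theorem pair_cls (x y : L.dual) : L.pair (L.cls x) (L.cls y) = ((L.form x y : ℚ) : AddCircle (1 : ℚ)) :=
  rfl

theorem q_cls (x : L.dual) : L.q (L.cls x) = ((L.form x x / 2 : ℚ) : AddCircle (1 : ℚ)) := rfl

theorem cls_surjective : Function.Surjective L.cls := Submodule.Quotient.mk_surjective _

theorem cls_add (x y : L.dual) : L.cls (x + y) = L.cls x + L.cls y := rfl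

theorem cls_eq_cls_iff {x y : L.dual} : L.cls x = L.cls y ↔ (x : V) - y ∈ L.carrier :=
  Submodule.Quotient.eq _

theorem cls_eq_zero_iff {x : L.dual} : L.cls x = 0 ↔ (x : V) ∈ L.carrier :=
  Submodule.Quotient.mk_eq_zero _

theorem pair_add_left (a b c : L.A) : L.pair (a + b) c = L.pair a c + L.pair b c := by
  obtain ⟨x, rfl⟩ := L.cls_surjective a
  obtain ⟨y, rfl⟩ := L.cls_surjective b
  obtain ⟨z, rfl⟩ := L.cls_surjective c
  rw [← L.cls_add, pair_cls, pair_cls, pair_cls]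
  simp

theorem pair_comm (a b : L.A) : L.pair a b = L.pair b a := by
  obtain ⟨x, rfl⟩ := L.cls_surjective a
  obtain ⟨y, rfl⟩ := L.cls_surjective b
  rw [pair_cls, pair_cls, L.form_comm]

theorem pair_add_right (a b c : L.A) : L.pair a (b + c) = L.pair a b + L.pair a c := by
  rw [L.pair_comm, L.pair_add_left, L.pair_comm b, L.pair_comm c]

theorem pair_nondeg {a : L.A} (h : ∀ b, L.pair a b = 0) : a = 0 := by
  obtain ⟨x, rfl⟩ := L.cls_surjective a
  rw [L.cls_eq_zero_iff]
  refine L.mem_carrier_of_form_dual fun y hy ↦ ?_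
  have := h (L.cls ⟨y, hy⟩)
  rw [pair_cls, ← e_eq_one_iff, e_coe_eq_one_iff] at this
  exact this

theorem isBichar_pair : IsBichar (fun a b ↦ e (L.pair a b)) where
  add_left a b c := by rw [L.pair_add_left, e_add]
  symm a b := by rw [L.pair_comm]
  norm_eq_one a b := norm_e _
  nondeg a h := L.pair_nondeg fun b ↦ (e_eq_one_iff _).mp (h b)

/-! ### Negative definiteness of `K` and lifting of dual vectors -/

namespace MaximalIsotropic

variable {L} (I : L.MaximalIsotropic)

theorem finrank_eq_sigP_add_sigQ : Module.finrank ℚ V = L.sigP + L.sigQ := by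
  have := L.finiteDimensional
  have h := QuadraticForm.sigPos_add_sigNeg_add_radical (Q := L.form.toQuadraticMap)
  have hrad : QuadraticMap.radical L.form.toQuadraticMap = ⊥ := by
    rw [eq_bot_iff]
    intro x hx
    rw [QuadraticMap.mem_radical_iff'] at hx
    refine (Submodule.mem_bot ℚ).mpr (L.nondeg.1 x fun y ↦ ?_)
    have h1 := hx.1
    have h2 := hx.2 y
    have h3 := L.form_comm x y
    simp only [LinearMap.BilinMap.toQuadraticMap_apply, map_add, LinearMap.add_apply] at h1 h2
    linarith
  rw [hrad, finrank_bot] at h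
  exact h.symm

theorem finrank_rat : Module.finrank ℚ I.rat = L.sigP := by
  have := L.finiteDimensional
  have : Module.Finite ℤ I.carrier := Module.Finite.iff_fg.mpr (L.fg.of_le I.le)
  have : IsAddTorsionFree V := IsAddTorsionFree.of_module_rat V
  let b₀ := Module.finBasis ℤ I.carrier
  have hli : LinearIndependent ℚ (fun i ↦ (b₀ i : V)) := by
    rw [← LinearIndependent.iff_fractionRing ℤ ℚ]
    exact b₀.linearIndependent.map' I.carrier.subtype (Submodule.ker_subtype _)
  have hr : Set.range (fun i ↦ (b₀ i : V)) = I.carrier.subtype '' Set.range b₀ := by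
    rw [← Set.range_comp]; rfl
  have hs : Submodule.span ℤ (Set.range fun i ↦ (b₀ i : V)) = I.carrier := by
    rw [hr, Submodule.span_image, b₀.span_eq, Submodule.map_top, Submodule.range_subtype]
  have : I.rat = Submodule.span ℚ (Set.range fun i ↦ (b₀ i : V)) := by
    rw [← Submodule.span_span_of_tower ℤ ℚ, hs, rat]
  rw [this, finrank_span_eq_card hli, Fintype.card_fin, I.finrank_eq]

theorem rat_le_perp : I.rat ≤ I.perp := fun _ hx _ hy ↦ I.rat_isotropic hy hx

theorem mem_rat_of_form_perp {x : V} (h : ∀ y ∈ I.perp, L.form y x = 0) : x ∈ I.rat := by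
  have := L.finiteDimensional
  have hx : x ∈ L.form.orthogonal (L.form.orthogonal I.rat) := fun y hy ↦ h y hy
  rwa [LinearMap.BilinForm.orthogonal_orthogonal L.nondeg L.symm.isRefl] at hx

/-- `(p + q) - p - p = q - p`. This is what makes the weights of `f` and of the theta series
opposite. -/
theorem finrank_W : (Module.finrank ℚ I.W : ℤ) = -L.sigma := by
  have := L.finiteDimensional
  have h1 := (I.rat.submoduleOf I.perp).finrank_quotient_add_finrank
  have h2 : Module.finrank ℚ (I.rat.submoduleOf I.perp) = L.sigP := by
    rw [← I.finrank_rat]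
    exact (Submodule.submoduleOfEquivOfLe I.rat_le_perp).finrank_eq
  have h3 : Module.finrank ℚ I.perp = Module.finrank ℚ V - Module.finrank ℚ I.rat :=
    LinearMap.BilinForm.finrank_orthogonal L.nondeg I.rat
  have h4 := finrank_eq_sigP_add_sigQ (L := L)
  rw [I.finrank_rat, h4] at h3
  rw [h2, h3] at h1
  rw [sigma]
  change Module.finrank ℚ I.W + _ = _ at h1
  omega

/-- Otherwise the form is nonnegative on `I_ℚ ⊕ ℚx`, of dimension `p + 1`. Such a subspace meets a
negative definite one of dimension `q` trivially, which is impossible in dimension `p + q`. -/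
theorem form_neg_of_perp {x : V} (hx : x ∈ I.perp) (hx' : x ∉ I.rat) : L.form x x < 0 := by
  have := L.finiteDimensional
  by_contra hneg
  push Not at hneg
  have hdim : Module.finrank ℚ (I.rat ⊔ Submodule.span ℚ {x} : Submodule ℚ V) = L.sigP + 1 := by
    have hd : Disjoint I.rat (Submodule.span ℚ {x}) := by
      have hx0 : x ≠ 0 := fun h ↦ hx' (h ▸ zero_mem _)
      exact (Submodule.disjoint_span_singleton' hx0).mpr hx'
    have h0 : x ≠ 0 := fun h ↦ hx' (h ▸ zero_mem _)
    have h := Submodule.finrank_sup_add_finrank_inf_eq I.rat (Submodule.span ℚ {x})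
    rw [hd.eq_bot, finrank_bot, I.finrank_rat, finrank_span_singleton h0] at h
    exact h
  have h := QuadraticForm.sigPos_add_finrank_le_of_nonpos (Q := -L.form.toQuadraticMap)
    (V := I.rat ⊔ Submodule.span ℚ {x}) (by
      intro y hy
      obtain ⟨i, hi, z, hz, rfl⟩ := Submodule.mem_sup.mp hy
      obtain ⟨c, rfl⟩ := Submodule.mem_span_singleton.mp hz
      have h1 := I.rat_isotropic hi hi
      have h2 := I.form_perp_left hi hx
      have h3 := I.form_perp_right hx hi
      simp only [_root_.neg_apply, LinearMap.BilinMap.toQuadraticMap_apply, map_add,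
        LinearMap.add_apply, map_smul, LinearMap.smul_apply, h1, h2, h3, smul_eq_mul]
      nlinarith [mul_nonneg (mul_self_nonneg c) hneg])
  rw [sigPos_neg, hdim, finrank_eq_sigP_add_sigQ (L := L)] at h
  change L.sigQ + _ ≤ _ at h
  omega

theorem formW_neg {k : I.W} (hk : k ≠ 0) : I.formW k k < 0 := by
  obtain ⟨x, rfl⟩ := I.proj_surjective k
  refine I.form_neg_of_perp x.2 fun h ↦ hk ?_
  exact (Submodule.Quotient.mk_eq_zero _).mpr h

theorem proj_eq_zero_iff {x : I.perp} : I.proj x = 0 ↔ (x : V) ∈ I.rat :=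
  Submodule.Quotient.mk_eq_zero _

theorem proj_mem_K {x : I.perp} (hx : (x : V) ∈ L.carrier) : I.proj x ∈ I.K.carrier :=
  ⟨x, hx, rfl⟩

theorem proj_mem_K_dual {x : I.perp} (hx : (x : V) ∈ L.dual) : I.proj x ∈ I.K.dual := by
  rw [mem_dual_iff]
  rintro _ ⟨y, hy, rfl⟩
  exact L.dual_pair hx hy

theorem exists_proj_eq_of_mem_K {k : I.W} (hk : k ∈ I.K.carrier) :
    ∃ x : I.perp, (x : V) ∈ L.carrier ∧ I.proj x = k := by
  obtain ⟨x, hx, rfl⟩ := hk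
  exact ⟨x, hx, rfl⟩

theorem mem_perp_of_form_carrier {x : V} (h : ∀ y ∈ I.carrier, L.form y x = 0) : x ∈ I.perp := by
  intro y hy
  change L.form y x = 0
  induction hy using Submodule.span_induction with
  | mem y hy => exact h y hy
  | zero => simp
  | add y z _ _ h1 h2 => simp [h1, h2]
  | smul a y _ h => simp [h]

/-- The projection maps `L^∨ ∩ I^⊥` onto `K^∨`. -/
theorem exists_proj_eq_of_mem_K_dual {k : I.W} (hk : k ∈ I.K.dual) :
    ∃ x : I.perp, (x : V) ∈ L.dual ∧ I.proj x = k := by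
  obtain ⟨x, rfl⟩ := I.proj_surjective k
  -- The functional `(x, ·)` is integral on `L ∩ I^⊥`. Composing it with a retraction of `L` onto `L
  -- ∩ I^⊥` extends it integrally to `L`, so a vector `y` of `L^∨` represents it.
  obtain ⟨r, hr, hr'⟩ := exists_retraction L.carrier L.fg I.perp
  let φ : L.carrier →ₗ[ℤ] ℚ :=
    ((L.form x).restrictScalars ℤ) ∘ₗ L.carrier.subtype ∘ₗ r
  have hφ : ∀ l, φ l = L.form x (r l) := fun _ ↦ rfl
  obtain ⟨y, hy⟩ := exists_form_eq L.form L.nondeg L.carrier L.fg L.span_eq_top φ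
  have hyd : y ∈ L.dual := by
    rw [mem_dual_iff]
    intro l hl
    rw [hy ⟨l, hl⟩, hφ]
    exact I.K.dual_pair hk (I.proj_mem_K (x := ⟨r ⟨l, hl⟩, hr _⟩) (r ⟨l, hl⟩).2)
  -- Both vectors pair equally with `L ∩ I^⊥`, hence after clearing denominators with `I^⊥`, and
  -- `I^⊥⊥ = I_ℚ`.
  have hdiff : y - x ∈ I.rat := by
    refine I.mem_rat_of_form_perp fun z hz ↦ ?_
    obtain ⟨m, hm, hmz⟩ := L.exists_smul_mem z
    have h1 := hy ⟨m • z, hmz⟩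
    rw [hφ, hr' ⟨m • z, hmz⟩ (I.perp.toAddSubgroup.zsmul_mem hz m)] at h1
    have hm' : (m : ℚ) ≠ 0 := by exact_mod_cast hm
    simp only [map_zsmul, zsmul_eq_mul, mul_right_inj' hm'] at h1
    rw [L.form_comm, map_sub, LinearMap.sub_apply, h1, sub_self]
  have hyp : y ∈ I.perp := by
    have := I.perp.add_mem (I.rat_le_perp hdiff) x.2
    rwa [sub_add_cancel] at this
  refine ⟨⟨y, hyp⟩, hyd, ?_⟩
  rw [← sub_eq_zero, ← map_sub, proj_eq_zero_iff]
  exact hdiff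

theorem carrier_le_star : I.carrier ≤ I.star := fun _ hx ↦
  ⟨Submodule.subset_span hx, L.carrier_le_dual (I.le hx)⟩

/-- A vector of `L^∨` which is integral on `I^*` lies in `I^⊥ + L`. -/
theorem exists_sub_mem_perp {z : V} (h : ∀ y ∈ I.star, ∃ n : ℤ, L.form z y = n) :
    ∃ l ∈ L.carrier, z - l ∈ I.perp := by
  -- The dual argument: extend `(z, ·)` from `I^*` to an integral functional on `L^∨`. It is
  -- represented by a vector of `L^∨∨ = L`, which agrees with `z` on `I`.
  obtain ⟨r, hr, hr'⟩ := exists_retraction L.dual L.dual_fg I.rat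
  let φ : L.dual →ₗ[ℤ] ℚ := ((L.form z).restrictScalars ℤ) ∘ₗ L.dual.subtype ∘ₗ r
  have hφ : ∀ l, φ l = L.form z (r l) := fun _ ↦ rfl
  obtain ⟨l, hl⟩ := exists_form_eq L.form L.nondeg L.dual L.dual_fg L.span_dual_eq_top φ
  refine ⟨l, L.mem_carrier_of_form_dual fun y hy ↦ ?_, ?_⟩
  · rw [hl ⟨y, hy⟩, hφ]
    exact h _ ⟨hr _, (r ⟨y, hy⟩).2⟩
  · refine I.mem_perp_of_form_carrier fun y hy ↦ ?_
    have hy' := I.carrier_le_star hy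
    have h1 := hl ⟨y, hy'.2⟩
    rw [hφ, hr' ⟨y, hy'.2⟩ hy'.1] at h1
    rw [L.form_comm, map_sub, LinearMap.sub_apply, h1, sub_self]

end MaximalIsotropic

end EvenLattice

end ThetaProduct

end

noncomputable section

namespace ThetaProduct

namespace EvenLattice

namespace MaximalIsotropic

variable {V : Type*} [AddCommGroup V] [Module ℚ V] {L : EvenLattice V} (I : L.MaximalIsotropic)

/-! ### The theta series of `K(-1)`, pulled back to `A_L` -/

/-- The image in `K^∨` of the vectors of `L^∨ ∩ I^⊥` of a given class in `A_L`. -/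
def thetaSet (a : L.A) : Set I.W :=
  {k | ∃ (x : I.perp) (h : (x : V) ∈ L.dual), L.cls ⟨x, h⟩ = a ∧ I.proj x = k}

/-- The component at `a ∈ A_L` of the pullback of `Θ_{K(-1)}` to `ℂA_L`. -/
def thetaUp (a : L.A) (τ : ℍ) : ℂ := ∑' k : I.thetaSet a, qpow (-(I.formW k k) / 2) τ

theorem proj_mk_eq_zero {x : V} (hx : x ∈ I.rat) : I.proj ⟨x, I.rat_le_perp hx⟩ = 0 :=
  I.proj_eq_zero_iff.mpr hx

theorem thetaSet_subset (a : L.A) : I.thetaSet a ⊆ I.K.dual := by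
  rintro _ ⟨x, h, -, rfl⟩
  exact I.proj_mem_K_dual h

theorem mem_thetaSet_zero {k : I.W} (hk : k ∈ I.K.carrier) : k ∈ I.thetaSet 0 := by
  obtain ⟨x, hx, rfl⟩ := I.exists_proj_eq_of_mem_K hk
  exact ⟨x, L.carrier_le_dual hx, L.cls_eq_zero_iff.mpr hx, rfl⟩

theorem add_mem_thetaSet {a b : L.A} {k l : I.W} (hk : k ∈ I.thetaSet a)
    (hl : l ∈ I.thetaSet b) : k + l ∈ I.thetaSet (a + b) := by
  obtain ⟨x, hx, rfl, rfl⟩ := hk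
  obtain ⟨y, hy, rfl, rfl⟩ := hl
  exact ⟨x + y, add_mem hx hy, rfl, map_add _ _ _⟩

theorem neg_mem_thetaSet {a : L.A} {k : I.W} (hk : k ∈ I.thetaSet a) :
    -k ∈ I.thetaSet (-a) := by
  obtain ⟨x, hx, rfl, rfl⟩ := hk
  exact ⟨-x, neg_mem hx, rfl, map_neg _ _⟩

theorem add_mem_thetaSet_of_mem_K {a : L.A} {k l : I.W} (hk : k ∈ I.thetaSet a)
    (hl : l ∈ I.K.carrier) : k + l ∈ I.thetaSet a := by
  have := I.add_mem_thetaSet hk (I.mem_thetaSet_zero hl)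
  rwa [add_zero] at this

theorem sub_mem_K_of_mem_thetaSet {a : L.A} {k l : I.W} (hk : k ∈ I.thetaSet a)
    (hl : l ∈ I.thetaSet a) : k - l ∈ I.K.carrier := by
  obtain ⟨x, hx, hxa, rfl⟩ := hk
  obtain ⟨y, hy, hya, rfl⟩ := hl
  rw [← map_sub]
  exact I.proj_mem_K (L.cls_eq_cls_iff.mp (hxa.trans hya.symm))

theorem e_formW_eq {a b : L.A} {k l : I.W} (hk : k ∈ I.thetaSet a) (hl : l ∈ I.thetaSet b) :
    e ((I.formW k l : ℚ) : AddCircle (1 : ℚ)) = e (L.pair a b) := by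
  obtain ⟨x, hx, rfl, rfl⟩ := hk
  obtain ⟨y, hy, rfl, rfl⟩ := hl
  rfl

/-- The combination of the two defining relations of `↓^L_K`. -/
theorem exists_relation_iff (a : L.A) (l : I.K.A) :
    (∃ m : I.overlattice.A,
      (∃ (x : I.perp) (h : (x : V) ∈ I.overlattice.dual) (h' : I.proj x ∈ I.K.dual),
        I.overlattice.cls ⟨x, h⟩ = m ∧ I.K.cls ⟨I.proj x, h'⟩ = l) ∧
      (∃ (x : V) (h : x ∈ L.dual) (h' : x ∈ I.overlattice.dual),
        L.cls ⟨x, h⟩ = a ∧ I.overlattice.cls ⟨x, h'⟩ = m)) ↔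
    ∃ k, ∃ h : k ∈ I.K.dual, k ∈ I.thetaSet a ∧ I.K.cls ⟨k, h⟩ = l := by
  constructor
  · rintro ⟨m, ⟨x, hx, hx', hxm, rfl⟩, y, hy, hy', rfl, hym⟩
    refine ⟨I.proj x, hx', ?_, rfl⟩
    -- The two representatives differ by `l + i` with `l ∈ L` and `i ∈ I^*`. Adding `i` to `x`
    -- reaches the class `a` without changing its projection.
    have hd := I.overlattice.cls_eq_cls_iff.mp (hym.trans hxm.symm)
    obtain ⟨l, hl, i, hi, hli⟩ := Submodule.mem_sup.mp hd
    have hu : (x : V) + i = y - l := by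
      have : l + i = y - x := hli
      rw [eq_sub_iff_add_eq, add_assoc, add_comm i l, this, add_sub_cancel]
    have hud : (x : V) + i ∈ L.dual := by
      rw [hu]; exact sub_mem hy (L.carrier_le_dual hl)
    refine ⟨x + ⟨i, I.rat_le_perp hi.1⟩, hud, ?_, ?_⟩
    · rw [L.cls_eq_cls_iff]
      change (x : V) + i - y ∈ L.carrier
      rw [hu, sub_sub_cancel_left]
      exact neg_mem hl
    · rw [map_add, I.proj_mk_eq_zero hi.1, add_zero]
  · rintro ⟨_, h, ⟨x, hx, rfl, rfl⟩, rfl⟩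
    have hx' : (x : V) ∈ I.overlattice.dual := by
      rw [mem_dual_iff]
      intro y hy
      obtain ⟨l, hl, i, hi, rfl⟩ := Submodule.mem_sup.mp hy
      obtain ⟨n, hn⟩ := L.dual_pair hx hl
      refine ⟨n, ?_⟩
      change L.form x (l + i) = n
      rw [map_add, I.form_perp_right x.2 hi.1, add_zero, hn]
    exact ⟨I.overlattice.cls ⟨x, hx'⟩, ⟨x, hx', h, rfl, rfl⟩, x, hx, hx', rfl, rfl⟩

theorem relation_unique {a : L.A} {m m' : I.overlattice.A}
    (h : ∃ (x : V) (h : x ∈ L.dual) (h' : x ∈ I.overlattice.dual),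
        L.cls ⟨x, h⟩ = a ∧ I.overlattice.cls ⟨x, h'⟩ = m)
    (h' : ∃ (x : V) (h : x ∈ L.dual) (h' : x ∈ I.overlattice.dual),
        L.cls ⟨x, h⟩ = a ∧ I.overlattice.cls ⟨x, h'⟩ = m') : m = m' := by
  obtain ⟨x, hx, hx', hxa, rfl⟩ := h
  obtain ⟨y, hy, hy', hya, rfl⟩ := h'
  rw [cls_eq_cls_iff]
  exact Submodule.mem_sup_left (L.cls_eq_cls_iff.mp (hxa.trans hya.symm))

open Classical in
-- The intermediate class in `A_{L^*}` is determined by `a`, so composing the two sums introduces no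
-- multiplicities.
theorem down_apply (v : L.A → ℂ) (l : I.K.A) :
    I.down v l = ∑ a, if ∃ k, ∃ h : k ∈ I.K.dual, k ∈ I.thetaSet a ∧ I.K.cls ⟨k, h⟩ = l
      then v a else 0 := by
  simp only [down, ident, push]
  simp_rw [← Finset.sum_filter (s := Finset.univ (α := L.A)), ← I.exists_relation_iff]
  rw [← Finset.sum_filter, Finset.sum_sigma']
  symm
  refine Finset.sum_bij' (i := fun a ha ↦ ⟨(Finset.mem_filter.mp ha).2.choose, a⟩)
    (j := fun p _ ↦ p.2) ?_ ?_ ?_ ?_ ?_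
  · intro a ha
    have := (Finset.mem_filter.mp ha).2.choose_spec
    simp only [Finset.mem_sigma, Finset.mem_filter, Finset.mem_univ, true_and]
    exact this
  · rintro ⟨m, a⟩ h
    simp only [Finset.mem_sigma, Finset.mem_filter, Finset.mem_univ, true_and] at h ⊢
    exact ⟨m, h⟩
  · intro a ha; rfl
  · rintro ⟨m, a⟩ h
    simp only [Finset.mem_sigma, Finset.mem_filter, Finset.mem_univ, true_and] at h
    have hex : ∃ m : I.overlattice.A,
      (∃ (x : I.perp) (h : (x : V) ∈ I.overlattice.dual) (h' : I.proj x ∈ I.K.dual),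
        I.overlattice.cls ⟨x, h⟩ = m ∧ I.K.cls ⟨I.proj x, h'⟩ = l) ∧
      (∃ (x : V) (h : x ∈ L.dual) (h' : x ∈ I.overlattice.dual),
        L.cls ⟨x, h⟩ = a ∧ I.overlattice.cls ⟨x, h'⟩ = m) := ⟨m, h⟩
    have : hex.choose = m := I.relation_unique hex.choose_spec.2 h.2
    exact Sigma.ext this HEq.rfl
  · intro a ha; rfl

open Classical in
-- `thetaSet a` is either empty or a single coset of `K`, so at most one class `l` contributes.
theorem sum_thetaNeg_eq (a : L.A) (τ : ℍ) :
    (∑ l, if ∃ k, ∃ h : k ∈ I.K.dual, k ∈ I.thetaSet a ∧ I.K.cls ⟨k, h⟩ = l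
      then I.K.thetaNeg τ l else 0) = I.thetaUp a τ := by
  by_cases hne : (I.thetaSet a).Nonempty
  · obtain ⟨k₀, hk₀⟩ := hne
    have hk₀' := I.thetaSet_subset a hk₀
    rw [Finset.sum_eq_single (I.K.cls ⟨k₀, hk₀'⟩)]
    · rw [if_pos ⟨k₀, hk₀', hk₀, rfl⟩]
      let E : {x : I.K.dual // I.K.cls x = I.K.cls ⟨k₀, hk₀'⟩} ≃ I.thetaSet a :=
        { toFun := fun x ↦ ⟨x.1, by
            have := I.add_mem_thetaSet_of_mem_K hk₀ (I.K.cls_eq_cls_iff.mp x.2)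
            rwa [add_sub_cancel] at this⟩
          invFun := fun k ↦ ⟨⟨k, I.thetaSet_subset a k.2⟩,
            I.K.cls_eq_cls_iff.mpr (I.sub_mem_K_of_mem_thetaSet k.2 hk₀)⟩
          left_inv := fun x ↦ rfl
          right_inv := fun k ↦ rfl }
      rw [thetaUp, thetaNeg, ← E.tsum_eq]
      rfl
    · intro l _ hl
      refine if_neg ?_
      rintro ⟨k, h, hk, rfl⟩
      exact hl (I.K.cls_eq_cls_iff.mpr (I.sub_mem_K_of_mem_thetaSet hk hk₀))
    · simp
  · rw [Finset.sum_eq_zero]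
    · rw [Set.not_nonempty_iff_eq_empty] at hne
      have : IsEmpty (I.thetaSet a) := Set.isEmpty_coe_sort.mpr hne
      rw [thetaUp, tsum_empty]
    · intro l _
      refine if_neg ?_
      rintro ⟨k, h, hk, rfl⟩
      exact hne ⟨k, hk⟩

/-- Adjointness: instead of pushing `f` down to `A_K`, the theta series is pulled up to `A_L`. All
later work uses this form, in which the overlattice no longer appears. -/
theorem xi_eq (f : ℍ → L.A → ℂ) (τ : ℍ) : I.xi f τ = ∑ a, f τ a * I.thetaUp a τ := by
  classical
  simp_rw [xi, I.down_apply, Finset.sum_mul]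
  rw [Finset.sum_comm]
  refine Finset.sum_congr rfl fun a _ ↦ ?_
  rw [← I.sum_thetaNeg_eq, Finset.mul_sum]
  refine Finset.sum_congr rfl fun l _ ↦ ?_
  split_ifs <;> simp

theorem qpow_add_one (r : ℚ) (τ : ℍ) :
    qpow r (ModularGroup.T • τ) = e (r : AddCircle (1 : ℚ)) * qpow r τ := by
  rw [e_coe, qpow, qpow, ← Complex.exp_add, UpperHalfPlane.modular_T_smul]
  congr 1
  simp
  ring

theorem thetaUp_T (a : L.A) (τ : ℍ) :
    I.thetaUp a (ModularGroup.T • τ) = e (-(L.q a)) * I.thetaUp a τ := by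
  rw [thetaUp, thetaUp, ← tsum_mul_left]
  refine tsum_congr fun k ↦ ?_
  rw [qpow_add_one]
  congr 1
  obtain ⟨x, hx, rfl, hk⟩ := k.2
  rw [← hk, L.q_cls, formW_proj, ← AddCircle.coe_neg, neg_div]

/-! ### Orthogonal frames -/

/-- An orthogonal basis of `K ⊗ ℚ` consisting of vectors of `K`. -/
structure OrthFrame (n : ℕ) where
  vec : Module.Basis (Fin n) ℚ I.W
  N : Fin n → ℕ
  neZero : ∀ i, NeZero (N i)
  mem : ∀ i, vec i ∈ I.K.carrier
  form_self : ∀ i, I.formW (vec i) (vec i) = -(N i : ℚ)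
  ortho : ∀ i j, i ≠ j → I.formW (vec i) (vec j) = 0

/-- Scale a rational orthogonal basis into `K`; negative definiteness makes each `N i` a positive
integer. -/
theorem nonempty_orthFrame : Nonempty (I.OrthFrame (Module.finrank ℚ I.W)) := by
  have := I.K.finiteDimensional
  have : Invertible (2 : ℚ) := invertibleOfNonzero two_ne_zero
  obtain ⟨v, hv⟩ := LinearMap.BilinForm.exists_orthogonal_basis (B := I.K.form)
    ⟨fun x y ↦ I.K.symm.eq x y⟩
  choose m hm hmv using fun i ↦ I.K.exists_smul_mem (v i)
  have hm' : ∀ i, IsUnit (m i : ℚ) := fun i ↦ by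
    rw [isUnit_iff_ne_zero]; exact_mod_cast hm i
  let w := v.isUnitSMul hm'
  have hw : ∀ i, w i = m i • v i := fun i ↦ by
    rw [Module.Basis.isUnitSMul_apply, Int.cast_smul_eq_zsmul]
  have hwK : ∀ i, w i ∈ I.K.carrier := fun i ↦ by rw [hw]; exact hmv i
  have hneg : ∀ i, I.formW (w i) (w i) < 0 := fun i ↦ I.formW_neg (w.ne_zero i)
  have hN : ∀ i, ∃ N : ℕ, N ≠ 0 ∧ I.formW (w i) (w i) = -(N : ℚ) := fun i ↦ by
    obtain ⟨t, ht⟩ := I.K.even (w i) (hwK i)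
    have ht' : I.formW (w i) (w i) = 2 * t := ht
    have h := hneg i
    rw [ht'] at h
    have h0 : 2 * t < 0 := by exact_mod_cast h
    refine ⟨(-(2 * t)).toNat, by omega, ?_⟩
    rw [ht']
    have h1 : (((-(2 * t)).toNat : ℤ) : ℚ) = ((-(2 * t) : ℤ) : ℚ) := by
      rw [Int.toNat_of_nonneg (by omega)]
    rw [Int.cast_natCast] at h1
    rw [h1]
    push_cast
    ring
  choose N hN0 hN using hN
  refine ⟨w, N, fun i ↦ ⟨hN0 i⟩, hwK, hN, fun i j hij ↦ ?_⟩
  have : I.formW (v i) (v j) = 0 := hv hij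
  rw [hw, hw, map_zsmul, map_zsmul, LinearMap.smul_apply, this, smul_zero, smul_zero]

namespace OrthFrame

variable {I} {n : ℕ} (F : I.OrthFrame n)

instance (i : Fin n) : NeZero (F.N i) := F.neZero i

theorem N_ne_zero (i : Fin n) : (F.N i : ℚ) ≠ 0 := by exact_mod_cast (F.neZero i).ne

/-- The vector `k` with `(k, v_i) = m_i`. -/
def pt (m : Fin n → ℤ) : I.W := -∑ i, ((m i : ℚ) / F.N i) • F.vec i

theorem formW_pt_vec (m : Fin n → ℤ) (i : Fin n) : I.formW (F.pt m) (F.vec i) = m i := by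
  rw [pt, map_neg, LinearMap.neg_apply, map_sum, LinearMap.sum_apply,
    Finset.sum_eq_single i (fun j _ hj ↦ by simp [F.ortho j i hj]) (by simp)]
  simp [F.form_self, F.N_ne_zero]

theorem formW_pt (m : Fin n → ℤ) (k : I.W) :
    I.formW k (F.pt m) = -∑ i, (m i : ℚ) / F.N i * I.formW k (F.vec i) := by
  rw [pt, map_neg, map_sum]
  simp

theorem formW_pt_pt (m m' : Fin n → ℤ) :
    I.formW (F.pt m) (F.pt m') = -∑ i, (m i : ℚ) * m' i / F.N i := by
  rw [formW_pt]
  congr 1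
  refine Finset.sum_congr rfl fun i _ ↦ ?_
  rw [formW_pt_vec]
  ring

theorem pt_injective : Function.Injective F.pt := fun m m' h ↦ by
  funext i
  have := F.formW_pt_vec m i
  rw [h, formW_pt_vec] at this
  exact_mod_cast this.symm

theorem exists_pt_eq {k : I.W} (hk : k ∈ I.K.dual) : ∃ m, F.pt m = k := by
  choose m hm using fun i ↦ I.K.dual_pair hk (F.mem i)
  refine ⟨m, ?_⟩
  have h : ∀ i, I.formW (F.pt m - k) (F.vec i) = 0 := fun i ↦ by
    have : I.formW k (F.vec i) = m i := hm i
    rw [map_sub, LinearMap.sub_apply, F.formW_pt_vec, this, sub_self]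
  have h2 : I.formW (F.pt m - k) = 0 := F.vec.ext fun i ↦ by simpa using h i
  rw [← sub_eq_zero]
  exact I.K.nondeg.1 _ fun y ↦ by
    change I.formW (F.pt m - k) y = 0
    rw [h2]; rfl

theorem pt_add (m m' : Fin n → ℤ) : F.pt (m + m') = F.pt m + F.pt m' := by
  simp only [pt, Pi.add_apply, Int.cast_add, add_div, add_smul, Finset.sum_add_distrib, neg_add]

theorem pt_neg (m : Fin n → ℤ) : F.pt (-m) = -F.pt m := by
  simp [pt, neg_div, Finset.sum_neg_distrib]

theorem pt_sub (m m' : Fin n → ℤ) : F.pt (m - m') = F.pt m - F.pt m' := by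
  rw [sub_eq_add_neg, pt_add, pt_neg, ← sub_eq_add_neg]

/-- Reduction of coordinates. -/
def red (m : Fin n → ℤ) : ∀ i, ZMod (F.N i) := fun i ↦ (m i : ZMod (F.N i))

theorem red_surjective : Function.Surjective F.red := fun b ↦ by
  choose m hm using fun i ↦ ZMod.intCast_surjective (b i)
  exact ⟨m, funext hm⟩

theorem red_add (m m' : Fin n → ℤ) : F.red (m + m') = F.red m + F.red m' := by
  funext i; simp [red]

theorem red_neg (m : Fin n → ℤ) : F.red (-m) = -F.red m := by
  funext i; simp [red]

/-- Changing `m i` by a multiple of `N i` moves the point by an integral multiple of `vec i ∈ K`.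
Membership in `thetaSet a` therefore depends only on the residues. -/
theorem pt_sub_mem_K {m m' : Fin n → ℤ} (h : F.red m = F.red m') :
    F.pt m - F.pt m' ∈ I.K.carrier := by
  rw [← pt_sub, pt]
  refine neg_mem (sum_mem fun i _ ↦ ?_)
  have h1 : (m i : ZMod (F.N i)) = m' i := congrFun h i
  have h2 : ((m i - m' i : ℤ) : ZMod (F.N i)) = 0 := by push_cast; rw [h1, sub_self]
  obtain ⟨j, hj⟩ := (ZMod.intCast_zmod_eq_zero_iff_dvd _ _).mp h2
  have : (((m - m') i : ℤ) : ℚ) / F.N i = (j : ℚ) := by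
    rw [Pi.sub_apply, hj]
    push_cast
    field_simp [F.N_ne_zero i]
  rw [this, Int.cast_smul_eq_zsmul]
  exact I.K.carrier.smul_mem j (F.mem i)

/-- The Lagrangian correspondence between `A_L` and the discriminant group of the lattice spanned
by the frame. -/
def corr : AddSubgroup (L.A × ∀ i, ZMod (F.N i)) where
  carrier := {p | ∃ m, F.red m = p.2 ∧ F.pt m ∈ I.thetaSet p.1}
  zero_mem' := ⟨0, by funext i; simp [red], I.mem_thetaSet_zero (by simp [pt])⟩
  add_mem' := by
    rintro ⟨a, _⟩ ⟨b, _⟩ ⟨m, rfl, hm⟩ ⟨m', rfl, hm'⟩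
    exact ⟨m + m', F.red_add m m', by rw [pt_add]; exact I.add_mem_thetaSet hm hm'⟩
  neg_mem' := by
    rintro ⟨a, _⟩ ⟨m, rfl, hm⟩
    exact ⟨-m, F.red_neg m, by rw [pt_neg]; exact I.neg_mem_thetaSet hm⟩

theorem mem_corr_iff (a : L.A) (m : Fin n → ℤ) :
    (a, F.red m) ∈ F.corr ↔ F.pt m ∈ I.thetaSet a := by
  refine ⟨?_, fun h ↦ ⟨m, rfl, h⟩⟩
  rintro ⟨m', h, hm'⟩
  have := I.add_mem_thetaSet_of_mem_K hm' (F.pt_sub_mem_K h.symm)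
  rwa [add_sub_cancel] at this

theorem prod_char_eq (m m' : Fin n → ℤ) :
    ∏ i, (ZMod.stdAddChar (F.red m i * F.red m' i))⁻¹
      = e ((I.formW (F.pt m) (F.pt m') : ℚ) : AddCircle (1 : ℚ)) := by
  rw [formW_pt_pt, e_coe]
  push_cast
  rw [mul_neg, Finset.mul_sum, ← Finset.sum_neg_distrib, Complex.exp_sum]
  refine Finset.prod_congr rfl fun i _ ↦ ?_
  have : F.red m i * F.red m' i = ((m i * m' i : ℤ) : ZMod (F.N i)) := by simp [red]
  rw [this, ZMod.stdAddChar_coe, ← Complex.exp_neg]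
  congr 1
  push_cast
  ring

/-- Isotropy holds because projecting `I^⊥` modulo `I_ℚ` preserves the form. For maximality, a pair
orthogonal to the correspondence is tested first on `I^*` and then on lifts of all of `K^∨`. -/
theorem isLagrangian_corr : IsBichar.IsLagrangian (fun a b ↦ e (L.pair a b))
    (fun b b' : ∀ i, ZMod (F.N i) ↦ ∏ i, (ZMod.stdAddChar (b i * b' i))⁻¹) F.corr := by
  rintro ⟨a, b⟩
  constructor
  · rintro ⟨m, rfl, hm⟩ ⟨a', _⟩ ⟨m', rfl, hm'⟩
    dsimp only at hm hm' ⊢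
    rw [prod_char_eq, I.e_formW_eq hm' hm]
  · intro h
    obtain ⟨m, rfl⟩ := F.red_surjective b
    obtain ⟨z, rfl⟩ := L.cls_surjective a
    have h1 : ∀ (x : I.perp) (hx : (x : V) ∈ L.dual),
        ∃ j : ℤ, L.form x z - I.formW (I.proj x) (F.pt m) = j := by
      intro x hx
      obtain ⟨m', hm'⟩ := F.exists_pt_eq (I.proj_mem_K_dual hx)
      have h2 := h (L.cls ⟨x, hx⟩, F.red m') ⟨m', rfl, x, hx, rfl, hm'.symm⟩
      dsimp only at h2
      rw [prod_char_eq, pair_cls, hm'] at h2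
      rw [← e_coe_eq_one_iff, AddCircle.coe_sub, sub_eq_add_neg, e_add, e_neg, h2]
      exact mul_inv_cancel₀ (e_ne_zero _)
    -- Vectors of `I^*` project to `0`, so orthogonality makes `z` integral on `I^*` and its class
    -- has a representative in `I^⊥`.
    obtain ⟨l, hl, hlp⟩ := I.exists_sub_mem_perp (z := z) (by
      intro y hy
      obtain ⟨j, hj⟩ := h1 ⟨y, I.rat_le_perp hy.1⟩ hy.2
      rw [I.proj_mk_eq_zero hy.1, map_zero,
        LinearMap.zero_apply, sub_zero] at hj
      exact ⟨j, by rw [L.form_comm]; exact hj⟩)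
    have hzd : (z : V) - l ∈ L.dual := sub_mem z.2 (L.carrier_le_dual hl)
    let u : I.perp := ⟨z - l, hlp⟩
    -- This difference is integral on `K^∨`, since every vector of `K^∨` lifts to `L^∨ ∩ I^⊥`.
    have hK : F.pt m - I.proj u ∈ I.K.carrier := by
      refine I.K.mem_carrier_of_form_dual fun k hk ↦ ?_
      obtain ⟨x, hx, rfl⟩ := I.exists_proj_eq_of_mem_K_dual hk
      obtain ⟨j, hj⟩ := h1 x hx
      obtain ⟨j', hj'⟩ := L.dual_pair hx hl
      refine ⟨-j + j', ?_⟩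
      change I.formW (F.pt m - I.proj u) (I.proj x) = _
      have e1 : I.formW (F.pt m) (I.proj x) = I.formW (I.proj x) (F.pt m) := I.K.form_comm _ _
      have e2 : I.formW (I.proj u) (I.proj x) = L.form x z - L.form x l := by
        rw [formW_proj, L.form_comm, ← map_sub]
      rw [map_sub, LinearMap.sub_apply, e1, e2, hj']
      push_cast
      linarith
    refine (F.mem_corr_iff _ m).mpr ?_
    have hu : I.proj u ∈ I.thetaSet (L.cls z) := by
      refine ⟨u, hzd, L.cls_eq_cls_iff.mpr ?_, rfl⟩
      change (z : V) - l - z ∈ L.carrier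
      rw [sub_sub_cancel_left]
      exact neg_mem hl
    have := I.add_mem_thetaSet_of_mem_K hu hK
    rwa [add_sub_cancel] at this

theorem qpow_pt (m : Fin n → ℤ) (τ : ℍ) :
    qpow (-(I.formW (F.pt m) (F.pt m)) / 2) τ = ∏ i, gaussTerm (F.N i) (m i) τ := by
  simp_rw [gaussTerm]
  rw [← Complex.exp_sum, qpow, formW_pt_pt]
  congr 1
  push_cast
  rw [neg_neg, Finset.sum_div, Finset.mul_sum, Finset.sum_mul]
  refine Finset.sum_congr rfl fun i _ ↦ ?_
  ring

open Classical in
-- The coordinates `m i = (k, vec i)` turn `thetaSet a` into a periodic subset of `ℤⁿ` and the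
-- summand into a product of Gaussians.
theorem hasSum_thetaUp (a : L.A) (τ : ℍ) :
    HasSum (fun k : I.thetaSet a ↦ qpow (-(I.formW k k) / 2) τ)
      (∑ b, if (a, b) ∈ F.corr then ∏ i, theta1 (F.N i) (b i) τ else 0) := by
  have h := hasSum_periodic F.N {b | (a, b) ∈ F.corr} (τ := (τ : ℂ)) τ.im_pos
  have h2 : HasSum ({m | F.pt m ∈ I.thetaSet a}.indicator
      fun m : Fin n → ℤ ↦ ∏ i, gaussTerm (F.N i) (m i) τ)
      (∑ b, if (a, b) ∈ F.corr then ∏ i, theta1 (F.N i) (b i) τ else 0) := by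
    refine h.congr_fun fun m ↦ ?_
    rw [Set.indicator_apply]
    refine if_congr ?_ rfl rfl
    exact (F.mem_corr_iff a m).symm
  rw [← hasSum_subtype_iff_indicator] at h2
  let E : {m | F.pt m ∈ I.thetaSet a} ≃ I.thetaSet a :=
    Equiv.ofBijective (fun m ↦ ⟨F.pt m, m.2⟩)
      ⟨fun m m' hmm ↦ Subtype.ext (F.pt_injective (congrArg Subtype.val hmm)), fun k ↦ by
        obtain ⟨m, hm⟩ := F.exists_pt_eq (I.thetaSet_subset a k.2)
        exact ⟨⟨m, by rw [Set.mem_ofPred_eq, hm]; exact k.2⟩, Subtype.ext hm⟩⟩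
  rw [← E.hasSum_iff]
  refine h2.congr_fun fun m ↦ ?_
  exact F.qpow_pt m τ

open Classical in
theorem thetaUp_eq (a : L.A) (τ : ℍ) : I.thetaUp a τ
    = ∑ b, if (a, b) ∈ F.corr then ∏ i, theta1 (F.N i) (b i) τ else 0 :=
  (F.hasSum_thetaUp a τ).tsum_eq

end OrthFrame

theorem summable_thetaUp (a : L.A) (τ : ℍ) :
    Summable fun k : I.thetaSet a ↦ qpow (-(I.formW k k) / 2) τ := by
  obtain ⟨F⟩ := I.nonempty_orthFrame
  exact (F.hasSum_thetaUp a τ).summable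

theorem mdifferentiable_thetaUp (a : L.A) : MDifferentiable 𝓘(ℂ) 𝓘(ℂ) (I.thetaUp a) := by
  classical
  obtain ⟨F⟩ := I.nonempty_orthFrame
  rw [UpperHalfPlane.mdifferentiable_iff]
  have h : DifferentiableOn ℂ (fun z : ℂ ↦ ∑ b, if (a, b) ∈ F.corr
      then ∏ i, theta1 (F.N i) (b i) z else 0) {z | 0 < z.im} := by
    refine DifferentiableOn.fun_sum fun b _ ↦ ?_
    split_ifs
    · exact DifferentiableOn.fun_finsetProd fun i _ z hz ↦
        (differentiableAt_theta1 (F.N i) (b i) hz).differentiableWithinAt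
    · exact differentiableOn_const _
  refine h.congr fun z hz ↦ ?_
  rw [Function.comp_apply, F.thetaUp_eq, ofComplex_apply_of_im_pos hz]

theorem thetaUp_isBigO (a : L.A) : I.thetaUp a =O[atImInfty] fun _ ↦ (1 : ℂ) := by
  classical
  obtain ⟨F⟩ := I.nonempty_orthFrame
  rw [show I.thetaUp a = fun τ : ℍ ↦ ∑ b, if (a, b) ∈ F.corr
      then ∏ i, theta1 (F.N i) (b i) τ else 0 from funext fun τ ↦ F.thetaUp_eq a τ]
  refine IsBigO.fun_sum fun b _ ↦ ?_
  split_ifs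
  · refine IsBigO.of_bound (∏ i, ∑' m : ℤ, ‖gaussTerm (F.N i) m Complex.I‖) ?_
    filter_upwards [(atImInfty_mem _).mpr ⟨1, fun z hz ↦ hz⟩] with τ hτ
    rw [norm_prod, norm_one, mul_one]
    exact Finset.prod_le_prod (fun _ _ ↦ norm_nonneg _) fun i _ ↦
      norm_theta1_le (F.N i) (b i) hτ
  · exact isBigO_zero _ _

/-- The rank-one laws multiply to a Fourier transform on `∏ ℤ/N_i`. The Lagrangian correspondence
carries it to the Fourier transform on `A_L` and exchanges the square roots of the group orders. -/
theorem thetaUp_S (a : L.A) (τ : ℍ) :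
    I.thetaUp a (ModularGroup.S • τ)
      = ((-Complex.I * τ) ^ (1 / 2 : ℂ)) ^ (Module.finrank ℚ I.W)
        / (Real.sqrt (Fintype.card L.A) : ℂ) * ∑ b, e (L.pair a b) * I.thetaUp b τ := by
  classical
  obtain ⟨F⟩ := I.nonempty_orthFrame
  have hA : (Real.sqrt (Fintype.card L.A) : ℂ) ≠ 0 := by
    have : (0 : ℝ) < Fintype.card L.A := by exact_mod_cast Fintype.card_pos
    exact_mod_cast (Real.sqrt_pos.mpr this).ne'
  have hB : (∏ i, (Real.sqrt (F.N i) : ℂ)) = (Real.sqrt (Fintype.card (∀ i, ZMod (F.N i))) : ℂ) := by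
    rw [Fintype.card_pi]
    simp only [ZMod.card]
    push_cast
    rw [← Complex.ofReal_prod, Real.sqrt_prod _ fun i _ ↦ Nat.cast_nonneg _]
  have hB0 : (∏ i, (Real.sqrt (F.N i) : ℂ)) ≠ 0 := Finset.prod_ne_zero_iff.mpr fun i _ ↦ by
    have : (0 : ℝ) < F.N i := by exact_mod_cast Nat.pos_of_neZero (F.N i)
    exact_mod_cast (Real.sqrt_pos.mpr this).ne'
  have hcoe : ((ModularGroup.S • τ : ℍ) : ℂ) = -1 / τ := by
    rw [UpperHalfPlane.modular_S_smul]
    change (-(τ : ℂ))⁻¹ = _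
    rw [neg_div, one_div, inv_neg]
  have hprod : ∀ b : (∀ i, ZMod (F.N i)), ∏ i, theta1 (F.N i) (b i) (-1 / (τ : ℂ))
      = ((-Complex.I * τ) ^ (1 / 2 : ℂ)) ^ (Module.finrank ℚ I.W)
        / (∏ i, (Real.sqrt (F.N i) : ℂ)) * ∑ b' : (∀ i, ZMod (F.N i)),
          (∏ i, (ZMod.stdAddChar (b i * b' i))⁻¹) * ∏ i, theta1 (F.N i) (b' i) τ := by
    intro b
    simp_rw [theta1_neg_inv _ _ τ.im_pos]
    rw [Finset.prod_mul_distrib, Finset.prod_div_distrib, Finset.prod_const, Finset.card_univ,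
      Fintype.card_fin, Finset.prod_univ_sum, Fintype.piFinset_univ]
    simp_rw [Finset.prod_mul_distrib]
  have key := L.isBichar_pair.lagrangian_intertwines_apply
    (IsBichar.pi fun i ↦ isBichar_stdAddChar (F.N i)) F.isLagrangian_corr
    (fun b ↦ ∏ i, theta1 (F.N i) (b i) τ) a
  rw [F.thetaUp_eq, hcoe]
  simp_rw [hprod, F.thetaUp_eq _ τ]
  have pull : ∀ (c : ℂ) (g : (∀ i, ZMod (F.N i)) → ℂ),
      (∑ b, if (a, b) ∈ F.corr then c * g b else 0) = c * ∑ b, if (a, b) ∈ F.corr then g b else 0 := by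
    intro c g
    rw [Finset.mul_sum]
    exact Finset.sum_congr rfl fun b _ ↦ by split_ifs <;> simp
  rw [pull]
  rw [← hB] at key
  rw [div_mul_eq_mul_div, div_mul_eq_mul_div, div_eq_div_iff hB0 hA]
  linear_combination (((-Complex.I * τ) ^ (1 / 2 : ℂ)) ^ (Module.finrank ℚ I.W)) * key

/-- On the imaginary axis the theta series has nonnegative real values. -/
theorem exists_thetaUp_I_eq : ∃ t : L.A → ℝ, (∀ a, I.thetaUp a UpperHalfPlane.I = t a) ∧
    (∀ a, 0 ≤ t a) ∧ 0 < t 0 := by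
  have hterm : ∀ r : ℚ, qpow r UpperHalfPlane.I = ((Real.exp (-(2 * Real.pi * r)) : ℝ) : ℂ) := by
    intro r
    rw [qpow, Complex.ofReal_exp]
    congr 1
    push_cast
    linear_combination (2 * Real.pi * (r : ℂ)) * Complex.I_mul_I
  have hs : ∀ a, Summable fun k : I.thetaSet a ↦
      Real.exp (-(2 * Real.pi * ((-(I.formW k k) / 2 : ℚ) : ℝ))) := fun a ↦ by
    have := I.summable_thetaUp a UpperHalfPlane.I
    simp_rw [hterm] at this
    exact Complex.summable_ofReal.mp this
  refine ⟨fun a ↦ ∑' k : I.thetaSet a, Real.exp (-(2 * Real.pi * ((-(I.formW k k) / 2 : ℚ) : ℝ))),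
    fun a ↦ ?_, fun a ↦ tsum_nonneg fun _ ↦ (Real.exp_pos _).le, ?_⟩
  · rw [thetaUp, Complex.ofReal_tsum]
    exact tsum_congr fun k ↦ hterm _
  · exact (hs 0).tsum_pos (fun _ ↦ (Real.exp_pos _).le)
      ⟨0, I.mem_thetaSet_zero (zero_mem _)⟩ (Real.exp_pos _)

end MaximalIsotropic

end EvenLattice

end ThetaProduct

end

noncomputable section

namespace ThetaProduct

/-! ### Functions on the upper half plane -/

theorem mdifferentiable_fun_sum {ι : Type*} (s : Finset ι) {f : ι → ℍ → ℂ}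
    (hf : ∀ i ∈ s, MDifferentiable 𝓘(ℂ) 𝓘(ℂ) (f i)) :
    MDifferentiable 𝓘(ℂ) 𝓘(ℂ) (fun τ ↦ ∑ i ∈ s, f i τ) := by
  simp_rw [UpperHalfPlane.mdifferentiable_iff] at hf ⊢
  exact DifferentiableOn.fun_sum hf

theorem mdifferentiable_fun_prod {ι : Type*} (s : Finset ι) {f : ι → ℍ → ℂ}
    (hf : ∀ i ∈ s, MDifferentiable 𝓘(ℂ) 𝓘(ℂ) (f i)) :
    MDifferentiable 𝓘(ℂ) 𝓘(ℂ) (fun τ ↦ ∏ i ∈ s, f i τ) := by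
  simp_rw [UpperHalfPlane.mdifferentiable_iff] at hf ⊢
  exact DifferentiableOn.fun_finsetProd hf

theorem mdifferentiable_fun_pow {f : ℍ → ℂ} (hf : MDifferentiable 𝓘(ℂ) 𝓘(ℂ) f) (n : ℕ) :
    MDifferentiable 𝓘(ℂ) 𝓘(ℂ) (fun τ ↦ f τ ^ n) := by
  rw [UpperHalfPlane.mdifferentiable_iff] at hf ⊢
  exact hf.pow n

theorem norm_qpow (r : ℚ) (τ : ℍ) : ‖qpow r τ‖ = Real.exp (-(2 * Real.pi * r * τ.im)) := by
  rw [qpow, Complex.norm_exp]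
  congr 1
  rw [show (2 * Real.pi * Complex.I * (r : ℂ) * (τ : ℂ))
    = ((2 * Real.pi * r : ℝ) : ℂ) * (Complex.I * τ) by push_cast; ring, Complex.re_ofReal_mul]
  simp

theorem qpow_mul (r s : ℚ) (τ : ℍ) : qpow r τ * qpow s τ = qpow (r + s) τ := by
  rw [qpow, qpow, qpow, ← Complex.exp_add]
  push_cast
  ring_nf

theorem MeromorphicAtCusp.of_isBigO_one {f : ℍ → ℂ} (hf : f =O[atImInfty] fun _ ↦ (1 : ℂ)) :
    MeromorphicAtCusp f := by
  refine ⟨0, hf.congr_right fun τ ↦ ?_⟩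
  simp [qpow]

theorem MeromorphicAtCusp.mul {f g : ℍ → ℂ} (hf : MeromorphicAtCusp f)
    (hg : MeromorphicAtCusp g) : MeromorphicAtCusp (fun τ ↦ f τ * g τ) := by
  obtain ⟨m, hm⟩ := hf
  obtain ⟨n, hn⟩ := hg
  refine ⟨m + n, (hm.mul hn).congr_right fun τ ↦ ?_⟩
  rw [qpow_mul]
  push_cast
  ring_nf

theorem MeromorphicAtCusp.sum {ι : Type*} (s : Finset ι) {f : ι → ℍ → ℂ}
    (hf : ∀ i ∈ s, MeromorphicAtCusp (f i)) : MeromorphicAtCusp (fun τ ↦ ∑ i ∈ s, f i τ) := by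
  classical
  induction s using Finset.induction_on with
  | empty => simpa using meromorphicAtCusp_zero
  | insert i s hi ih =>
    simp_rw [Finset.sum_insert hi]
    exact (hf i (Finset.mem_insert_self i s)).add
      (ih fun j hj ↦ hf j (Finset.mem_insert_of_mem hj))

theorem MeromorphicAtCusp.pow {f : ℍ → ℂ} (hf : MeromorphicAtCusp f) (n : ℕ) :
    MeromorphicAtCusp (fun τ ↦ f τ ^ n) := by
  induction n with
  | zero =>
    simp_rw [pow_zero]
    exact .of_isBigO_one (isBigO_refl _ _)
  | succ n ih =>
    simp_rw [pow_succ]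
    exact ih.mul hf

theorem invariant_of_generators {α : Type*} {f : ℍ → α}
    (hS : ∀ τ, f (ModularGroup.S • τ) = f τ) (hT : ∀ τ, f (ModularGroup.T • τ) = f τ)
    (g : SL(2, ℤ)) (τ : ℍ) : f (g • τ) = f τ := by
  have hg : g ∈ Subgroup.closure {ModularGroup.S, ModularGroup.T} := by
    rw [SpecialLinearGroup.SL2Z_generators]; trivial
  induction hg using Subgroup.closure_induction generalizing τ with
  | mem g hg =>
    rcases hg with rfl | rfl
    · exact hS τ
    · exact hT τ
  | one => rw [one_smul]
  | mul g h _ _ hg hh => rw [mul_smul, hg, hh]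
  | inv g _ hg => rw [← hg, smul_inv_smul]

/-- For `τ` in the upper half plane, `arg τ - π/2` stays in the principal range, so the logarithms
add. The factor is the eighth root of unity in `ρ_L(S)`. -/
theorem cpow_half_neg_I_mul (τ : ℍ) : (-Complex.I * (τ : ℂ)) ^ (1 / 2 : ℂ)
    = e ((-1 / 8 : ℚ) : AddCircle (1 : ℚ)) * (τ : ℂ) ^ (2⁻¹ : ℂ) := by
  have hτ : (τ : ℂ) ≠ 0 := τ.ne_zero
  have hI : -Complex.I ≠ 0 := neg_ne_zero.mpr Complex.I_ne_zero
  have h0 : 0 < (τ : ℂ).arg := by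
    refine lt_of_le_of_ne (Complex.arg_nonneg_iff.mpr τ.im_pos.le) fun h ↦ ?_
    exact τ.im_ne_zero (Complex.arg_eq_zero_iff.mp h.symm).2
  have h1 := Complex.arg_le_pi (τ : ℂ)
  have hpi := Real.pi_pos
  have hlog : Complex.log (-Complex.I * τ) = Complex.log (-Complex.I) + Complex.log τ := by
    refine Complex.log_mul hI hτ ?_
    rw [Complex.arg_neg_I]
    constructor <;> linarith
  rw [Complex.cpow_def_of_ne_zero (mul_ne_zero hI hτ), Complex.cpow_def_of_ne_zero hτ, e_coe,
    ← Complex.exp_add, hlog, Complex.log_neg_I]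
  congr 1
  push_cast
  ring

theorem cpow_half_sq (τ : ℍ) : ((τ : ℂ) ^ (2⁻¹ : ℂ)) ^ 2 = τ := by
  simp

theorem cpow_half_ne_zero (τ : ℍ) : (τ : ℂ) ^ (2⁻¹ : ℂ) ≠ 0 := fun h ↦
  τ.ne_zero (by rw [← cpow_half_sq, h]; simp)

theorem e_eighth_pow (n : ℕ) : e ((-1 / 8 : ℚ) : AddCircle (1 : ℚ)) ^ n
    = e ((-(n : ℚ) / 8 : ℚ) : AddCircle (1 : ℚ)) := by
  rw [← e_nsmul, ← AddCircle.coe_nsmul]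
  congr 2
  rw [nsmul_eq_mul]
  ring

theorem e_eighth_pow_eight : e ((-1 / 8 : ℚ) : AddCircle (1 : ℚ)) ^ 8 = 1 := by
  rw [e_eighth_pow, e_coe_eq_one_iff]
  exact ⟨-1, by norm_num⟩

namespace IsBichar

/-- The Fourier transform is an isometry for the standard bilinear pairing, up to sign. -/
theorem sum_fourier_mul_fourier {A : Type*} [AddCommGroup A] [Fintype A] {χ : A → A → ℂ}
    (hχ : IsBichar χ) (u w : A → ℂ) :
    ∑ a, (∑ b, (χ b a)⁻¹ * u b) * (∑ d, χ a d * w d) = Fintype.card A * ∑ a, u a * w a := by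
  classical
  simp_rw [Finset.sum_mul_sum]
  rw [Finset.sum_comm, Finset.mul_sum]
  refine Finset.sum_congr rfl fun b _ ↦ ?_
  rw [Finset.sum_comm]
  have : ∀ d, ∑ a, (χ b a)⁻¹ * u b * (χ a d * w d)
      = (if b = d then (Fintype.card A : ℂ) else 0) * (u b * w d) := fun d ↦ by
    rw [← hχ.sum_inv_mul b d, Finset.sum_mul]
    exact Finset.sum_congr rfl fun a _ ↦ by ring
  simp_rw [this]
  simp

end IsBichar

/-! ### Modularity of `ξ(f)` and the left unit criterion -/

namespace EvenLattice

variable {V : Type*} [AddCommGroup V] [Module ℚ V] (L : EvenLattice V)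

theorem sqrt_card_ne_zero : (Real.sqrt (Fintype.card L.A) : ℂ) ≠ 0 := by
  have : (0 : ℝ) < Fintype.card L.A := by exact_mod_cast Fintype.card_pos
  exact_mod_cast (Real.sqrt_pos.mpr this).ne'

theorem sqrt_card_sq : (Real.sqrt (Fintype.card L.A) : ℂ) ^ 2 = Fintype.card L.A := by
  have : (Real.sqrt (Fintype.card L.A)) ^ 2 = Fintype.card L.A := Real.sq_sqrt (Nat.cast_nonneg _)
  exact_mod_cast congrArg (fun x : ℝ ↦ (x : ℂ)) this

theorem weilS_apply (v : L.A → ℂ) (m : L.A) : L.weilS v m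
    = e ((-(L.sigma : ℚ) / 8 : ℚ) : AddCircle (1 : ℚ)) / (Real.sqrt (Fintype.card L.A) : ℂ)
      * ∑ l, e (-(L.pair l m)) * v l := rfl

variable {L} in
theorem MShriek_T {f : ℍ → L.A → ℂ} (hf : f ∈ L.MShriek) (τ : ℍ) (l : L.A) :
    f (ModularGroup.T • τ) l = e (L.q l) * f τ l := by
  have h := hf.2.1 (Mp2Z.T, L.weilT) (Submonoid.subset_closure (by simp)) τ
  have h' := congrFun h l
  simpa [Mp2Z.T, weilT] using h'

variable {L} in
theorem MShriek_S {f : ℍ → L.A → ℂ} (hf : f ∈ L.MShriek) (τ : ℍ) (l : L.A) :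
    f (ModularGroup.S • τ) l = ((τ : ℂ) ^ (2⁻¹ : ℂ)) ^ L.sigma * L.weilS (f τ) l := by
  have h := hf.2.1 (Mp2Z.S, L.weilS) (Submonoid.subset_closure (by simp)) τ
  exact congrFun h l

variable {L} in
theorem mem_MShriek_of_generators {f : ℍ → L.A → ℂ}
    (hd : ∀ l, MDifferentiable 𝓘(ℂ) 𝓘(ℂ) (fun τ ↦ f τ l))
    (hT : ∀ τ l, f (ModularGroup.T • τ) l = e (L.q l) * f τ l)
    (hS : ∀ τ l, f (ModularGroup.S • τ) l
      = ((τ : ℂ) ^ (2⁻¹ : ℂ)) ^ L.sigma * L.weilS (f τ) l)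
    (hm : ∀ l, MeromorphicAtCusp (fun τ ↦ f τ l)) : f ∈ L.MShriek := by
  refine ⟨hd, fun x hx ↦ ?_, hm⟩
  induction hx using Submonoid.closure_induction with
  | mem x hx =>
    rcases hx with rfl | rfl
    · intro τ
      funext l
      simpa [Mp2Z.T, weilT] using hT τ l
    · intro τ
      funext l
      exact hS τ l
  | one =>
    intro τ
    simp [Mp2Z.one_mat, Mp2Z.one_phi]
  | mul x y _ _ hx hy =>
    intro τ
    simp only [Prod.fst_mul, Prod.snd_mul, Mp2Z.mul_mat, Mp2Z.mul_phi, mul_smul, hx, hy,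
      map_smul, Module.End.mul_apply, mul_zpow]

namespace MaximalIsotropic

variable {L} (I : L.MaximalIsotropic)

theorem sigma_eq : L.sigma = -(Module.finrank ℚ I.W : ℤ) := by
  rw [I.finrank_W, neg_neg]

theorem xi_smul (g : ℍ → ℂ) (f : ℍ → L.A → ℂ) :
    I.xi (fun τ ↦ g τ • f τ) = fun τ ↦ g τ * I.xi f τ := by
  funext τ
  rw [xi_eq, xi_eq, Finset.mul_sum]
  exact Finset.sum_congr rfl fun a _ ↦ by simp [mul_assoc]

theorem xi_T {f : ℍ → L.A → ℂ} (hf : f ∈ L.MShriek) (τ : ℍ) :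
    I.xi f (ModularGroup.T • τ) = I.xi f τ := by
  rw [xi_eq, xi_eq]
  refine Finset.sum_congr rfl fun a _ ↦ ?_
  rw [MShriek_T hf, thetaUp_T, e_neg]
  have := e_ne_zero (L.q a)
  field_simp

/-- The two factors transform by inverse Fourier transforms, so the pairing is preserved. The
automorphy factors and eighth roots of unity cancel because `σ(L) = -n`. -/
theorem xi_S {f : ℍ → L.A → ℂ} (hf : f ∈ L.MShriek) (τ : ℍ) :
    I.xi f (ModularGroup.S • τ) = I.xi f τ := by
  rw [xi_eq, xi_eq]
  have hs := L.sqrt_card_ne_zero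
  have hs2 := L.sqrt_card_sq
  have key := L.isBichar_pair.sum_fourier_mul_fourier (f τ) (fun a ↦ I.thetaUp a τ)
  simp_rw [MShriek_S hf, I.thetaUp_S, weilS_apply, e_neg, cpow_half_neg_I_mul, I.sigma_eq]
  set n := Module.finrank ℚ I.W
  set s := (τ : ℂ) ^ (2⁻¹ : ℂ)
  have hs0 : s ≠ 0 := cpow_half_ne_zero τ
  have hc : e (((-((-(n : ℤ) : ℤ) : ℚ)) / 8 : ℚ) : AddCircle (1 : ℚ))
      = (e ((-1 / 8 : ℚ) : AddCircle (1 : ℚ)) ^ n)⁻¹ := by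
    rw [e_eighth_pow, ← e_neg, ← AddCircle.coe_neg]
    congr 2
    push_cast
    ring
  rw [hc]
  set c := e ((-1 / 8 : ℚ) : AddCircle (1 : ℚ))
  have hc0 : c ≠ 0 := e_ne_zero _
  have hterm : ∀ X Y : ℂ, s ^ (-(n : ℤ)) * ((c ^ n)⁻¹ / (Real.sqrt (Fintype.card L.A) : ℂ) * X)
      * ((c * s) ^ n / (Real.sqrt (Fintype.card L.A) : ℂ) * Y)
      = (Fintype.card L.A : ℂ)⁻¹ * (X * Y) := by
    intro X Y
    rw [← hs2, zpow_neg, zpow_natCast, mul_pow]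
    field_simp
  simp_rw [hterm]
  rw [← Finset.mul_sum, key, inv_mul_cancel_left₀]
  exact_mod_cast Fintype.card_ne_zero

theorem xi_mem_MShriek {f : ℍ → L.A → ℂ} (hf : f ∈ L.MShriek) :
    I.xi f ∈ ThetaProduct.MShriek := by
  have hxi : I.xi f = fun τ ↦ ∑ a, f τ a * I.thetaUp a τ := funext fun τ ↦ I.xi_eq f τ
  refine ⟨?_, fun g τ ↦ invariant_of_generators (I.xi_S hf) (I.xi_T hf) g τ, ?_⟩
  · rw [hxi]
    exact mdifferentiable_fun_sum _ fun a _ ↦ (hf.1 a).mul (I.mdifferentiable_thetaUp a)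
  · rw [hxi]
    exact .sum _ fun a _ ↦ (hf.2.2 a).mul (.of_isBigO_one (I.thetaUp_isBigO a))

theorem _root_.ThetaProduct.EvenLattice.smul_mem_MShriek {g : ℍ → ℂ}
    (hg : g ∈ ThetaProduct.MShriek) {f : ℍ → L.A → ℂ} (hf : f ∈ L.MShriek) :
    (fun τ ↦ g τ • f τ) ∈ L.MShriek := by
  refine mem_MShriek_of_generators (fun l ↦ hg.1.mul (hf.1 l)) (fun τ l ↦ ?_) (fun τ l ↦ ?_)
    fun l ↦ hg.2.2.mul (hf.2.2 l)
  · simp only [hg.2.1, Pi.smul_apply, smul_eq_mul, MShriek_T hf]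
    ring
  · simp only [hg.2.1, Pi.smul_apply, smul_eq_mul, MShriek_S hf, map_smul]
    ring

theorem hasLeftUnit_of_xi_eq_one {u : ℍ → L.A → ℂ} (hu : u ∈ L.MShriek)
    (h : I.xi u = fun _ ↦ 1) : I.HasLeftUnit :=
  ⟨u, hu, fun f _ ↦ by funext τ; simp [thetaProd, h]⟩

theorem one_mem_MShriek : (fun _ ↦ 1 : ℍ → ℂ) ∈ ThetaProduct.MShriek :=
  ⟨mdifferentiable_const, fun _ _ ↦ rfl, .of_isBigO_one (isBigO_refl _ _)⟩

/-- Given that `M^!(L)` is nonzero, a left unit is a preimage of `1` under `ξ`. -/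
theorem hasLeftUnit_iff {f₀ : ℍ → L.A → ℂ} (hf₀ : f₀ ∈ L.MShriek) (hne : f₀ ≠ 0) :
    I.HasLeftUnit ↔ ∀ g ∈ ThetaProduct.MShriek, ∃ f ∈ L.MShriek, I.xi f = g := by
  constructor
  · rintro ⟨u, hu, h⟩ g hg
    -- Holomorphic functions on `ℍ` have no zero divisors, so one nonzero component of `f₀` can be
    -- cancelled.
    have hu1 : I.xi u = fun _ ↦ 1 := by
      obtain ⟨τ₀, hτ₀⟩ := Function.ne_iff.mp hne
      obtain ⟨l, hl⟩ := Function.ne_iff.mp hτ₀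
      have hmul : (fun τ ↦ I.xi u τ - 1) * (fun τ ↦ f₀ τ l) = 0 := by
        funext τ
        have := congrFun (congrFun (h f₀ hf₀) τ) l
        simp only [thetaProd, Pi.smul_apply, smul_eq_mul] at this
        simp only [Pi.mul_apply, Pi.zero_apply]
        rw [sub_mul, this, one_mul, sub_self]
      rcases (UpperHalfPlane.mul_eq_zero_iff
        ((I.xi_mem_MShriek hu).1.sub mdifferentiable_const) (hf₀.1 l)).mp hmul with h1 | h1
      · funext τ
        exact sub_eq_zero.mp (congrFun h1 τ)
      · exact absurd (congrFun h1 τ₀) hl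
    refine ⟨fun τ ↦ g τ • u τ, smul_mem_MShriek hg hu, ?_⟩
    rw [xi_smul, hu1]
    simp
  · intro h
    obtain ⟨u, hu, hu1⟩ := h _ one_mem_MShriek
    exact I.hasLeftUnit_of_xi_eq_one hu hu1

end MaximalIsotropic

end EvenLattice

end ThetaProduct

end

noncomputable section

namespace ThetaProduct

/-! ### A Lagrangian correspondence between `A` and `A⁷`

For integers with `1 + a² + b² + c² + d²` annihilating `A`, left multiplication by the quaternion
`a + bi + cj + dk` is an anti-isometry of `A⁴`, and its graph is Lagrangian in `A⁸ = A × A⁷`. -/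

section Quaternion

variable {A C : Type*} [AddCommGroup A] [AddCommGroup C]

/-- The graph of left multiplication by `a + bi + cj + dk` on `A⁴`, as a subgroup of `A × A⁷`. -/
def quatGraph (A : Type*) [AddCommGroup A] (a b c d : ℤ) : AddSubgroup (A × (Fin 7 → A)) where
  carrier := {p | p.2 3 = a • p.1 - b • p.2 0 - c • p.2 1 - d • p.2 2 ∧
    p.2 4 = b • p.1 + a • p.2 0 - d • p.2 1 + c • p.2 2 ∧
    p.2 5 = c • p.1 + d • p.2 0 + a • p.2 1 - b • p.2 2 ∧
    p.2 6 = d • p.1 - c • p.2 0 + b • p.2 1 + a • p.2 2}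
  zero_mem' := by simp
  add_mem' := by
    rintro p r ⟨h1, h2, h3, h4⟩ ⟨h1', h2', h3', h4'⟩
    refine ⟨?_, ?_, ?_, ?_⟩ <;> simp only [Prod.fst_add, Prod.snd_add, Pi.add_apply, *] <;> module
  neg_mem' := by
    rintro p ⟨h1, h2, h3, h4⟩
    refine ⟨?_, ?_, ?_, ?_⟩ <;> simp only [Prod.fst_neg, Prod.snd_neg, Pi.neg_apply, *] <;> module

variable {a b c d : ℤ}

/-- Left multiplication by a quaternion scales the pairing on `A⁴` by its norm, so on the graph the
total pairing is a multiple of `1 +` norm. -/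
theorem quatGraph_pair (P : A →+ A →+ C)
    (hP : ∀ u v, (1 + a ^ 2 + b ^ 2 + c ^ 2 + d ^ 2) • P u v = 0) {p r : A × (Fin 7 → A)}
    (hp : p ∈ quatGraph A a b c d) (hr : r ∈ quatGraph A a b c d) :
    P r.1 p.1 + ∑ i, P (r.2 i) (p.2 i) = 0 := by
  obtain ⟨h1, h2, h3, h4⟩ := hp
  obtain ⟨h1', h2', h3', h4'⟩ := hr
  simp only [Fin.sum_univ_seven, h1, h2, h3, h4, h1', h2', h3', h4', map_add, map_sub, map_zsmul,
    AddMonoidHom.add_apply, AddMonoidHom.sub_apply, AddMonoidHom.zsmul_apply]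
  linear_combination (norm := module) hP r.1 p.1 + hP (r.2 0) (p.2 0) + hP (r.2 1) (p.2 1)
    + hP (r.2 2) (p.2 2)

theorem quatGraph_quadratic (q : A → C) (P : A →+ A →+ C)
    (hadd : ∀ u v, q (u + v) = q u + q v + P u v) (hsmul : ∀ (n : ℤ) u, q (n • u) = n ^ 2 • q u)
    (hq : ∀ u, (1 + a ^ 2 + b ^ 2 + c ^ 2 + d ^ 2) • q u = 0) {p : A × (Fin 7 → A)}
    (hp : p ∈ quatGraph A a b c d) :
    q p.1 + ∑ i, q (p.2 i) = 0 := by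
  obtain ⟨h1, h2, h3, h4⟩ := hp
  have hneg : ∀ u, q (-u) = q u := fun u ↦ by
    have := hsmul (-1) u
    simpa using this
  have hsub : ∀ u v, q (u - v) = q u + q v - P u v := fun u v ↦ by
    rw [sub_eq_add_neg, hadd, hneg, map_neg, sub_eq_add_neg]
  simp only [Fin.sum_univ_seven, h1, h2, h3, h4, hadd, hsub, hsmul, map_add, map_sub, map_zsmul,
    AddMonoidHom.add_apply, AddMonoidHom.sub_apply, AddMonoidHom.zsmul_apply]
  linear_combination (norm := module) hq p.1 + hq (p.2 0) + hq (p.2 1) + hq (p.2 2)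

/-- Write `p = (x, y)` with `x, y ∈ A⁴` and `α = a + bi + cj + dk`. Testing on the graph over each
coordinate gives `x + ᾱy = 0`; multiplying by `α`, whose norm acts as `-1`, gives `y = αx`. -/
theorem mem_quatGraph_of_pair (P : A →+ A →+ C) (hP : ∀ u, (∀ v, P v u = 0) → u = 0)
    (hA : ∀ u : A, (1 + a ^ 2 + b ^ 2 + c ^ 2 + d ^ 2) • u = 0) {p : A × (Fin 7 → A)}
    (h : ∀ r ∈ quatGraph A a b c d, P r.1 p.1 + ∑ i, P (r.2 i) (p.2 i) = 0) :
    p ∈ quatGraph A a b c d := by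
  have e0 : p.1 + a • p.2 3 + b • p.2 4 + c • p.2 5 + d • p.2 6 = 0 := by
    refine hP _ fun v ↦ ?_
    have := h (v, ![0, 0, 0, a • v, b • v, c • v, d • v]) (by simp [quatGraph])
    simpa [Fin.sum_univ_seven, add_assoc] using this
  have e1 : p.2 0 - b • p.2 3 + a • p.2 4 + d • p.2 5 - c • p.2 6 = 0 := by
    refine hP _ fun v ↦ ?_
    have := h (0, ![v, 0, 0, -b • v, a • v, d • v, -c • v]) (by simp [quatGraph])
    simpa [Fin.sum_univ_seven, add_assoc, sub_eq_add_neg] using this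
  have e2 : p.2 1 - c • p.2 3 - d • p.2 4 + a • p.2 5 + b • p.2 6 = 0 := by
    refine hP _ fun v ↦ ?_
    have := h (0, ![0, v, 0, -c • v, -d • v, a • v, b • v]) (by simp [quatGraph])
    simpa [Fin.sum_univ_seven, add_assoc, sub_eq_add_neg] using this
  have e3 : p.2 2 - d • p.2 3 + c • p.2 4 - b • p.2 5 + a • p.2 6 = 0 := by
    refine hP _ fun v ↦ ?_
    have := h (0, ![0, 0, v, -d • v, c • v, -b • v, a • v]) (by simp [quatGraph])
    simpa [Fin.sum_univ_seven, add_assoc, sub_eq_add_neg] using this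
  refine ⟨?_, ?_, ?_, ?_⟩
  · linear_combination (norm := module) hA (p.2 3) - a • e0 + b • e1 + c • e2 + d • e3
  · linear_combination (norm := module) hA (p.2 4) - b • e0 - a • e1 + d • e2 - c • e3
  · linear_combination (norm := module) hA (p.2 5) - c • e0 - d • e1 - a • e2 + b • e3
  · linear_combination (norm := module) hA (p.2 6) - d • e0 + c • e1 - b • e2 - a • e3

end Quaternion

namespace EvenLattice

variable {V : Type*} [AddCommGroup V] [Module ℚ V] (L : EvenLattice V)

/-- The pairing of the discriminant group as a biadditive map. -/
def pairHom : L.A →+ L.A →+ AddCircle (1 : ℚ) :=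
  AddMonoidHom.mk' (fun a ↦ AddMonoidHom.mk' (L.pair a) (L.pair_add_right a)) fun a b ↦ by
    ext c
    exact L.pair_add_left a b c

theorem pairHom_apply (a b : L.A) : L.pairHom a b = L.pair a b := rfl

theorem q_add (a b : L.A) : L.q (a + b) = L.q a + L.q b + L.pair a b := by
  obtain ⟨x, rfl⟩ := L.cls_surjective a
  obtain ⟨y, rfl⟩ := L.cls_surjective b
  rw [← cls_add, q_cls, q_cls, q_cls, pair_cls, ← AddCircle.coe_add, ← AddCircle.coe_add]
  congr 1
  have := L.form_comm x y
  simp only [Submodule.coe_add, map_add, LinearMap.add_apply]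
  linarith

theorem q_zsmul (n : ℤ) (a : L.A) : L.q (n • a) = n ^ 2 • L.q a := by
  obtain ⟨x, rfl⟩ := L.cls_surjective a
  have h : n • L.cls x = L.cls (n • x) := rfl
  rw [h, q_cls, q_cls, ← AddCircle.coe_zsmul]
  congr 1
  simp only [Submodule.coe_smul, map_zsmul, LinearMap.smul_apply, zsmul_eq_mul]
  push_cast
  ring

theorem card_smul (a : L.A) : (Fintype.card L.A : ℤ) • a = 0 := by
  rw [natCast_zsmul]
  exact card_nsmul_eq_zero

/-- `2|A| · (x, x)/2 = (x, |A| x)` with `|A| x ∈ L`. The factor `2` is there because `|A|` alone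
need not kill the quadratic form. -/
theorem two_card_smul_q (a : L.A) : (2 * Fintype.card L.A : ℤ) • L.q a = 0 := by
  obtain ⟨x, rfl⟩ := L.cls_surjective a
  have h := L.card_smul (L.cls x)
  have h' : (Fintype.card L.A : ℤ) • (x : V) ∈ L.carrier := L.cls_eq_zero_iff.mp h
  obtain ⟨m, hm⟩ := L.dual_pair x.2 h'
  rw [q_cls, ← AddCircle.coe_zsmul, ← e_eq_one_iff, e_coe_eq_one_iff]
  refine ⟨m, ?_⟩
  rw [← hm, map_zsmul, zsmul_eq_mul, zsmul_eq_mul]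
  push_cast
  ring

theorem exists_four_squares : ∃ a b c d : ℤ,
    1 + a ^ 2 + b ^ 2 + c ^ 2 + d ^ 2 = 2 * Fintype.card L.A := by
  -- The natural subtraction is harmless, as `|A| > 0`.
  obtain ⟨a, b, c, d, h⟩ := Nat.sum_four_squares (2 * Fintype.card L.A - 1)
  have hpos : 0 < Fintype.card L.A := Fintype.card_pos
  refine ⟨a, b, c, d, ?_⟩
  have h2 : 1 + a ^ 2 + b ^ 2 + c ^ 2 + d ^ 2 = 2 * Fintype.card L.A := by omega
  exact_mod_cast h2

/-- Inverting the bicharacter on the first factor turns the Lagrangian condition into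
self-orthogonality in `A⁸`. It also makes the resulting transform on `A` the one in `ρ_L(S)` rather
than its dual. -/
theorem isLagrangian_quatGraph {a b c d : ℤ}
    (h : 1 + a ^ 2 + b ^ 2 + c ^ 2 + d ^ 2 = 2 * Fintype.card L.A) :
    IsBichar.IsLagrangian (fun x y ↦ (e (L.pair x y))⁻¹)
      (fun u v : Fin 7 → L.A ↦ ∏ i, e (L.pair (u i) (v i))) (quatGraph L.A a b c d) := by
  have hA : ∀ u : L.A, (1 + a ^ 2 + b ^ 2 + c ^ 2 + d ^ 2) • u = 0 := fun u ↦ by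
    rw [h, mul_smul, L.card_smul, smul_zero]
  have hiff : ∀ p r : L.A × (Fin 7 → L.A),
      (e (L.pair r.1 p.1))⁻¹ = ∏ i, e (L.pair (r.2 i) (p.2 i)) ↔
        L.pairHom r.1 p.1 + ∑ i, L.pairHom (r.2 i) (p.2 i) = 0 := fun p r ↦ by
    rw [← e_sum, ← e_eq_one_iff, e_add]
    simp only [pairHom_apply]
    exact ⟨fun h ↦ by rw [← h, mul_inv_cancel₀ (e_ne_zero _)], inv_eq_of_mul_eq_one_right⟩
  intro p
  constructor
  · intro hp r hr
    refine (hiff p r).mpr (quatGraph_pair L.pairHom (fun u v ↦ ?_) hp hr)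
    rw [← AddMonoidHom.zsmul_apply, ← map_zsmul, hA, map_zero, AddMonoidHom.zero_apply]
  · intro hp
    refine mem_quatGraph_of_pair L.pairHom (fun u hu ↦ L.pair_nondeg fun v ↦ ?_) hA
      fun r hr ↦ (hiff p r).mp (hp r hr)
    rw [L.pair_comm]
    exact hu v

theorem sum_q_quatGraph {a b c d : ℤ}
    (h : 1 + a ^ 2 + b ^ 2 + c ^ 2 + d ^ 2 = 2 * Fintype.card L.A) {p : L.A × (Fin 7 → L.A)}
    (hp : p ∈ quatGraph L.A a b c d) : L.q p.1 + ∑ i, L.q (p.2 i) = 0 :=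
  quatGraph_quadratic L.q L.pairHom L.q_add L.q_zsmul
    (fun u ↦ by rw [h, L.two_card_smul_q]) hp

end EvenLattice

/-! ### A nonvanishing weight `-4` factor -/

/-- `E₄² / Δ`, weakly holomorphic of weight `-4`. -/
def weightFactor (τ : ℍ) : ℂ := ModularForm.E₄ τ ^ 2 / ModularForm.discriminant τ

theorem mdifferentiable_discriminant :
    MDifferentiable 𝓘(ℂ) 𝓘(ℂ) ModularForm.discriminant := CuspForm.discriminant.holo'

theorem mdifferentiable_weightFactor : MDifferentiable 𝓘(ℂ) 𝓘(ℂ) weightFactor := by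
  have h1 := mdifferentiable_fun_pow ModularForm.E₄.holo' 2
  have h2 := mdifferentiable_discriminant
  rw [UpperHalfPlane.mdifferentiable_iff] at h1 h2 ⊢
  exact h1.div h2 fun z _ ↦ ModularForm.discriminant_ne_zero _

open scoped ModularForm in
theorem apply_smul_of_slash {f : ℍ → ℂ} {k : ℤ} {g : SL(2, ℤ)} (h : f ∣[k] g = f) (τ : ℍ) :
    f (g • τ) = denom (g : GL (Fin 2) ℝ) τ ^ k * f τ := by
  have h1 := congrFun h τ
  rw [ModularForm.SL_slash_apply] at h1
  rw [← h1, mul_comm, mul_assoc, ← zpow_add₀ (denom_ne_zero _ _), neg_add_cancel, zpow_zero,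
    mul_one]

theorem discriminant_S (τ : ℍ) : ModularForm.discriminant (ModularGroup.S • τ)
    = (τ : ℂ) ^ 12 * ModularForm.discriminant τ := by
  rw [apply_smul_of_slash ModularForm.discriminant_S_invariant, ModularGroup.denom_S]
  rfl

theorem discriminant_T (τ : ℍ) : ModularForm.discriminant (ModularGroup.T • τ)
    = ModularForm.discriminant τ := by
  rw [apply_smul_of_slash ModularForm.discriminant_T_invariant, ModularGroup.denom_apply]
  simp [ModularGroup.T]

open scoped ModularForm in
theorem E₄_slash (g : SL(2, ℤ)) : (ModularForm.E₄ : ℍ → ℂ) ∣[(4 : ℤ)] g = ModularForm.E₄ :=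
  ModularForm.E₄.slash_action_eq' _ ⟨g, rfl⟩

theorem weightFactor_S (τ : ℍ) :
    weightFactor (ModularGroup.S • τ) = ((τ : ℂ) ^ 4)⁻¹ * weightFactor τ := by
  have hE : ModularForm.E₄ (ModularGroup.S • τ) = (τ : ℂ) ^ 4 * ModularForm.E₄ τ := by
    rw [apply_smul_of_slash (E₄_slash _), ModularGroup.denom_S]
    rfl
  have := τ.ne_zero
  have := ModularForm.discriminant_ne_zero τ
  rw [weightFactor, weightFactor, hE, discriminant_S]
  field_simp

theorem weightFactor_T (τ : ℍ) : weightFactor (ModularGroup.T • τ) = weightFactor τ := by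
  have hE : ModularForm.E₄ (ModularGroup.T • τ) = ModularForm.E₄ τ := by
    rw [apply_smul_of_slash (E₄_slash _), ModularGroup.denom_apply]
    simp [ModularGroup.T]
  rw [weightFactor, weightFactor, hE, discriminant_T]

theorem meromorphicAtCusp_weightFactor : MeromorphicAtCusp weightFactor := by
  have h1 : MeromorphicAtCusp (ModularForm.E₄ : ℍ → ℂ) := by
    refine .of_isBigO_one ?_
    have : IsBoundedAtImInfty (ModularForm.E₄ : ℍ → ℂ) := ModularFormClass.bdd_at_infty _
    exact (this : _ =O[atImInfty] (1 : ℍ → ℝ)).trans (isBigO_of_le _ fun _ ↦ by simp)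
  have h2 : MeromorphicAtCusp (fun τ ↦ (ModularForm.discriminant τ)⁻¹) := by
    refine ⟨1, (ModularForm.exp_isBigO_discriminant.inv_rev ?_).trans ?_⟩
    · exact Eventually.of_forall fun τ h ↦ absurd h (Real.exp_pos _).ne'
    · refine isBigO_of_le _ fun τ ↦ ?_
      rw [norm_qpow, norm_inv, Real.norm_of_nonneg (Real.exp_pos _).le, ← Real.exp_neg]
      apply le_of_eq
      congr 1
      push_cast
      ring
  have := (h1.pow 2).mul h2
  simp only [← div_eq_mul_inv] at this
  exact this

namespace EvenLattice

namespace MaximalIsotropic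

variable {V : Type*} [AddCommGroup V] [Module ℚ V] {L : EvenLattice V} (I : L.MaximalIsotropic)

/-! ### A nonzero element of `M^!(L)` -/

open Classical in
/-- A form of type `ρ_L` and weight `7 rk(K)/2`, from seven copies of the theta series. -/
def quatTheta (a b c d : ℤ) (τ : ℍ) (x : L.A) : ℂ :=
  ∑ u : Fin 7 → L.A, if (x, u) ∈ quatGraph L.A a b c d then ∏ i, I.thetaUp (u i) τ else 0

variable {a b c d : ℤ}

theorem quatTheta_T (h : 1 + a ^ 2 + b ^ 2 + c ^ 2 + d ^ 2 = 2 * Fintype.card L.A)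
    (τ : ℍ) (x : L.A) :
    I.quatTheta a b c d (ModularGroup.T • τ) x = e (L.q x) * I.quatTheta a b c d τ x := by
  classical
  rw [quatTheta, quatTheta, Finset.mul_sum]
  refine Finset.sum_congr rfl fun u _ ↦ ?_
  split_ifs with hu
  · have := L.sum_q_quatGraph h hu
    simp_rw [thetaUp_T]
    rw [Finset.prod_mul_distrib, ← e_sum, Finset.sum_neg_distrib, ← eq_neg_of_add_eq_zero_left this]
  · simp

/-- The seventh tensor power of `thetaUp_S`, transported along the quaternion graph. Of the seven
factors `|A|^{-1/2}`, the comparison of group orders leaves exactly one. -/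
theorem quatTheta_S (h : 1 + a ^ 2 + b ^ 2 + c ^ 2 + d ^ 2 = 2 * Fintype.card L.A)
    (τ : ℍ) (x : L.A) :
    I.quatTheta a b c d (ModularGroup.S • τ) x
      = (((-Complex.I * τ) ^ (1 / 2 : ℂ)) ^ (Module.finrank ℚ I.W)) ^ 7
        / (Real.sqrt (Fintype.card L.A) : ℂ)
        * ∑ y, e (-(L.pair y x)) * I.quatTheta a b c d τ y := by
  classical
  have hprod : ∀ u : Fin 7 → L.A, ∏ i, I.thetaUp (u i) (ModularGroup.S • τ)
      = ((((-Complex.I * τ) ^ (1 / 2 : ℂ)) ^ (Module.finrank ℚ I.W))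
        / (Real.sqrt (Fintype.card L.A) : ℂ)) ^ 7 * ∑ v : Fin 7 → L.A,
          (∏ i, e (L.pair (u i) (v i))) * ∏ i, I.thetaUp (v i) τ := by
    intro u
    simp_rw [thetaUp_S]
    rw [Finset.prod_mul_distrib, Finset.prod_const, Finset.card_univ,
      Fintype.card_fin, Finset.prod_univ_sum, Fintype.piFinset_univ]
    simp_rw [Finset.prod_mul_distrib]
  have key := L.isBichar_pair.inv.lagrangian_intertwines_apply
    (IsBichar.pi fun _ : Fin 7 ↦ L.isBichar_pair) (L.isLagrangian_quatGraph h)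
    (fun u ↦ ∏ i, I.thetaUp (u i) τ) x
  have hcard : (Real.sqrt (Fintype.card (Fin 7 → L.A)) : ℂ)
      = (Real.sqrt (Fintype.card L.A) : ℂ) ^ 7 := by
    rw [Fintype.card_fun, Fintype.card_fin]
    push_cast
    rw [← Complex.ofReal_pow]
    congr 1
    rw [Real.sqrt_eq_iff_mul_self_eq (by positivity) (by positivity), ← mul_pow,
      Real.mul_self_sqrt (Nat.cast_nonneg _)]
  have pull : ∀ (c' : ℂ) (g : (Fin 7 → L.A) → ℂ),
      (∑ u, if (x, u) ∈ quatGraph L.A a b c d then c' * g u else 0)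
        = c' * ∑ u, if (x, u) ∈ quatGraph L.A a b c d then g u else 0 := by
    intro c' g
    rw [Finset.mul_sum]
    exact Finset.sum_congr rfl fun b _ ↦ by split_ifs <;> simp
  have hs := L.sqrt_card_ne_zero
  rw [quatTheta]
  simp_rw [hprod]
  rw [pull]
  rw [hcard] at key
  have hR : ∑ y, e (-(L.pair y x)) * I.quatTheta a b c d τ y
      = ∑ y, (e (L.pair x y))⁻¹ * ∑ u : Fin 7 → L.A,
        if (y, u) ∈ quatGraph L.A a b c d then ∏ i, I.thetaUp (u i) τ else 0 := by
    refine Finset.sum_congr rfl fun y _ ↦ ?_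
    rw [e_neg, L.pair_comm, quatTheta]
  rw [hR]
  rw [div_pow, div_mul_eq_mul_div, div_mul_eq_mul_div, div_eq_div_iff (pow_ne_zero 7 hs) hs]
  linear_combination
    ((((-Complex.I * τ) ^ (1 / 2 : ℂ)) ^ (Module.finrank ℚ I.W)) ^ 7) * key

theorem mdifferentiable_quatTheta (x : L.A) :
    MDifferentiable 𝓘(ℂ) 𝓘(ℂ) (fun τ ↦ I.quatTheta a b c d τ x) := by
  refine mdifferentiable_fun_sum _ fun u _ ↦ ?_
  split_ifs
  · exact mdifferentiable_fun_prod _ fun i _ ↦ I.mdifferentiable_thetaUp (u i)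
  · exact mdifferentiable_const

theorem quatTheta_isBigO (x : L.A) :
    (fun τ ↦ I.quatTheta a b c d τ x) =O[atImInfty] fun _ ↦ (1 : ℂ) := by
  refine IsBigO.fun_sum fun u _ ↦ ?_
  split_ifs
  · have := IsBigO.finsetProd (s := Finset.univ) fun i _ ↦ I.thetaUp_isBigO (u i)
    simpa using this
  · exact isBigO_zero _ _

theorem exists_quatTheta_I_eq (a b c d : ℤ) : ∃ t : L.A → ℝ,
    (∀ x, I.quatTheta a b c d UpperHalfPlane.I x = t x) ∧ (∀ x, 0 ≤ t x) ∧ 0 < t 0 := by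
  classical
  obtain ⟨t, ht, hnn, hpos⟩ := I.exists_thetaUp_I_eq
  refine ⟨fun x ↦ ∑ u : Fin 7 → L.A, if (x, u) ∈ quatGraph L.A a b c d then ∏ i, t (u i) else 0,
    fun x ↦ ?_, fun x ↦ ?_, ?_⟩
  · rw [quatTheta]
    simp_rw [ht]
    rw [Complex.ofReal_sum]
    refine Finset.sum_congr rfl fun u _ ↦ ?_
    split_ifs
    · push_cast; rfl
    · simp
  · exact Finset.sum_nonneg fun u _ ↦ by
      split_ifs
      · exact Finset.prod_nonneg fun i _ ↦ hnn _
      · exact le_rfl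
  · refine Finset.sum_pos' (fun u _ ↦ ?_) ⟨0, Finset.mem_univ _, ?_⟩
    · split_ifs
      · exact Finset.prod_nonneg fun i _ ↦ hnn _
      · exact le_rfl
    · have h0 : ((0 : L.A), (0 : Fin 7 → L.A)) ∈ quatGraph L.A a b c d := zero_mem _
      rw [if_pos h0]
      exact Finset.prod_pos fun i _ ↦ hpos

/-- The product of `quatTheta` with a power of `E₄² / Δ` lies in `M^!(L)`. -/
theorem quatTheta_mem_MShriek (h : 1 + a ^ 2 + b ^ 2 + c ^ 2 + d ^ 2 = 2 * Fintype.card L.A) :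
    (fun τ x ↦ weightFactor τ ^ Module.finrank ℚ I.W * I.quatTheta a b c d τ x) ∈ L.MShriek := by
  refine mem_MShriek_of_generators
    (fun l ↦ (mdifferentiable_fun_pow mdifferentiable_weightFactor _).mul
      (I.mdifferentiable_quatTheta l)) (fun τ l ↦ ?_) (fun τ l ↦ ?_)
    fun l ↦ (meromorphicAtCusp_weightFactor.pow _).mul (.of_isBigO_one (I.quatTheta_isBigO l))
  · rw [weightFactor_T, I.quatTheta_T h]
    ring
  · have hW : L.weilS (fun x ↦ weightFactor τ ^ Module.finrank ℚ I.W * I.quatTheta a b c d τ x) l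
        = weightFactor τ ^ Module.finrank ℚ I.W * L.weilS (I.quatTheta a b c d τ) l :=
      congrFun (map_smul L.weilS (weightFactor τ ^ Module.finrank ℚ I.W)
        (I.quatTheta a b c d τ)) l
    rw [hW, weightFactor_S, I.quatTheta_S h, weilS_apply, I.sigma_eq, cpow_half_neg_I_mul]
    have hs2 := cpow_half_sq τ
    have hs0 : (τ : ℂ) ^ (2⁻¹ : ℂ) ≠ 0 := cpow_half_ne_zero τ
    set n := Module.finrank ℚ I.W
    set s := (τ : ℂ) ^ (2⁻¹ : ℂ)
    have hc8 := e_eighth_pow_eight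
    have hc : e (((-((-(n : ℤ) : ℤ) : ℚ)) / 8 : ℚ) : AddCircle (1 : ℚ))
        = (e ((-1 / 8 : ℚ) : AddCircle (1 : ℚ)) ^ n)⁻¹ := by
      rw [e_eighth_pow, ← e_neg, ← AddCircle.coe_neg]
      congr 2
      push_cast
      ring
    rw [hc]
    set c' := e ((-1 / 8 : ℚ) : AddCircle (1 : ℚ))
    have hc0 : c' ≠ 0 := e_ne_zero _
    -- The choice of seven copies: `7 ≡ -1` modulo `8`, so the root of unity is the one required by
    -- `ρ_L`. The weights agree as `7n/2 - 4n = -n/2`.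
    have hc7 : (c' ^ n)⁻¹ = (c' ^ n) ^ 7 := by
      refine inv_eq_of_mul_eq_one_right ?_
      rw [← pow_succ', ← pow_mul, mul_comm, pow_mul, hc8, one_pow]
    rw [hc7, ← hs2, mul_pow, mul_pow, inv_pow, zpow_neg, zpow_natCast]
    have hs := L.sqrt_card_ne_zero
    field_simp
    ring

theorem weightFactor_ne_zero : weightFactor ≠ 0 := by
  intro h
  refine EisensteinSeries.E_ne_zero (k := 4) (by norm_num) ⟨2, rfl⟩ ?_
  ext τ
  have := congrFun h τ
  rw [weightFactor, Pi.zero_apply, div_eq_zero_iff] at this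
  exact pow_eq_zero_iff two_ne_zero |>.mp (this.resolve_right (ModularForm.discriminant_ne_zero τ))

theorem exists_ne_zero_mem_MShriek (I : L.MaximalIsotropic) : ∃ f ∈ L.MShriek, f ≠ 0 := by
  obtain ⟨a, b, c, d, h⟩ := L.exists_four_squares
  refine ⟨_, I.quatTheta_mem_MShriek h, fun h0 ↦ ?_⟩
  obtain ⟨t, ht, -, hpos⟩ := I.exists_quatTheta_I_eq a b c d
  have hmul : (fun τ ↦ weightFactor τ ^ Module.finrank ℚ I.W)
      * (fun τ ↦ I.quatTheta a b c d τ 0) = 0 := by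
    funext τ
    exact congrFun (congrFun h0 τ) 0
  rcases (UpperHalfPlane.mul_eq_zero_iff (mdifferentiable_fun_pow mdifferentiable_weightFactor _)
    (I.mdifferentiable_quatTheta 0)).mp hmul with h1 | h1
  · refine weightFactor_ne_zero ?_
    funext τ
    by_contra hne
    exact pow_ne_zero _ hne (congrFun h1 τ)
  · have := congrFun h1 UpperHalfPlane.I
    rw [ht, Pi.zero_apply, Complex.ofReal_eq_zero] at this
    exact hpos.ne' this

/-- With `n = 0` no power of `E₄²/Δ` is needed, so the form stays bounded. At `τ = i` its `ξ` is a
sum of nonnegative terms, and the one at `0` is positive. -/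
theorem exists_isLittleOQInv_of_sigma_eq_zero (hσ : L.sigma = 0) :
    ∃ f ∈ L.MShriek, f ∉ I.thetaPerp ∧ L.IsLittleOQInv f := by
  obtain ⟨a, b, c, d, h⟩ := L.exists_four_squares
  have hn : Module.finrank ℚ I.W = 0 := by
    have := I.finrank_W
    rw [hσ] at this
    omega
  have hmem := I.quatTheta_mem_MShriek h
  simp_rw [hn, pow_zero, one_mul] at hmem
  refine ⟨_, hmem, fun hperp ↦ ?_, fun l ↦ ?_⟩
  · obtain ⟨t, ht, hnn, hpos⟩ := I.exists_quatTheta_I_eq a b c d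
    obtain ⟨s, hs, hnn', hpos'⟩ := I.exists_thetaUp_I_eq
    have h0 := congrFun hperp.2 UpperHalfPlane.I
    rw [xi_eq] at h0
    simp_rw [ht, hs] at h0
    have h1 : ∑ x, t x * s x = 0 := by
      rw [Pi.zero_apply] at h0
      exact_mod_cast h0
    have h2 : 0 < ∑ x, t x * s x := Finset.sum_pos' (fun x _ ↦ mul_nonneg (hnn x) (hnn' x))
      ⟨0, Finset.mem_univ _, mul_pos hpos hpos'⟩
    exact h2.ne' h1
  · refine (I.quatTheta_isBigO l).trans_isLittleO ?_
    rw [isLittleO_const_left]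
    right
    have hq : (norm ∘ qpow (-1)) = fun τ : ℍ ↦ Real.exp (2 * Real.pi * τ.im) := by
      funext τ
      rw [Function.comp_apply, norm_qpow]
      congr 1
      push_cast
      ring
    rw [hq]
    refine Real.tendsto_exp_atTop.comp ?_
    exact tendsto_comap.const_mul_atTop (by positivity)

end MaximalIsotropic

end EvenLattice

end ThetaProduct

end

noncomputable section

namespace ThetaProduct

/-! ### Forms which are `o(q⁻¹)` at the cusp -/

theorem discriminant_isBigO_qpow : ModularForm.discriminant =O[atImInfty] qpow 1 := by
  have h := CuspFormClass.exp_decay_atImInfty (h := 1) CuspForm.discriminant one_pos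
    one_mem_strictPeriods_SL
  refine (h : ModularForm.discriminant =O[atImInfty] _).trans (isBigO_of_le _ fun τ ↦ ?_)
  rw [norm_qpow, Real.norm_of_nonneg (Real.exp_pos _).le]
  apply le_of_eq
  congr 1
  push_cast
  ring

theorem tendsto_mul_discriminant {f : ℍ → ℂ} (hf : f =o[atImInfty] qpow (-1)) :
    Tendsto (fun τ ↦ f τ * ModularForm.discriminant τ) atImInfty (𝓝 0) := by
  rw [← isLittleO_one_iff ℂ]
  refine (hf.mul_isBigO discriminant_isBigO_qpow).congr_right fun τ ↦ ?_
  rw [qpow_mul]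
  simp [qpow]

/-- A weakly holomorphic modular form of weight `0` which is `o(q⁻¹)` is constant. -/
theorem MShriek.exists_eq_const {f : ℍ → ℂ} (hf : f ∈ MShriek)
    (ho : f =o[atImInfty] qpow (-1)) : ∃ c : ℂ, f = fun _ ↦ c := by
  have hslash : ∀ γ : SL(2, ℤ), SlashAction.map (12 : ℤ) γ
      (fun τ ↦ f τ * ModularForm.discriminant τ) = fun τ ↦ f τ * ModularForm.discriminant τ := by
    intro γ
    funext τ
    have h := congrFun (SlashInvariantForm.slash_action_generators_SL2Z
      ModularForm.discriminant_S_invariant ModularForm.discriminant_T_invariant γ) τ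
    rw [ModularForm.SL_slash_apply] at h ⊢
    rw [hf.2.1, mul_assoc, h]
  -- Multiplication by `Δ` absorbs a pole of order less than one and lands in the one-dimensional
  -- space spanned by `Δ`.
  let F : CuspForm 𝒮ℒ 12 :=
    { toFun := fun τ ↦ f τ * ModularForm.discriminant τ
      slash_action_eq' := by
        rintro A ⟨γ, rfl⟩
        exact hslash γ
      holo' := hf.1.mul mdifferentiable_discriminant
      zero_at_cusps' := by
        intro c hc
        rw [Subgroup.IsArithmetic.isCusp_iff_isCusp_SL2Z] at hc
        rw [OnePoint.isZeroAt_iff_forall_SL2Z hc]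
        intro γ _
        rw [hslash]
        exact tendsto_mul_discriminant ho }
  obtain ⟨c, hc⟩ := CuspForm.exists_smul_discriminant_of_weight_eq_twelve F
  refine ⟨c, funext fun τ ↦ ?_⟩
  have h1 : c * ModularForm.discriminant τ = f τ * ModularForm.discriminant τ :=
    DFunLike.congr_fun hc τ
  exact (mul_right_cancel₀ (ModularForm.discriminant_ne_zero τ) h1).symm

/-- Maximum principle: a vector-valued function, whose norm is invariant under `τ ↦ τ + 1`, tends
to `0` at the cusp and is dominated by its values on `Im τ ≥ 1/2`, vanishes. -/
theorem eq_zero_of_norm_periodic {E : Type*} [NormedAddCommGroup E] [NormedSpace ℂ E]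
    {Φ : ℂ → E} (hd : DifferentiableOn ℂ Φ {z | 0 < z.im})
    (hT : ∀ τ : ℍ, ‖Φ ((ModularGroup.T • τ : ℍ) : ℂ)‖ = ‖Φ τ‖)
    (h0 : Tendsto (fun τ : ℍ ↦ ‖Φ τ‖) atImInfty (𝓝 0))
    (hle : ∀ τ : ℍ, ∃ τ' : ℍ, 1 / 2 ≤ τ'.im ∧ ‖Φ τ‖ ≤ ‖Φ τ'‖) (τ : ℍ) : Φ τ = 0 := by
  by_contra hne
  obtain ⟨τ₁, hτ₁, hle₁⟩ := hle τ
  have hpos : 0 < ‖Φ τ₁‖ := (norm_pos_iff.mpr hne).trans_le hle₁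
  -- Above height `Y` the norm is below `‖Φ τ₁‖`, so the supremum is sought on the compact box `C`,
  -- which meets every `T`-orbit of height in `[1/2, Y]`.
  obtain ⟨Y, hY⟩ := (atImInfty_mem _).mp (h0.eventually (gt_mem_nhds hpos))
  have hTz : ∀ (σ : ℍ) (n : ℤ), ‖Φ ((ModularGroup.T ^ n • σ : ℍ) : ℂ)‖ = ‖Φ σ‖ := by
    have hnat : ∀ (n : ℕ) (σ : ℍ), ‖Φ ((ModularGroup.T ^ n • σ : ℍ) : ℂ)‖ = ‖Φ σ‖ := by
      intro n
      induction n with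
      | zero => intro σ; rw [pow_zero, one_smul]
      | succ n ih => intro σ; rw [pow_succ, mul_smul, ih, hT]
    intro σ n
    obtain ⟨m, rfl | rfl⟩ := n.eq_nat_or_neg
    · rw [zpow_natCast, hnat]
    · rw [zpow_neg, zpow_natCast, ← hnat m, smul_inv_smul]
  let C : Set ℂ := Set.Icc (-1 / 2) (1 / 2) ×ℂ Set.Icc (1 / 2) Y
  have hCU : C ⊆ {z | 0 < z.im} := fun z hz ↦ by
    have : 1 / 2 ≤ z.im := hz.2.1
    change 0 < z.im
    linarith
  have hC : IsCompact C := isCompact_Icc.reProdIm isCompact_Icc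
  have htrans : ∀ σ : ℍ, 1 / 2 ≤ σ.im → σ.im ≤ Y → ∃ z ∈ C, ‖Φ z‖ = ‖Φ σ‖ := by
    intro σ h1 h2
    refine ⟨((ModularGroup.T ^ (-round σ.re) • σ : ℍ) : ℂ), ?_, hTz _ _⟩
    rw [modular_T_zpow_smul]
    have h3 := abs_le.mp (abs_sub_round σ.re)
    refine ⟨?_, ?_⟩
    · simp only [Set.mem_preimage, coe_vadd, Complex.add_re, Complex.ofReal_re, coe_re, Set.mem_Icc]
      push_cast
      constructor <;> linarith
    · simpa using ⟨by linarith, h2⟩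
  have hτ₁Y : τ₁.im ≤ Y := by
    by_contra hlt
    push Not at hlt
    exact lt_irrefl _ (show ‖Φ τ₁‖ < ‖Φ τ₁‖ from hY τ₁ hlt.le)
  obtain ⟨z₁, hz₁, hz₁'⟩ := htrans τ₁ hτ₁ hτ₁Y
  obtain ⟨z₀, hz₀, hmax⟩ := hC.exists_isMaxOn ⟨z₁, hz₁⟩ (hd.continuousOn.mono hCU).norm
  have hz₀pos : ‖Φ τ₁‖ ≤ ‖Φ z₀‖ := hz₁' ▸ hmax hz₁
  have hglob : IsMaxOn (norm ∘ Φ) {z : ℂ | 0 < z.im} z₀ := by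
    intro z hz
    obtain ⟨σ, hσ, hzσ⟩ := hle ⟨z, hz⟩
    refine le_trans hzσ ?_
    by_cases hσY : σ.im ≤ Y
    · obtain ⟨z', hz', hz''⟩ := htrans σ hσ hσY
      rw [← hz'']
      exact hmax hz'
    · push Not at hσY
      exact (hY σ hσY.le).le.trans hz₀pos
  have hconst := Complex.norm_eqOn_of_isPreconnected_of_isMaxOn
    (convex_halfSpace_im_gt 0).isPreconnected (isOpen_lt continuous_const Complex.continuous_im)
    hd (hCU hz₀) hglob
  -- The norm is constant by the maximum principle, yet strictly smaller at this high point.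
  let σ : ℍ := ⟨⟨0, max Y 1⟩, lt_of_lt_of_le one_pos (le_max_right Y 1)⟩
  have h1 := hconst (show ((σ : ℂ)) ∈ {z : ℂ | 0 < z.im} from σ.im_pos)
  have h2 : ‖Φ σ‖ < ‖Φ τ₁‖ := hY σ (le_max_left Y 1)
  have h3 : ‖Φ σ‖ = ‖Φ z₀‖ := h1
  linarith

/-! ### Left units from small poles, and vanishing for `σ(L) ≤ -24` -/

namespace EvenLattice

variable {V : Type*} [AddCommGroup V] [Module ℚ V] (L : EvenLattice V)

/-- `ρ_L(S)` is unitary. -/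
theorem sum_norm_sq_weilS (v : L.A → ℂ) : ∑ l, ‖L.weilS v l‖ ^ 2 = ∑ l, ‖v l‖ ^ 2 := by
  have h := L.isBichar_pair.inv.sum_norm_sq_fourier v
  have hpos : (0 : ℝ) < Fintype.card L.A := by exact_mod_cast Fintype.card_pos
  simp_rw [weilS_apply, norm_mul, mul_pow, norm_div, norm_e, e_neg]
  rw [← Finset.mul_sum, h, Complex.norm_real, Real.norm_of_nonneg (Real.sqrt_nonneg _), div_pow,
    Real.sq_sqrt hpos.le]
  field_simp

namespace MaximalIsotropic

variable {L} (I : L.MaximalIsotropic)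

theorem hasLeftUnit_of_isLittleOQInv {f : ℍ → L.A → ℂ} (hf : f ∈ L.MShriek)
    (hp : f ∉ I.thetaPerp) (ho : L.IsLittleOQInv f) : I.HasLeftUnit := by
  have hxi : I.xi f = fun τ ↦ ∑ a, f τ a * I.thetaUp a τ := funext fun τ ↦ I.xi_eq f τ
  have hxo : I.xi f =o[atImInfty] qpow (-1) := by
    rw [hxi]
    refine IsLittleO.fun_sum fun a _ ↦ ?_
    simpa using (ho a).mul_isBigO (I.thetaUp_isBigO a)
  obtain ⟨c, hc⟩ := MShriek.exists_eq_const (I.xi_mem_MShriek hf) hxo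
  have hc0 : c ≠ 0 := by
    rintro rfl
    exact hp ⟨hf, hc⟩
  refine I.hasLeftUnit_of_xi_eq_one (L.MShriek.smul_mem c⁻¹ hf) ?_
  have := I.xi_smul (fun _ ↦ c⁻¹) f
  rw [hc] at this
  simp only [inv_mul_cancel₀ hc0] at this
  exact this

/-- `fΔ` has weight `k = 12 + σ(L)/2 ≤ 0` for a unitary representation, so `‖fΔ‖² Im^k` is
invariant. As `k ≤ 0`, raising the imaginary part cannot lower `‖fΔ‖`, and the maximum principle
applies. -/
theorem eq_zero_of_isLittleOQInv {f : ℍ → L.A → ℂ} (hf : f ∈ L.MShriek)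
    (ho : L.IsLittleOQInv f) (hσ : L.sigma ≤ -24) : f = 0 := by
  let D := ModularForm.discriminant
  let Φ : ℂ → EuclideanSpace ℂ L.A := fun z ↦
    WithLp.toLp 2 fun l ↦ f (ofComplex z) l * D (ofComplex z)
  have hΦ : ∀ τ : ℍ, ‖Φ τ‖ ^ 2 = ∑ l, ‖f τ l‖ ^ 2 * ‖D τ‖ ^ 2 := fun τ ↦ by
    rw [EuclideanSpace.norm_sq_eq]
    simp only [Φ, ofComplex_apply, norm_mul, mul_pow]
  have hT : ∀ τ : ℍ, ‖Φ ((ModularGroup.T • τ : ℍ) : ℂ)‖ = ‖Φ τ‖ := fun τ ↦ by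
    rw [← sq_eq_sq₀ (norm_nonneg _) (norm_nonneg _), hΦ, hΦ]
    refine Finset.sum_congr rfl fun l _ ↦ ?_
    rw [MShriek_T hf, norm_mul, norm_e, one_mul, show D (ModularGroup.T • τ) = D τ from
      discriminant_T τ]
  have hS : ∀ τ : ℍ, ‖Φ ((ModularGroup.S • τ : ℍ) : ℂ)‖ ^ 2
      = ‖(τ : ℂ)‖ ^ (24 + L.sigma) * ‖Φ τ‖ ^ 2 := fun τ ↦ by
    have hn : ‖(τ : ℂ)‖ ≠ 0 := norm_ne_zero_iff.mpr τ.ne_zero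
    have hs : (‖(τ : ℂ) ^ (2⁻¹ : ℂ)‖ ^ L.sigma) ^ 2 = ‖(τ : ℂ)‖ ^ L.sigma := by
      rw [← zpow_natCast, ← zpow_mul, mul_comm, zpow_mul, zpow_natCast, ← norm_pow, cpow_half_sq]
    rw [hΦ, hΦ, ← Finset.sum_mul, ← Finset.sum_mul]
    simp_rw [MShriek_S hf, norm_mul, mul_pow, norm_zpow]
    rw [← Finset.mul_sum, sum_norm_sq_weilS, show D (ModularGroup.S • τ) = (τ : ℂ) ^ 12 * D τ from
      discriminant_S τ, norm_mul, norm_pow, hs, zpow_add₀ hn]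
    have : ‖(τ : ℂ)‖ ^ (24 : ℤ) = (‖(τ : ℂ)‖ ^ 12) ^ 2 := by
      rw [← pow_mul]; rfl
    rw [this]
    ring
  -- The invariant is squared once more so that the exponent `2k = 24 + σ(L)` is an integer even for
  -- half-integral weight.
  have hinv : ∀ (g : SL(2, ℤ)) (τ : ℍ),
      (‖Φ ((g • τ : ℍ) : ℂ)‖ ^ 2) ^ 2 * (g • τ).im ^ (24 + L.sigma)
        = (‖Φ τ‖ ^ 2) ^ 2 * τ.im ^ (24 + L.sigma) := by
    refine invariant_of_generators (f := fun τ : ℍ ↦ (‖Φ τ‖ ^ 2) ^ 2 * τ.im ^ (24 + L.sigma))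
      (fun τ ↦ ?_) (fun τ ↦ ?_)
    · have hn : ‖(τ : ℂ)‖ ≠ 0 := norm_ne_zero_iff.mpr τ.ne_zero
      rw [hS, ModularGroup.im_smul_eq_div_normSq, ModularGroup.denom_S, Complex.normSq_eq_norm_sq,
        div_zpow, mul_pow, ← zpow_natCast (‖(τ : ℂ)‖ ^ (24 + L.sigma)), ← zpow_mul,
        ← zpow_natCast ‖(τ : ℂ)‖ 2, ← zpow_mul, mul_comm (24 + L.sigma)]
      field_simp
    · rw [hT, ModularGroup.im_smul_eq_div_normSq, ModularGroup.denom_apply]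
      simp [ModularGroup.T]
  have hzero : ∀ τ : ℍ, Φ τ = 0 := by
    refine eq_zero_of_norm_periodic ?_ hT ?_ ?_
    · rw [differentiableOn_euclidean]
      intro l
      have := (hf.1 l).mul mdifferentiable_discriminant
      rw [UpperHalfPlane.mdifferentiable_iff] at this
      exact this
    · have h1 : Tendsto (fun τ : ℍ ↦ Real.sqrt (∑ l, ‖f τ l * D τ‖ ^ 2)) atImInfty
          (𝓝 (Real.sqrt (∑ _l : L.A, (0 : ℝ) ^ 2))) := by
        refine (Real.continuous_sqrt.tendsto _).comp (tendsto_finsetSum _ fun l _ ↦ ?_)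
        exact ((tendsto_zero_iff_norm_tendsto_zero.mp (tendsto_mul_discriminant (ho l)))).pow 2
      simp only [ne_eq, OfNat.ofNat_ne_zero, not_false_eq_true, zero_pow, Finset.sum_const_zero,
        Real.sqrt_zero] at h1
      refine h1.congr fun τ ↦ ?_
      rw [EuclideanSpace.norm_eq]
      simp only [Φ, ofComplex_apply]
    · intro τ
      obtain ⟨γ, hγ, hden⟩ := ModularGroup.exists_one_half_le_im_smul_and_norm_denom_le τ
      refine ⟨γ • τ, hγ, ?_⟩
      have h1 := hinv γ τ
      have him : τ.im ≤ (γ • τ).im := by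
        rw [ModularGroup.im_smul_eq_div_normSq, Complex.normSq_eq_norm_sq]
        have hd0 : 0 < ‖denom (γ : GL (Fin 2) ℝ) τ‖ := norm_pos_iff.mpr (denom_ne_zero _ _)
        rw [le_div_iff₀ (by positivity)]
        have : ‖denom (γ : GL (Fin 2) ℝ) τ‖ ^ 2 ≤ 1 := pow_le_one₀ hd0.le hden
        nlinarith [τ.im_pos]
      -- The bound `σ(L) ≤ -24` enters here: the exponent is nonpositive, so its sign favours the
      -- higher point.
      obtain ⟨m, hm⟩ : ∃ m : ℕ, 24 + L.sigma = -(m : ℤ) := ⟨(-(24 + L.sigma)).toNat, by omega⟩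
      rw [hm, zpow_neg, zpow_neg, zpow_natCast, zpow_natCast, ← div_eq_mul_inv, ← div_eq_mul_inv,
        div_eq_div_iff (by positivity) (by positivity)] at h1
      have hp : τ.im ^ m ≤ (γ • τ).im ^ m := pow_le_pow_left₀ τ.im_pos.le him m
      have h2 : (‖Φ τ‖ ^ 2) ^ 2 ≤ (‖Φ ((γ • τ : ℍ) : ℂ)‖ ^ 2) ^ 2 := by
        have hpos : 0 < τ.im ^ m := pow_pos τ.im_pos m
        refine le_of_mul_le_mul_right ?_ hpos
        rw [h1]
        exact mul_le_mul_of_nonneg_left hp (by positivity)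
      rw [← pow_mul, ← pow_mul] at h2
      exact (pow_le_pow_iff_left₀ (norm_nonneg _) (norm_nonneg _) (by norm_num)).mp h2
  funext τ l
  have h1 := hΦ τ
  rw [hzero τ, norm_zero, zero_pow two_ne_zero] at h1
  have h2 := (Finset.sum_eq_zero_iff_of_nonneg (fun l _ ↦ by positivity)).mp h1.symm l
    (Finset.mem_univ l)
  rw [← mul_pow, sq_eq_zero_iff, mul_eq_zero, norm_eq_zero, norm_eq_zero] at h2
  exact h2.resolve_right (ModularForm.discriminant_ne_zero τ)

end MaximalIsotropic

end EvenLattice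

end ThetaProduct

end

theorem mainTheorem4 {V : Type*} [AddCommGroup V] [Module ℚ V]
    (L : ThetaProduct.EvenLattice V) (hpq : L.sigP ≤ L.sigQ) (I : L.MaximalIsotropic) :
    -- `ξ` maps `M^!(L)` to `M^!`, and `M^!(L)` is closed under the `Θ`-product
    (∀ f ∈ L.MShriek, I.xi f ∈ ThetaProduct.MShriek) ∧
    (∀ f ∈ L.MShriek, ∀ g ∈ L.MShriek, I.thetaProd f g ∈ L.MShriek) ∧
    -- (1)
    (I.HasLeftUnit ↔ ∀ g ∈ ThetaProduct.MShriek, ∃ f ∈ L.MShriek, I.xi f = g) ∧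
    (L.sigma = 0 → I.HasLeftUnit) ∧
    -- (2)
    ((∃ f ∈ L.MShriek, f ∉ I.thetaPerp ∧ L.IsLittleOQInv f) → I.HasLeftUnit) ∧
    ((∃ f ∈ L.MShriek, f ∉ I.thetaPerp ∧ L.IsLittleOQInv f) → |L.sigma| < 24) := by
  have hunit : (∃ f ∈ L.MShriek, f ∉ I.thetaPerp ∧ L.IsLittleOQInv f) → I.HasLeftUnit :=
    fun ⟨_, hf, hp, ho⟩ ↦ I.hasLeftUnit_of_isLittleOQInv hf hp ho
  obtain ⟨f₀, hf₀, hne⟩ := I.exists_ne_zero_mem_MShriek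
  refine ⟨fun f hf ↦ I.xi_mem_MShriek hf,
    fun f hf g hg ↦ ThetaProduct.EvenLattice.smul_mem_MShriek (I.xi_mem_MShriek hf) hg,
    I.hasLeftUnit_iff hf₀ hne, fun hσ ↦ hunit (I.exists_isLittleOQInv_of_sigma_eq_zero hσ),
    hunit, ?_⟩
  rintro ⟨f, hf, hp, ho⟩
  by_contra hσ
  -- From `p ≤ q`, so failure of the bound means `σ(L) ≤ -24`; then `f = 0` and `ξ(f) = 0`.
  have hle : L.sigma ≤ 0 := by
    rw [ThetaProduct.EvenLattice.sigma]
    omega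
  rw [abs_of_nonpos hle] at hσ
  refine hp ⟨hf, ?_⟩
  rw [ThetaProduct.EvenLattice.MaximalIsotropic.eq_zero_of_isLittleOQInv hf ho (by omega)]
  funext τ
  simp [I.xi_eq]
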